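/- **Setting.** Let $k\in\{1,2,3\}$, $d\ge 1$. For $k=1$ let $D=(0,b)$ with $b>0$ and $G_D(x,y)=x\wedge y-\frac{xy}{b}$. For $k=2,3$ let $D\subset\mathbb R^k$ be a bounded domain with regular boundary (the Dirichlet problem on $D$ is solvable for all continuous boundary values), and let $G_D(x,y)=\Gamma(|x-y|)-h_y(x)$ be its Green function, where $\Gamma(r)=-\frac1{2\pi}\log r$ for $k=2$, $\Gamma(r)=\frac1{4\pi r}$ for $k=3$, and $h_y$ is harmonic in $D$, continuous on $\overline D$, and equal to $\Gamma(|\cdot-y|)$ on $\partial D$ (equivalently $h_y(x)=\mathbb E_x\,\Gamma(|B_\tau-y|)$, with $B_\tau$ the point where Brownian motion started from $x$ first hits $\partial D$). Write $\|\cdot\|$ and $\langle\cdot,\cdot\rangle$ for the norm and inner product of $L^2(D;\mathbb R^d)$. Let $W=(W^1,\dots,W^d)$ be a $d$-dimensional white noise on $\mathbb R^k$, $\sigma=(\sigma_{ij})$ a non-singular real $d\times d$ matrix, $f:\mathbb R^d\to\mathbb R^d$ and $g:D\to\mathbb R^d$. Let $u=\{u(x),x\in D\}$ be a mild solution of $-\Delta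 u^i+f^i(u)=g^i+\sum_j\sigma_{ij}\dot W^j$ in $D$, $u|_{\partial D}=0$: a process whose sample paths are a.s. continuous on $\overline D$ and zero on $\partial D$, such that for all $x\in D$, a.s., for $i=1,\dots,d$, $$u^i(x)+\int_D G_D(x,y)f^i(u(y))\,dy=\int_D G_D(x,y)g^i(y)\,dy+\sum_{j=1}^d\sigma_{ij}\int_D G_D(x,y)\,W^j(dy).$$ **Hypotheses.** (i) $g\in L^2(D;\mathbb R^d)$. (ii) $F(v)=f\circ v$ defines an operator $F:L^2(D;\mathbb R^d)\to L^2(D;\mathbb R^d)$ that is continuous in norm and bounded (it maps bounded sets to bounded sets). Moreover $F=F_1+F_2$, where $F_j(v)=f_j\circ v$ ($f_j:\mathbb R^d\to\mathbb R^d$) are operators on $L^2(D;\mathbb R^d)$ such that $F_1$ is bounded with $\langle v-w,F_1(v)-F_1(w)\rangle\ge0$ for all $v,w$, and, for some $L>0$ and all $v\in L^2(D;\mathbb R^d)$, $|F_2(v)(z_1)-F_2(v)(z_2)|\le L|v(z_1)-v(z_2)|$ for almost all $z_1,z_2\in D$. (iii) $L<a\wedge\bigl(K|D|^{1/2}\bigr)^{-1}$,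 where $K=\sup_{x\in D}\|G_D(x,\cdot)\|_{L^2(D)}$, $|D|$ is the Lebesgue measure of $D$, and $a>0$ is a constant such that $\bigl\langle\int_D G_D(\cdot,y)\varphi(y)\,dy,\varphi\bigr\rangle\ge a\bigl\|\int_D G_D(\cdot,y)\varphi(y)\,dy\bigr\|^2$ for all $\varphi\in L^2(D;\mathbb R^d)$. **Conclusion.** Let $A$ be an open ball $B_r(c)$ with $\overline{B_r(c)}\subset D$; if $k=1$, also $A=D$ is allowed. For $\gamma\in(0,1)$ put $\xi=1$ if $k=1$, $\xi=1-\gamma$ if $k=2$, $\xi=\frac12$ if $k=3$. Then for every $\gamma\in(0,1)$ and every real $p\ge2$ there is a constant $C>0$ such that $$\mathbb E\bigl[|u(x_1)-u(x_2)|^p\bigr]\le C|x_1-x_2|^{p\xi}\qquad\text{for all }x_1,x_2\in A.$$ Moreover, for almost all $\omega$, the sample path $x\mapsto u(x)(\omega)$ is Hölder continuous on $A$ of every order $\alpha\in(0,1)$ if $k=1,2$, and of every order $\alpha\in(0,\frac12)$ if $k=3$. -/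

import Mathlib

open MeasureTheory ProbabilityTheory Set Metric InnerProductSpace
open scoped ENNReal NNReal RealInnerProductSpace

noncomputable section

namespace EllipticSPDE

/-- `ℝⁿ` with its Euclidean norm. -/
abbrev Euc (n : ℕ) : Type := EuclideanSpace ℝ (Fin n)

/-- The Hilbert space `L²(D; ℝᵈ)`. -/
abbrev L2 {k : ℕ} (D : Set (Euc k)) (d : ℕ) : Type := Lp (Euc d) 2 (volume.restrict D)

/-! ### Green functions of the Dirichlet Laplacian -/

/-- `h` is a classical solution of the Dirichlet problem on `D` with boundary values `φ`: it is
harmonic in `D`, continuous on the closure, and equal to `φ` on the boundary. -/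
def IsDirichletSolution {k : ℕ} (D : Set (Euc k)) (φ h : Euc k → ℝ) : Prop :=
  HarmonicOnNhd h D ∧ ContinuousOn h (closure D) ∧ EqOn h φ (frontier D)

/-- `D` has a regular boundary: the Dirichlet problem is solvable for all continuous boundary
values. -/
def HasRegularBoundary {k : ℕ} (D : Set (Euc k)) : Prop :=
  ∀ φ : Euc k → ℝ, ContinuousOn φ (frontier D) → ∃ h, IsDirichletSolution D φ h

open Classical in
/-- The solution of the Dirichlet problem (unique on `closure D` when `D` is bounded and open);
at `x ∈ D` it is the expectation of `φ` at the point where Brownian motion started from `x` first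
hits the boundary. -/
def dirichletSolution {k : ℕ} (D : Set (Euc k)) (φ : Euc k → ℝ) : Euc k → ℝ :=
  if h : ∃ h, IsDirichletSolution D φ h then h.choose else 0

/-- The fundamental solution of `-Δ` in the plane, as a function of the distance. -/
def fundSol2 (r : ℝ) : ℝ := -(1 / (2 * Real.pi)) * Real.log r

/-- The fundamental solution of `-Δ` in space, as a function of the distance. -/
def fundSol3 (r : ℝ) : ℝ := 1 / (4 * Real.pi) * r⁻¹

/-- The Green function of `D` obtained from the fundamental solution `Γ`:
`G(x, y) = Γ(|x - y|) - h_y(x)`, with `h_y` harmonic in `D` and equal to `Γ(|· - y|)` on the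
boundary of `D`. -/
def greenFunction {k : ℕ} (Γ : ℝ → ℝ) (D : Set (Euc k)) (x y : Euc k) : ℝ :=
  Γ ‖x - y‖ - dirichletSolution D (fun z => Γ ‖z - y‖) x

/-- The Green function of the interval `(0, b)`. -/
def greenInterval (b : ℝ) (x y : Euc 1) : ℝ := min (x 0) (y 0) - x 0 * y 0 / b

/-- The admissible domains `D ⊂ ℝᵏ`, `k = 1, 2, 3`, together with their Green function `G`:
the intervals `(0, b)` for `k = 1`, and the bounded domains with regular boundary for
`k = 2, 3`. -/
inductive IsDomainWithGreen :
    (k : ℕ) → (D : Set (Euc k)) → (G : Euc k → Euc k → ℝ) → Prop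
  | dim1 (b : ℝ) (hb : 0 < b) :
      IsDomainWithGreen 1 {x | 0 < x 0 ∧ x 0 < b} (greenInterval b)
  | dim2 (D : Set (Euc 2)) (hopen : IsOpen D) (hconn : IsConnected D)
      (hbdd : Bornology.IsBounded D) (hreg : HasRegularBoundary D) :
      IsDomainWithGreen 2 D (greenFunction fundSol2 D)
  | dim3 (D : Set (Euc 3)) (hopen : IsOpen D) (hconn : IsConnected D)
      (hbdd : Bornology.IsBounded D) (hreg : HasRegularBoundary D) :
      IsDomainWithGreen 3 D (greenFunction fundSol3 D)

/-- `K = sup_{x ∈ D} ‖G(x, ·)‖_{L²(D)}`. -/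
def greenSup {k : ℕ} (D : Set (Euc k)) (G : Euc k → Euc k → ℝ) : ℝ≥0∞ :=
  ⨆ x ∈ D, eLpNorm (G x) 2 (volume.restrict D)

/-- `a` is a constant for which the Poincaré-type inequality
`⟨Gφ, φ⟩ ≥ a ‖Gφ‖²` holds for all `φ ∈ L²(D; ℝᵈ)`, with `Gφ(x) = ∫_D G(x, y) φ(y) dy`. -/
def IsPoincareConst {k : ℕ} (D : Set (Euc k)) (G : Euc k → Euc k → ℝ) (d : ℕ) (a : ℝ) : Prop :=
  0 < a ∧ ∀ φ : L2 D d,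
    a * ∫ x in D, ‖∫ y in D, G x y • φ y‖ ^ 2 ≤ ∫ x in D, ⟪∫ y in D, G x y • φ y, φ x⟫

/-! ### Assumptions on the nonlinearity -/

/-- `F : L²(D; ℝᵈ) → L²(D; ℝᵈ)` is the Nemytskii operator `F(v)(y) = f(v(y))`. -/
def IsNemytskii {k d : ℕ} (D : Set (Euc k)) (f : Euc d → Euc d) (F : L2 D d → L2 D d) : Prop :=
  ∀ v : L2 D d, ∀ᵐ y ∂(volume.restrict D), F v y = f (v y)

/-- A (nonlinear) operator is bounded if it maps bounded sets to bounded sets. -/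
def IsBoundedOperator {k d : ℕ} {D : Set (Euc k)} (F : L2 D d → L2 D d) : Prop :=
  ∀ s : Set (L2 D d), Bornology.IsBounded s → Bornology.IsBounded (F '' s)

/-- Condition (C): `F` is continuous in norm, and bounded. -/
def CondC {k d : ℕ} {D : Set (Euc k)} (F : L2 D d → L2 D d) : Prop :=
  Continuous F ∧ IsBoundedOperator F

/-- The monotonicity condition with constant `L`: `F = F₁ + F₂` with `F₁`, `F₂` the Nemytskii
operators of functions `f₁`, `f₂`, `F₁` bounded and monotone, and `F₂` Lipschitz in the pointwise
sense with constant `L`. -/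
def CondMbar {k d : ℕ} (D : Set (Euc k)) (F : L2 D d → L2 D d) (L : ℝ) : Prop :=
  0 < L ∧ ∃ (f₁ f₂ : Euc d → Euc d) (F₁ F₂ : L2 D d → L2 D d),
    IsNemytskii D f₁ F₁ ∧ IsNemytskii D f₂ F₂ ∧
    (∀ v, F v = F₁ v + F₂ v) ∧
    IsBoundedOperator F₁ ∧
    (∀ v w : L2 D d, 0 ≤ ⟪v - w, F₁ v - F₁ w⟫) ∧
    ∀ v : L2 D d, ∀ᵐ z₁ ∂(volume.restrict D), ∀ᵐ z₂ ∂(volume.restrict D),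
      ‖F₂ v z₁ - F₂ v z₂‖ ≤ L * ‖v z₁ - v z₂‖

/-! ### White noise and mild solutions -/

/-- A `d`-dimensional white noise on `ℝᵏ`: a centred Gaussian family `W^j(φ)`, `φ ∈ L²(ℝᵏ)`,
`1 ≤ j ≤ d`, with `E[W^i(φ) W^j(ψ)] = δ_{ij} ⟨φ, ψ⟩`. -/
structure IsWhiteNoise {Ω : Type*} [MeasurableSpace Ω] (P : Measure Ω) (k d : ℕ)
    (W : Fin d → Lp ℝ 2 (volume : Measure (Euc k)) → Ω → ℝ) : Prop where
  gaussian : IsGaussianProcess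
    (fun q : Fin d × Lp ℝ 2 (volume : Measure (Euc k)) => W q.1 q.2) P
  centred : ∀ j φ, ∫ ω, W j φ ω ∂P = 0
  covariance : ∀ i j φ ψ, ∫ ω, W i φ ω * W j ψ ω ∂P = if i = j then ⟪φ, ψ⟫ else 0

open Classical in
/-- The Wiener integral `∫_D h(y) W(dy) = W(1_D h)` of a function that is square integrable
on `D`. -/
def wienerIntegral {Ω : Type*} {k : ℕ} (W : Lp ℝ 2 (volume : Measure (Euc k)) → Ω → ℝ)
    (D : Set (Euc k)) (h : Euc k → ℝ) : Ω → ℝ :=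
  if hh : MemLp (D.indicator h) 2 (volume : Measure (Euc k)) then W (hh.toLp _) else 0

/-- `u` is a mild solution, with sample paths in the space of continuous functions on `closure D`
that vanish on the boundary, of
`-Δ uⁱ + fⁱ(u) = gⁱ + ∑ⱼ σᵢⱼ Ẇʲ` in `D`, `u = 0` on the boundary. -/
structure IsMildSolution {Ω : Type*} [MeasurableSpace Ω] (P : Measure Ω) {k d : ℕ}
    (D : Set (Euc k)) (G : Euc k → Euc k → ℝ) (f : Euc d → Euc d) (g : Euc k → Euc d)
    (σ : Matrix (Fin d) (Fin d) ℝ) (W : Fin d → Lp ℝ 2 (volume : Measure (Euc k)) → Ω → ℝ)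
    (u : Euc k → Ω → Euc d) : Prop where
  measurable : ∀ x ∈ D, Measurable (u x)
  paths : ∀ᵐ ω ∂P, ContinuousOn (fun x => u x ω) (closure D) ∧ ∀ x ∈ frontier D, u x ω = 0
  equation : ∀ x ∈ D, ∀ᵐ ω ∂P, ∀ i : Fin d,
    u x ω i + ∫ y in D, G x y * f (u y ω) i =
      (∫ y in D, G x y * g y i) + ∑ j, σ i j * wienerIntegral (W j) D (G x) ω

/-! ### Hölder exponents -/

/-- The exponent `ξ`: `1` for `k = 1`, `1 - γ` for `k = 2`, `1/2` for `k = 3`. -/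
def momentExponent (k : ℕ) (γ : ℝ) : ℝ := if k = 1 then 1 else if k = 2 then 1 - γ else 1 / 2

/-- The bound for the Hölder exponents of the paths: `1` for `k = 1, 2`, `1/2` for `k = 3`. -/
def pathExponent (k : ℕ) : ℝ := if k = 3 then 1 / 2 else 1

end EllipticSPDE

end

/-! Write `z = u + ∫_D G(·, y) f(u(y)) dy`. By the equation, `z` is the sum of a deterministic
function and a stochastic convolution with the kernel `G`, hence it has moments of all orders.
Testing the equation with `F u - F z` and using that `F` is monotone up to `-L` while the Poincaré
inequality gains `a > L`, one gets a pathwise bound `‖F u‖ ≤ B (1 + ‖z‖)` in `L²(D)`, so `‖F u‖` has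
moments of all orders too. Taking differences in the equation, the `Lᵖ(P)` norm of `u(x₁) - u(x₂)`
is then at most a multiple of `‖G(x₁, ·) - G(x₂, ·)‖` in `L²(D)`; for the noise this is because the
`Lᵖ` norm of a centred Gaussian variable is a multiple of its standard deviation.

The regularity of `G` is that of the fundamental solution, which determines the exponent: the
regular part `h_y` is harmonic and, up to a constant, nonnegative, so that on a smaller ball its
increments are at most `C ‖x₁ - x₂‖` times its value at the centre, and this value is square
integrable in `y`.

The Hölder continuity of the paths is Kolmogorov's criterion: the moments of the increments bound
the expectation of a Gagliardo energy, which is thus almost surely finite, and for a continuous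
function on a convex set a finite energy implies Hölder continuity, by telescoping over shrinking
homothetic copies of the set. -/

noncomputable section

namespace EllipticSPDE

/-! ### Harmonic functions -/

section Harmonic

variable {E : Type*} [NormedAddCommGroup E]

/-- The radial weight `(1 - |y|²)₊` of the mean value property. Its square is differentiable with
gradient `-4 (1 - |y|²)₊ y`, which turns averages of radial derivatives into averages of Laplacians
by integration by parts. -/
def bump (y : E) : ℝ := max 0 (1 - ‖y‖ ^ 2)

lemma bump_nonneg (y : E) : 0 ≤ bump y := le_max_left _ _

lemma continuous_bump : Continuous (bump (E := E)) := by
  unfold bump; fun_prop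

lemma bump_eq_zero {y : E} (hy : 1 ≤ ‖y‖) : bump y = 0 :=
  max_eq_left (by nlinarith)

lemma tsupport_bump_sq_subset : tsupport (fun y : E => bump y ^ 2) ⊆ closedBall 0 1 := by
  refine closure_minimal (fun y hy => ?_) isClosed_closedBall
  contrapose! hy
  simp only [mem_closedBall, dist_zero_right, not_le] at hy
  simp [bump_eq_zero hy.le]

lemma bump_pos {y : E} (hy : ‖y‖ < 1) : 0 < bump y :=
  lt_max_of_lt_right (by nlinarith [norm_nonneg y])

lemma bump_eq_one_sub_min_sq (y : E) : bump y = 1 - (min ‖y‖ 1) ^ 2 := by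
  rcases le_total ‖y‖ 1 with hy | hy
  · rw [bump, min_eq_left hy, max_eq_right (by nlinarith [norm_nonneg y])]
  · rw [bump_eq_zero hy, min_eq_right hy]; norm_num

lemma abs_bump_sub_le (a b : E) : |bump a - bump b| ≤ 2 * ‖a - b‖ := by
  have hmin : |min ‖a‖ 1 - min ‖b‖ 1| ≤ ‖a - b‖ :=
    (abs_min_sub_min_le_max ‖a‖ 1 ‖b‖ 1).trans (by simpa using abs_norm_sub_norm_le a b)
  have hsum : |min ‖a‖ 1 + min ‖b‖ 1| ≤ 2 := by
    rw [abs_of_nonneg (by positivity)]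
    linarith [min_le_right ‖a‖ 1, min_le_right ‖b‖ 1]
  calc |bump a - bump b| = |min ‖a‖ 1 + min ‖b‖ 1| * |min ‖a‖ 1 - min ‖b‖ 1| := by
        rw [bump_eq_one_sub_min_sq, bump_eq_one_sub_min_sq, ← abs_mul, ← abs_neg]
        ring_nf
    _ ≤ 2 * ‖a - b‖ := by gcongr

lemma hasDerivAt_max_zero_sq (s : ℝ) :
    HasDerivAt (fun s : ℝ => (max 0 s) ^ 2) (2 * max 0 s) s := by
  refine hasDerivAt_of_hasDerivAt_of_ne' (x := 0) (g := fun s => 2 * max 0 s) (fun y hy => ?_)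
    (by fun_prop) (by fun_prop) s
  rcases hy.lt_or_gt with hy | hy
  · rw [max_eq_left hy.le, mul_zero]
    refine (hasDerivAt_const y (0 : ℝ)).congr_of_eventuallyEq ?_
    filter_upwards [Iio_mem_nhds hy] with x hx
    simp [max_eq_left (mem_Iio.1 hx).le]
  · rw [max_eq_right hy.le]
    refine (show HasDerivAt (fun s : ℝ => s ^ 2) (2 * y) y by
      simpa using hasDerivAt_pow 2 y).congr_of_eventuallyEq ?_
    filter_upwards [Ioi_mem_nhds hy] with x hx
    simp [max_eq_right (mem_Ioi.1 hx).le]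

variable [InnerProductSpace ℝ E]

lemma hasFDerivAt_bump_sq (y : E) :
    HasFDerivAt (fun y : E => bump y ^ 2) (-(4 * bump y) • innerSL ℝ y) y := by
  have hnorm : HasFDerivAt (fun y : E => 1 - ‖y‖ ^ 2) (-(2 • innerSL ℝ y)) y := by
    simpa using ((hasFDerivAt_id y).norm_sq).const_sub 1
  refine ((hasDerivAt_max_zero_sq (1 - ‖y‖ ^ 2)).comp_hasFDerivAt y hnorm).congr_fderiv ?_
  ext v
  simp only [bump, smul_apply, neg_apply, smul_eq_mul, nsmul_eq_mul, Nat.cast_ofNat]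
  ring

lemma add_smul_mem_closedBall {x y : E} {R t : ℝ} (ht : |t| ≤ R) (hy : y ∈ closedBall 0 1) :
    x + t • y ∈ closedBall x R := by
  rw [mem_closedBall, dist_self_add_left, norm_smul, Real.norm_eq_abs]
  exact mul_le_of_le_one_right (abs_nonneg t) (by simpa using hy) |>.trans ht

/-- The weight `bump` transported to the ball with centre `x` and radius `t`. -/
def ballBump (x : E) (t : ℝ) (z : E) : ℝ := bump (t⁻¹ • (z - x))

lemma ballBump_nonneg (x : E) (t : ℝ) (z : E) : 0 ≤ ballBump x t z := bump_nonneg _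

lemma norm_inv_smul_sub {t : ℝ} (ht : 0 < t) (x z : E) : ‖t⁻¹ • (z - x)‖ = dist z x / t := by
  rw [norm_smul, norm_inv, Real.norm_of_nonneg ht.le, dist_eq_norm, div_eq_inv_mul]

lemma ballBump_eq_zero {x z : E} {t : ℝ} (ht : 0 < t) (hz : t ≤ dist z x) :
    ballBump x t z = 0 :=
  bump_eq_zero (by rwa [norm_inv_smul_sub ht, one_le_div ht])

lemma ballBump_pos {x z : E} {t : ℝ} (ht : 0 < t) (hz : dist z x < t) : 0 < ballBump x t z :=
  bump_pos (by rwa [norm_inv_smul_sub ht, div_lt_one ht])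

lemma le_ballBump {x z : E} {s t : ℝ} (ht : 0 < t) (hz : dist z x ≤ s) :
    1 - (s / t) ^ 2 ≤ ballBump x t z := by
  refine le_trans ?_ (le_max_right _ _)
  rw [norm_inv_smul_sub ht]
  gcongr

lemma abs_ballBump_sub_le (x₁ x₂ z : E) {t : ℝ} (ht : 0 < t) :
    |ballBump x₁ t z - ballBump x₂ t z| ≤ 2 / t * ‖x₁ - x₂‖ := by
  refine (abs_bump_sub_le _ _).trans (le_of_eq ?_)
  rw [← smul_sub, norm_smul, norm_inv, Real.norm_of_nonneg ht.le, sub_sub_sub_cancel_left,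
    norm_sub_rev]
  ring

lemma exists_abs_ballBump_sub_le_mul_ballBump {r ρ T : ℝ} (hr : 0 < r) (hρ : 0 < ρ)
    (hT : r + ρ < T) (c : E) :
    ∃ C, 0 ≤ C ∧ ∀ x₁ ∈ ball c r, ∀ x₂ ∈ ball c r, ∀ z,
      |ballBump x₁ ρ z - ballBump x₂ ρ z| ≤ C * ‖x₁ - x₂‖ * ballBump c T z := by
  have hT0 : 0 < T := by linarith
  set κ := 1 - ((r + ρ) / T) ^ 2
  have hκ0 : 0 < κ := by
    have : ((r + ρ) / T) ^ 2 < 1 := pow_lt_one₀ (by positivity) ((div_lt_one hT0).2 hT) two_ne_zero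
    linarith
  refine ⟨2 / ρ / κ, by positivity, fun x₁ hx₁ x₂ hx₂ z => ?_⟩
  rcases le_or_gt (dist z c) (r + ρ) with hz | hz
  · calc |ballBump x₁ ρ z - ballBump x₂ ρ z| ≤ 2 / ρ * ‖x₁ - x₂‖ := abs_ballBump_sub_le x₁ x₂ z hρ
      _ = 2 / ρ / κ * ‖x₁ - x₂‖ * κ := by field_simp
      _ ≤ _ := by gcongr; exact le_ballBump hT0 hz
  · have hzero : ∀ x ∈ ball c r, ballBump x ρ z = 0 := fun x hx =>
      ballBump_eq_zero hρ (by linarith [dist_triangle z x c, mem_ball.1 hx])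
    rw [hzero x₁ hx₁, hzero x₂ hx₂, sub_self, abs_zero]
    exact mul_nonneg (by positivity) (ballBump_nonneg c T z)

variable [FiniteDimensional ℝ E] [MeasurableSpace E] [BorelSpace E]

lemma integrable_mul_bump {g : E → ℝ} (hg : ContinuousOn g (closedBall 0 1)) :
    Integrable (fun y => g y * bump y) := by
  have hint : IntegrableOn (fun y => g y * bump y) (closedBall (0 : E) 1) :=
    (hg.mul continuous_bump.continuousOn).integrableOn_compact (isCompact_closedBall _ _)
  rwa [integrableOn_iff_integrable_of_support_subset] at hint
  intro y hy
  contrapose! hy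
  simp only [mem_closedBall, dist_zero_right, not_le] at hy
  simp [bump_eq_zero hy.le]

lemma integral_bump_pos : 0 < ∫ y : E, bump y := by
  have hint : Integrable (bump (E := E)) := by
    simpa using integrable_mul_bump (E := E) (g := fun _ => 1) continuousOn_const
  refine (integral_pos_iff_support_of_nonneg bump_nonneg hint).2 ?_
  exact (measure_ball_pos volume (0 : E) one_pos).trans_le
    (measure_mono fun y hy => (bump_pos (by simpa using hy)).ne')

lemma integral_bump_sq_mul_fderiv {v : E → ℝ} (hv : ∀ y ∈ closedBall 0 1, ContDiffAt ℝ 1 v y)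
    (e : E) :
    ∫ y, bump y ^ 2 * fderiv ℝ v y e = 4 * ∫ y, ⟪y, e⟫ * v y * bump y := by
  have hvc : ContinuousOn v (closedBall 0 1) := fun y hy =>
    (hv y hy).continuousAt.continuousWithinAt
  have hdc : ContinuousOn (fun y => fderiv ℝ v y e) (closedBall 0 1) := fun y hy =>
    (((hv y hy).fderiv_right (m := 0) (by norm_num)).continuousAt.clm_apply
      continuousAt_const).continuousWithinAt
  have hbc := continuous_bump.continuousOn (s := closedBall (0 : E) 1)
  have hgrad (y : E) : fderiv ℝ (fun y : E => bump y ^ 2) y e = -(4 * bump y) * ⟪y, e⟫ := by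
    rw [(hasFDerivAt_bump_sq y).fderiv]; simp
  have hic : ContinuousOn (fun y : E => ⟪y, e⟫ * v y) (closedBall 0 1) :=
    (by fun_prop : Continuous fun y : E => ⟪y, e⟫).continuousOn.mul hvc
  rw [integral_mul_fderiv_eq_neg_fderiv_mul_of_integrable, ← integral_neg, ← integral_const_mul]
  · exact integral_congr_ae (.of_forall fun y => by simp only [hgrad]; ring)
  · exact ((integrable_mul_bump hic).const_mul (-4)).congr
      (.of_forall fun y => by simp only [hgrad]; ring)
  · exact (integrable_mul_bump (hbc.mul hdc)).congr
      (.of_forall fun y => by simp only [Pi.mul_apply]; ring)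
  · exact (integrable_mul_bump (hbc.mul hvc)).congr
      (.of_forall fun y => by simp only [Pi.mul_apply]; ring)
  · exact fun y _ => (hasFDerivAt_bump_sq y).differentiableAt
  · exact fun y hy => (hv y (tsupport_bump_sq_subset hy)).differentiableAt one_ne_zero

lemma integral_bump_sq_mul_divergence {ι : Type*} [Fintype ι] (b : OrthonormalBasis ι ℝ E)
    {A : E → E →L[ℝ] ℝ} (hA : ∀ y ∈ closedBall 0 1, ContDiffAt ℝ 1 A y) :
    ∫ y, bump y ^ 2 * ∑ i, fderiv ℝ A y (b i) (b i) = 4 * ∫ y, A y y * bump y := by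
  have hAb (i : ι) : ∀ y ∈ closedBall 0 1, ContDiffAt ℝ 1 (fun y => A y (b i)) y := fun y hy =>
    (hA y hy).clm_apply contDiffAt_const
  have hfderiv (i : ι) (y : E) : bump y ^ 2 * fderiv ℝ A y (b i) (b i)
      = bump y ^ 2 * fderiv ℝ (fun y => A y (b i)) y (b i) := by
    rcases le_or_gt ‖y‖ 1 with hy | hy
    · rw [fderiv_clm_apply ((hA y (by simpa using hy)).differentiableAt one_ne_zero)
        (differentiableAt_const _)]
      simp
    · simp [bump_eq_zero hy.le]
  have hAc (i : ι) : ContinuousOn (fun y => A y (b i)) (closedBall 0 1) := fun y hy =>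
    (hAb i y hy).continuousAt.continuousWithinAt
  have hdc (i : ι) : ContinuousOn (fun y => fderiv ℝ (fun y => A y (b i)) y (b i))
      (closedBall 0 1) := fun y hy =>
    (((hAb i y hy).fderiv_right (m := 0) (by norm_num)).continuousAt.clm_apply
      continuousAt_const).continuousWithinAt
  have happly (y : E) : A y y * bump y = ∑ i, ⟪y, b i⟫ * A y (b i) * bump y := by
    nth_rw 2 [← b.sum_repr' y]
    simp [map_sum, Finset.sum_mul, real_inner_comm]
  simp_rw [Finset.mul_sum, hfderiv, happly]
  rw [integral_finsetSum, integral_finsetSum, Finset.mul_sum]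
  · exact Finset.sum_congr rfl fun i _ => integral_bump_sq_mul_fderiv (hAb i) (b i)
  · exact fun i _ => integrable_mul_bump
      ((by fun_prop : Continuous fun y : E => ⟪y, b i⟫).continuousOn.mul (hAc i))
  · exact fun i _ => (integrable_mul_bump (continuous_bump.continuousOn.mul (hdc i))).congr
      (.of_forall fun y => by simp only [Pi.mul_apply]; ring)

lemma integral_fderiv_radial_eq_zero {h : E → ℝ} {x : E} {R t : ℝ}
    (hh : HarmonicOnNhd h (closedBall x R)) (ht : |t| ≤ R) :
    ∫ y, fderiv ℝ h (x + t • y) y * bump y = 0 := by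
  have hmem : ∀ y ∈ closedBall (0 : E) 1, HarmonicAt h (x + t • y) := fun y hy =>
    hh _ (add_smul_mem_closedBall ht hy)
  have hgrad : ∀ y ∈ closedBall (0 : E) 1, ContDiffAt ℝ 1 (fderiv ℝ h) (x + t • y) := fun y hy =>
    (hmem y hy).1.fderiv_right (by norm_num)
  have hdiv := integral_bump_sq_mul_divergence (stdOrthonormalBasis ℝ E)
    (A := fun y => fderiv ℝ h (x + t • y)) fun y hy => (hgrad y hy).comp y (by fun_prop)
  have hzero (y : E) : bump y ^ 2 * ∑ i, fderiv ℝ (fun y => fderiv ℝ h (x + t • y)) y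
      (stdOrthonormalBasis ℝ E i) (stdOrthonormalBasis ℝ E i) = 0 := by
    rcases le_or_gt ‖y‖ 1 with hy | hy
    · have hy : y ∈ closedBall (0 : E) 1 := by simpa using hy
      have hlin : HasFDerivAt (fun y : E => x + t • y) (t • ContinuousLinearMap.id ℝ E) y :=
        ((hasFDerivAt_id y).const_smul t).const_add x
      have hcomp := HasFDerivAt.comp y
        ((hgrad y hy).differentiableAt one_ne_zero).hasFDerivAt hlin
      have hlap := (hmem y hy).2.self_of_nhds
      simp only [laplacian_eq_iteratedFDeriv_stdOrthonormalBasis, iteratedFDeriv_two_apply,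
        Pi.zero_apply, Matrix.cons_val_zero, Matrix.cons_val_one] at hlap
      simp only [Function.comp_def] at hcomp
      simp [hcomp.fderiv, ← Finset.mul_sum, hlap]
    · simp [bump_eq_zero hy.le]
  simp only [hzero, integral_zero] at hdiv
  linarith

lemma hasDerivAt_integral_add_smul_mul_bump {h : E → ℝ} {x : E} {R s : ℝ}
    (hh : HarmonicOnNhd h (closedBall x R)) (hs : |s| < R) :
    HasDerivAt (fun s => ∫ y, h (x + s • y) * bump y) 0 s := by
  have hab : ∀ r ∈ Ioo (-R) R, |r| ≤ R := fun r hr => abs_le.2 ⟨hr.1.le, hr.2.le⟩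
  have hsI : Ioo (-R) R ∈ nhds s := Ioo_mem_nhds (abs_lt.1 hs).1 (abs_lt.1 hs).2
  have hmaps (r : ℝ) (hr : |r| ≤ R) : MapsTo (fun y => x + r • y) (closedBall 0 1)
      (closedBall x R) := fun y => add_smul_mem_closedBall hr
  have hgrad : ContinuousOn (fderiv ℝ h) (closedBall x R) := fun z hz =>
    ((hh z hz).1.fderiv_right (m := 1) (by norm_num)).continuousAt.continuousWithinAt
  have hint (r : ℝ) (hr : |r| ≤ R) : Integrable fun y => h (x + r • y) * bump y :=
    integrable_mul_bump (hh.continuousOn.comp (by fun_prop) (hmaps r hr))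
  obtain ⟨C, hC⟩ := (isCompact_closedBall x R).exists_bound_of_continuousOn hgrad
  rw [← integral_fderiv_radial_eq_zero hh hs.le]
  refine (hasDerivAt_integral_of_dominated_loc_of_deriv_le (bound := fun y => C * bump y)
    (F' := fun s y => fderiv ℝ h (x + s • y) y * bump y) hsI ?_ (hint s hs.le) ?_
    (.of_forall fun y r hr => ?_) (integrable_mul_bump continuousOn_const)
    (.of_forall fun y r hr => ?_)).2
  · filter_upwards [hsI] with r hr using (hint r (hab r hr)).aestronglyMeasurable
  · exact (integrable_mul_bump ((hgrad.comp (by fun_prop) (hmaps s hs.le)).clm_apply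
      continuousOn_id)).aestronglyMeasurable
  · rcases le_or_gt ‖y‖ 1 with hy | hy
    · have hc := hC _ (hmaps r (hab r hr) (by simpa using hy))
      rw [norm_mul, Real.norm_of_nonneg (bump_nonneg y)]
      refine mul_le_mul_of_nonneg_right ?_ (bump_nonneg y)
      simpa using (fderiv ℝ h (x + r • y)).le_of_opNorm_le_of_le hc hy
    · simp [bump_eq_zero hy.le]
  · rcases le_or_gt ‖y‖ 1 with hy | hy
    · have hh' : HasFDerivAt h (fderiv ℝ h (x + r • y)) (x + r • y) :=
        ((hh _ (hmaps r (hab r hr) (by simpa using hy))).1.differentiableAt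
          two_ne_zero).hasFDerivAt
      have hline : HasDerivAt (fun r : ℝ => x + r • y) y r := by
        simpa using ((hasDerivAt_id r).smul_const y).const_add x
      exact (hh'.comp_hasDerivAt r hline).mul_const _
    · simpa [bump_eq_zero hy.le] using hasDerivAt_const r (0 : ℝ)

lemma integral_add_smul_mul_bump {h : E → ℝ} {x : E} {R t : ℝ}
    (hh : HarmonicOnNhd h (closedBall x R)) (ht0 : 0 ≤ t) (ht : t < R) :
    ∫ y, h (x + t • y) * bump y = h x * ∫ y : E, bump y := by
  have hder : ∀ s ∈ Icc 0 t, HasDerivAt (fun s => ∫ y, h (x + s • y) * bump y) 0 s :=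
    fun s hs => hasDerivAt_integral_add_smul_mul_bump hh
      (abs_lt.2 ⟨by linarith [hs.1], by linarith [hs.2]⟩)
  have hconst := constant_of_has_deriv_right_zero (f := fun s => ∫ y, h (x + s • y) * bump y)
    (fun s hs => (hder s hs).continuousAt.continuousWithinAt)
    (fun s hs => (hder s (Ico_subset_Icc_self hs)).hasDerivWithinAt) t ⟨ht0, le_rfl⟩
  simpa only [zero_smul, add_zero, integral_const_mul] using hconst

lemma integrable_mul_ballBump {g : E → ℝ} {x : E} {t : ℝ} (ht : 0 < t)
    (hg : ContinuousOn g (closedBall x t)) : Integrable fun z => g z * ballBump x t z := by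
  have hcomp : ContinuousOn (fun y => g (x + t • y)) (closedBall 0 1) :=
    hg.comp (by fun_prop) fun y => add_smul_mem_closedBall (abs_of_pos ht).le
  refine (((integrable_mul_bump hcomp).comp_smul (inv_ne_zero ht.ne')).comp_sub_right x).congr
    (.of_forall fun z => ?_)
  simp [ballBump, smul_smul, ht.ne']

theorem integral_mul_ballBump_of_harmonic {h : E → ℝ} {x : E} {R t : ℝ}
    (hh : HarmonicOnNhd h (closedBall x R)) (ht0 : 0 < t) (ht : t < R) :
    ∫ z, h z * ballBump x t z = t ^ Module.finrank ℝ E * (∫ y : E, bump y) * h x := by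
  calc ∫ z, h z * ballBump x t z
      = ∫ z, (fun y => h (x + t • y) * bump y) (t⁻¹ • (z - x)) := by
        simp [ballBump, smul_smul, ht0.ne']
    _ = t ^ Module.finrank ℝ E * ∫ y, h (x + t • y) * bump y := by
        rw [integral_sub_right_eq_self (fun z => (fun y => h (x + t • y) * bump y) (t⁻¹ • z)) x,
          Measure.integral_comp_smul volume (fun y => h (x + t • y) * bump y), inv_pow, inv_inv,
          abs_of_pos (by positivity), smul_eq_mul]
    _ = _ := by rw [integral_add_smul_mul_bump hh ht0.le ht]; ring

lemma eventuallyEq_const_of_isLocalMax_of_harmonic {h : E → ℝ} {x : E} (hh : HarmonicAt h x)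
    (hmax : IsLocalMax h x) : ∀ᶠ y in nhds x, h y = h x := by
  obtain ⟨R, hR, hball⟩ := nhds_basis_closedBall.eventually_iff.1 (hh.eventually.and hmax)
  have hhR : HarmonicOnNhd h (closedBall x R) := fun y hy => (hball hy).1
  obtain ⟨t, ht, htR⟩ := exists_between hR
  have htc : ContinuousOn h (closedBall x t) :=
    hhR.continuousOn.mono (closedBall_subset_closedBall htR.le)
  have hint : Integrable fun z => (h x - h z) * ballBump x t z :=
    integrable_mul_ballBump ht (continuousOn_const.sub htc)
  have hzero : ∫ z, (h x - h z) * ballBump x t z = 0 := by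
    simp_rw [sub_mul]
    rw [integral_sub (integrable_mul_ballBump ht continuousOn_const)
      (integrable_mul_ballBump ht htc), integral_mul_ballBump_of_harmonic hhR ht htR,
      integral_mul_ballBump_of_harmonic (h := fun _ => h x) (harmonicOnNhd_const _) ht htR,
      sub_self]
  have hnonneg : 0 ≤ fun z => (h x - h z) * ballBump x t z := fun z => by
    rcases lt_or_ge (dist z x) t with hz | hz
    · exact mul_nonneg (sub_nonneg.2 (hball (hz.le.trans htR.le)).2) (ballBump_nonneg _ _ _)
    · simp [ballBump_eq_zero ht hz]
  have hae := (integral_eq_zero_iff_of_nonneg hnonneg hint).1 hzero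
  have heq : EqOn h (fun _ => h x) (ball x t) := by
    refine Measure.eqOn_open_of_ae_eq (μ := volume) ?_ isOpen_ball
      (htc.mono ball_subset_closedBall) continuousOn_const
    filter_upwards [ae_restrict_of_ae hae, ae_restrict_mem measurableSet_ball] with z hz hzt
    have := (mul_eq_zero.1 hz).resolve_right (ballBump_pos ht hzt).ne'
    linarith
  exact heq.eventuallyEq_of_mem (ball_mem_nhds x ht)

/- The set where the maximum over `closure D` is attained is compact; if it missed the frontier,
it would be open as well, hence empty or the whole space. -/
theorem le_of_le_on_frontier_of_harmonic [Nontrivial E] {D : Set E} (hD : IsOpen D)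
    (hb : Bornology.IsBounded D) {h : E → ℝ} (hh : HarmonicOnNhd h D)
    (hc : ContinuousOn h (closure D)) {M : ℝ} (hM : ∀ z ∈ frontier D, h z ≤ M) {x : E}
    (hx : x ∈ D) : h x ≤ M := by
  obtain ⟨m, hmD, hmax⟩ := hb.isCompact_closure.exists_isMaxOn ⟨x, subset_closure hx⟩ hc
  set S := closure D ∩ h ⁻¹' {h m}
  have hScompact : IsCompact S := hb.isCompact_closure.of_isClosed_subset
    (hc.preimage_isClosed_of_isClosed isClosed_closure isClosed_singleton) inter_subset_left
  obtain ⟨z, hzS, hzf⟩ : (S ∩ frontier D).Nonempty := by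
    by_contra! hempty
    have hSD : S ⊆ D := fun y hy => by
      by_contra hyD
      exact hempty.le ⟨hy, hy.1, by rwa [hD.interior_eq]⟩
    have hSopen : IsOpen S := isOpen_iff_mem_nhds.2 fun y hy => by
      have hymax : IsLocalMax h y := by
        filter_upwards [hD.mem_nhds (hSD hy)] with w hw
        exact (hmax (subset_closure hw)).trans_eq hy.2.symm
      filter_upwards [eventuallyEq_const_of_isLocalMax_of_harmonic (hh y (hSD hy)) hymax,
        hD.mem_nhds (hSD hy)] with w hw hwD
      exact ⟨subset_closure hwD, hw.trans hy.2⟩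
    have hSuniv : S = univ := IsClopen.eq_univ ⟨hScompact.isClosed, hSopen⟩ ⟨m, hmD, rfl⟩
    have : NoncompactSpace E := NormedSpace.noncompactSpace ℝ E
    exact noncompact_univ E (hSuniv ▸ hScompact)
  exact (hmax (subset_closure hx)).trans (hzS.2 ▸ hM z hzf)

/- The values of `h` are averages of `h` over small balls, and the difference of the two averaging
weights is dominated by the averaging weight of one large ball. -/
theorem exists_abs_sub_le_of_nonneg_harmonic (c : E) {r R : ℝ} (hr : 0 < r) (hrR : r < R) :
    ∃ C, 0 ≤ C ∧ ∀ h : E → ℝ, HarmonicOnNhd h (closedBall c R) → (∀ z ∈ closedBall c R, 0 ≤ h z) →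
      ∀ x₁ ∈ ball c r, ∀ x₂ ∈ ball c r, |h x₁ - h x₂| ≤ C * ‖x₁ - x₂‖ * h c := by
  obtain ⟨ρ, hρ, hρR⟩ : ∃ ρ, 0 < ρ ∧ r + 3 * ρ = R := ⟨(R - r) / 3, by linarith, by ring⟩
  have hT : 0 < r + 2 * ρ := by linarith
  obtain ⟨C, hC, hbump⟩ :=
    exists_abs_ballBump_sub_le_mul_ballBump hr hρ (by linarith : r + ρ < r + 2 * ρ) c
  set n := Module.finrank ℝ E
  have hI := integral_bump_pos (E := E)
  set I := ∫ y : E, bump y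
  refine ⟨C * (r + 2 * ρ) ^ n / ρ ^ n, by positivity, fun h hh hnn x₁ hx₁ x₂ hx₂ => ?_⟩
  have hsub : ∀ x ∈ ball c r, closedBall x (2 * ρ) ⊆ closedBall c R := fun x hx =>
    closedBall_subset_closedBall' (by linarith [mem_ball.1 hx])
  have hmean : ∀ x ∈ ball c r, ∫ z, h z * ballBump x ρ z = ρ ^ n * I * h x := fun x hx =>
    integral_mul_ballBump_of_harmonic (hh.mono (hsub x hx)) hρ (by linarith)
  have hint : ∀ x ∈ ball c r, Integrable fun z => h z * ballBump x ρ z := fun x hx =>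
    integrable_mul_ballBump hρ (hh.continuousOn.mono
      ((closedBall_subset_closedBall (by linarith)).trans (hsub x hx)))
  have hpoint (z : E) : |h z * ballBump x₁ ρ z - h z * ballBump x₂ ρ z| ≤
      C * ‖x₁ - x₂‖ * (h z * ballBump c (r + 2 * ρ) z) := by
    rcases le_or_gt (dist z c) R with hz | hz
    · rw [← mul_sub, abs_mul, abs_of_nonneg (hnn z hz), mul_left_comm]
      exact mul_le_mul_of_nonneg_left (hbump x₁ hx₁ x₂ hx₂ z) (hnn z hz)
    · have hzero : ∀ x ∈ ball c r, ballBump x ρ z = 0 := fun x hx =>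
        ballBump_eq_zero hρ (by linarith [dist_triangle z x c, mem_ball.1 hx])
      simp [hzero x₁ hx₁, hzero x₂ hx₂, ballBump_eq_zero hT (show _ ≤ dist z c by linarith)]
  refine le_of_mul_le_mul_left ?_ (by positivity : 0 < ρ ^ n * I)
  calc ρ ^ n * I * |h x₁ - h x₂| = |∫ z, (h z * ballBump x₁ ρ z - h z * ballBump x₂ ρ z)| := by
        rw [integral_sub (hint x₁ hx₁) (hint x₂ hx₂), hmean x₁ hx₁, hmean x₂ hx₂, ← mul_sub,
          abs_mul, abs_of_pos (by positivity : 0 < ρ ^ n * I)]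
    _ ≤ ∫ z, C * ‖x₁ - x₂‖ * (h z * ballBump c (r + 2 * ρ) z) :=
        abs_integral_le_integral_abs.trans (integral_mono ((hint x₁ hx₁).sub (hint x₂ hx₂)).abs
          ((integrable_mul_ballBump hT (hh.continuousOn.mono
            (closedBall_subset_closedBall (by linarith)))).const_mul _) hpoint)
    _ = C * ‖x₁ - x₂‖ * ((r + 2 * ρ) ^ n * I * h c) := by
        rw [integral_const_mul, integral_mul_ballBump_of_harmonic hh hT (by linarith)]
    _ = ρ ^ n * I * (C * (r + 2 * ρ) ^ n / ρ ^ n * ‖x₁ - x₂‖ * h c) := by field_simp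

end Harmonic

/-! ### The Green function -/

section DirichletProblem

variable {k : ℕ} {D : Set (Euc k)} {φ ψ : Euc k → ℝ} {x : Euc k}

lemma isDirichletSolution_dirichletSolution (hreg : HasRegularBoundary D)
    (hφ : ContinuousOn φ (frontier D)) : IsDirichletSolution D φ (dirichletSolution D φ) := by
  have h := hreg φ hφ
  rw [dirichletSolution, dif_pos h]
  exact h.choose_spec

variable [NeZero k] (hD : IsOpen D) (hb : Bornology.IsBounded D) (hreg : HasRegularBoundary D)
include hD hb hreg

lemma le_dirichletSolution (hφ : ContinuousOn φ (frontier D)) {m : ℝ}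
    (hm : ∀ z ∈ frontier D, m ≤ φ z) (hx : x ∈ D) : m ≤ dirichletSolution D φ x := by
  obtain ⟨harm, cont, eq⟩ := isDirichletSolution_dirichletSolution hreg hφ
  refine neg_le_neg_iff.1 (le_of_le_on_frontier_of_harmonic hD hb harm.neg cont.neg ?_ hx)
  intro z hz
  rw [Pi.neg_apply, eq hz]
  exact neg_le_neg (hm z hz)

lemma dirichletSolution_sub_le (hφ : ContinuousOn φ (frontier D))
    (hψ : ContinuousOn ψ (frontier D)) {ε : ℝ} (hε : ∀ z ∈ frontier D, φ z - ψ z ≤ ε)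
    (hx : x ∈ D) : dirichletSolution D φ x - dirichletSolution D ψ x ≤ ε := by
  obtain ⟨harm, cont, eq⟩ := isDirichletSolution_dirichletSolution hreg hφ
  obtain ⟨harm', cont', eq'⟩ := isDirichletSolution_dirichletSolution hreg hψ
  refine le_of_le_on_frontier_of_harmonic hD hb (harm.sub harm') (cont.sub cont') ?_ hx
  intro z hz
  rw [Pi.sub_apply, eq hz, eq' hz]
  exact hε z hz

lemma abs_dirichletSolution_sub_le (hφ : ContinuousOn φ (frontier D))
    (hψ : ContinuousOn ψ (frontier D)) {ε : ℝ} (hε : ∀ z ∈ frontier D, |φ z - ψ z| ≤ ε)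
    (hx : x ∈ D) : |dirichletSolution D φ x - dirichletSolution D ψ x| ≤ ε :=
  abs_sub_le_iff.2
    ⟨dirichletSolution_sub_le hD hb hreg hφ hψ (fun z hz => (abs_sub_le_iff.1 (hε z hz)).1) hx,
      dirichletSolution_sub_le hD hb hreg hψ hφ (fun z hz => (abs_sub_le_iff.1 (hε z hz)).2) hx⟩

end DirichletProblem

section GreenFunction

variable {k : ℕ} {D : Set (Euc k)} {Γ : ℝ → ℝ} {c x : Euc k}

/-- The regular part `h_y(x)` of the Green function, as a function of both variables. -/
def harmonicPart (Γ : ℝ → ℝ) (D : Set (Euc k)) (x y : Euc k) : ℝ :=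
  dirichletSolution D (fun z => Γ ‖z - y‖) x

lemma norm_sub_pos_of_mem_frontier (hD : IsOpen D) {y z : Euc k} (hy : y ∈ D)
    (hz : z ∈ frontier D) : 0 < ‖z - y‖ := by
  rw [norm_pos_iff, sub_ne_zero]
  rintro rfl
  rw [hD.frontier_eq] at hz
  exact hz.2 hy

lemma continuousOn_norm_sub_frontier (hD : IsOpen D) (hΓ : ContinuousOn Γ (Ioi 0)) {y : Euc k}
    (hy : y ∈ D) : ContinuousOn (fun z => Γ ‖z - y‖) (frontier D) :=
  hΓ.comp (by fun_prop) fun _ hz => norm_sub_pos_of_mem_frontier hD hy hz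

lemma eventually_abs_norm_sub_lt_on_frontier (hD : IsOpen D) (hb : Bornology.IsBounded D)
    (hΓ : ContinuousOn Γ (Ioi 0)) {y₀ : Euc k} (hy₀ : y₀ ∈ D) {ε : ℝ} (hε : 0 < ε) :
    ∀ᶠ y in nhds y₀, ∀ z ∈ frontier D, |Γ ‖z - y‖ - Γ ‖z - y₀‖| < ε := by
  have compact : IsCompact (frontier D) :=
    hb.isCompact_closure.of_isClosed_subset isClosed_frontier frontier_subset_closure
  refine compact.eventually_forall_of_forall_eventually fun z hz => ?_
  have hΓz : ContinuousAt Γ ‖z - y₀‖ :=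
    hΓ.continuousAt (Ioi_mem_nhds (norm_sub_pos_of_mem_frontier hD hy₀ hz))
  have cont : ContinuousAt (fun q : Euc k × Euc k => Γ ‖q.2 - q.1‖) (y₀, z) :=
    ContinuousAt.comp (f := fun q : Euc k × Euc k => ‖q.2 - q.1‖) hΓz (by fun_prop)
  have cont₀ : ContinuousAt (fun q : Euc k × Euc k => Γ ‖q.2 - y₀‖) (y₀, z) :=
    ContinuousAt.comp (f := fun q : Euc k × Euc k => ‖q.2 - y₀‖) hΓz (by fun_prop)
  exact (cont.sub cont₀).abs.eventually_lt_const (by simpa using hε)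

variable [NeZero k] (hD : IsOpen D) (hb : Bornology.IsBounded D) (hreg : HasRegularBoundary D)
  (hΓ : ContinuousOn Γ (Ioi 0))
include hD hb hreg hΓ

lemma continuousOn_harmonicPart (hx : x ∈ D) : ContinuousOn (harmonicPart Γ D x) D := by
  intro y₀ hy₀
  refine ContinuousAt.continuousWithinAt (Metric.continuousAt_iff'.2 fun ε hε => ?_)
  filter_upwards [eventually_abs_norm_sub_lt_on_frontier hD hb hΓ hy₀ (half_pos hε),
    hD.mem_nhds hy₀] with y hy hyD
  refine (abs_dirichletSolution_sub_le hD hb hreg (continuousOn_norm_sub_frontier hD hΓ hyD)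
    (continuousOn_norm_sub_frontier hD hΓ hy₀) (fun z hz => (hy z hz).le) hx).trans_lt ?_
  exact half_lt_self hε

lemma aestronglyMeasurable_harmonicPart (hx : x ∈ D) :
    AEStronglyMeasurable (harmonicPart Γ D x) (volume.restrict D) :=
  (continuousOn_harmonicPart hD hb hreg hΓ hx).aestronglyMeasurable hD.measurableSet

lemma memLp_greenFunction (hΓ2 : MemLp (fun y => Γ ‖x - y‖) 2 (volume.restrict D))
    (hG : eLpNorm (greenFunction Γ D x) 2 (volume.restrict D) ≠ ∞) (hx : x ∈ D) :
    MemLp (greenFunction Γ D x) 2 (volume.restrict D) :=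
  ⟨hΓ2.aestronglyMeasurable.sub (aestronglyMeasurable_harmonicPart hD hb hreg hΓ hx),
    hG.lt_top⟩

lemma memLp_harmonicPart (hΓ2 : MemLp (fun y => Γ ‖x - y‖) 2 (volume.restrict D))
    (hG : eLpNorm (greenFunction Γ D x) 2 (volume.restrict D) ≠ ∞) (hx : x ∈ D) :
    MemLp (harmonicPart Γ D x) 2 (volume.restrict D) := by
  have := hΓ2.sub (memLp_greenFunction hD hb hreg hΓ hΓ2 hG hx)
  refine this.congr_norm (aestronglyMeasurable_harmonicPart hD hb hreg hΓ hx) (.of_forall ?_)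
  intro y
  simp [greenFunction, harmonicPart]

variable {m : ℝ} (hm : ∀ y ∈ D, ∀ z ∈ frontier D, m ≤ Γ ‖z - y‖)
include hm

lemma exists_abs_harmonicPart_sub_le {r : ℝ} (hr : 0 < r) (hball : closedBall c r ⊆ D) :
    ∃ C, 0 ≤ C ∧ ∀ y ∈ D, ∀ x₁ ∈ ball c r, ∀ x₂ ∈ ball c r,
      |harmonicPart Γ D x₁ y - harmonicPart Γ D x₂ y| ≤
        C * ‖x₁ - x₂‖ * (harmonicPart Γ D c y - m) := by
  obtain ⟨δ, hδ, larger⟩ :=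
    (isCompact_closedBall c r).exists_cthickening_subset_open hD hball
  rw [cthickening_closedBall hδ.le hr.le] at larger
  obtain ⟨C, hC, bound⟩ :=
    exists_abs_sub_le_of_nonneg_harmonic c hr (show r < δ + r by linarith)
  refine ⟨C, hC, fun y hy x₁ hx₁ x₂ hx₂ => ?_⟩
  have hφ := continuousOn_norm_sub_frontier hD hΓ hy
  have harm := ((isDirichletSolution_dirichletSolution hreg hφ).1.mono larger).sub
    (harmonicOnNhd_const m)
  simpa using! bound _ harm (fun z hz => sub_nonneg.2
    (le_dirichletSolution hD hb hreg hφ (hm y hy) (larger hz))) x₁ hx₁ x₂ hx₂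

lemma exists_eLpNorm_harmonicPart_sub_le
    (hΓ2 : ∀ x ∈ D, MemLp (fun y => Γ ‖x - y‖) 2 (volume.restrict D))
    (hG : ∀ x ∈ D, eLpNorm (greenFunction Γ D x) 2 (volume.restrict D) ≠ ∞)
    {r : ℝ} (hr : 0 < r) (hball : closedBall c r ⊆ D) :
    ∃ C, 0 ≤ C ∧ ∀ x₁ ∈ ball c r, ∀ x₂ ∈ ball c r,
      eLpNorm (harmonicPart Γ D x₁ - harmonicPart Γ D x₂) 2 (volume.restrict D) ≤
        ENNReal.ofReal (C * ‖x₁ - x₂‖) := by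
  have hc : c ∈ D := hball (mem_closedBall_self hr.le)
  have : IsFiniteMeasure (volume.restrict D) :=
    ⟨by rw [Measure.restrict_apply_univ]; exact hb.measure_lt_top⟩
  have hH : MemLp (fun y => harmonicPart Γ D c y - m) 2 (volume.restrict D) :=
    (memLp_harmonicPart hD hb hreg hΓ (hΓ2 c hc) (hG c hc) hc).sub (memLp_const m)
  obtain ⟨C, hC, bound⟩ := exists_abs_harmonicPart_sub_le hD hb hreg hΓ hm hr hball
  refine ⟨C * (eLpNorm (fun y => harmonicPart Γ D c y - m) 2 (volume.restrict D)).toReal,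
    by positivity, fun x₁ hx₁ x₂ hx₂ => ?_⟩
  rw [mul_right_comm, ENNReal.ofReal_mul (by positivity),
    ENNReal.ofReal_toReal hH.eLpNorm_ne_top]
  refine eLpNorm_le_mul_eLpNorm_of_ae_le_mul ?_ 2
  filter_upwards [ae_restrict_mem hD.measurableSet] with y hy
  refine (bound y hy x₁ hx₁ x₂ hx₂).trans ?_
  gcongr
  exact le_abs_self _

omit [NeZero k] hD hb hreg hΓ hm in
lemma norm_sub_le_rpow_mul_rpow {ξ : ℝ} (hξ : ξ ≤ 1) {r : ℝ} {x₁ x₂ : Euc k}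
    (hx₁ : x₁ ∈ ball c r) (hx₂ : x₂ ∈ ball c r) :
    ‖x₁ - x₂‖ ≤ (2 * r) ^ (1 - ξ) * ‖x₁ - x₂‖ ^ ξ := by
  have hr : 0 < r := pos_of_mem_ball hx₁
  rcases (norm_nonneg (x₁ - x₂)).eq_or_lt with h0 | h0
  · rw [← h0]
    positivity
  · have h1 : ‖x₁ - x₂‖ ≤ 2 * r := by
      rw [← dist_eq_norm]
      linarith [dist_triangle_right x₁ x₂ c, mem_ball.1 hx₁, mem_ball.1 hx₂]
    calc ‖x₁ - x₂‖ = ‖x₁ - x₂‖ ^ (1 - ξ) * ‖x₁ - x₂‖ ^ ξ := by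
          rw [← Real.rpow_add h0, sub_add_cancel, Real.rpow_one]
      _ ≤ (2 * r) ^ (1 - ξ) * ‖x₁ - x₂‖ ^ ξ := by gcongr

lemma exists_eLpNorm_greenFunction_sub_le
    (hΓ2 : ∀ x ∈ D, MemLp (fun y => Γ ‖x - y‖) 2 (volume.restrict D))
    (hG : ∀ x ∈ D, eLpNorm (greenFunction Γ D x) 2 (volume.restrict D) ≠ ∞)
    {ξ : ℝ} (hξ : ξ ≤ 1) {C₀ : ℝ} (hC₀ : 0 ≤ C₀)
    (hΓH : ∀ x₁ ∈ D, ∀ x₂ ∈ D, eLpNorm (fun y => Γ ‖x₁ - y‖ - Γ ‖x₂ - y‖) 2 (volume.restrict D) ≤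
      ENNReal.ofReal (C₀ * ‖x₁ - x₂‖ ^ ξ))
    {r : ℝ} (hr : 0 < r) (hball : closedBall c r ⊆ D) :
    ∃ C, 0 ≤ C ∧ ∀ x₁ ∈ ball c r, ∀ x₂ ∈ ball c r,
      eLpNorm (greenFunction Γ D x₁ - greenFunction Γ D x₂) 2 (volume.restrict D) ≤
        ENNReal.ofReal (C * ‖x₁ - x₂‖ ^ ξ) := by
  obtain ⟨C, hC, harmonic⟩ :=
    exists_eLpNorm_harmonicPart_sub_le hD hb hreg hΓ hm hΓ2 hG hr hball
  refine ⟨C₀ + C * (2 * r) ^ (1 - ξ), by positivity, fun x₁ hx₁ x₂ hx₂ => ?_⟩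
  have hx₁D : x₁ ∈ D := hball (ball_subset_closedBall hx₁)
  have hx₂D : x₂ ∈ D := hball (ball_subset_closedBall hx₂)
  have split : greenFunction Γ D x₁ - greenFunction Γ D x₂ =
      (fun y => Γ ‖x₁ - y‖ - Γ ‖x₂ - y‖) - (harmonicPart Γ D x₁ - harmonicPart Γ D x₂) :=
    funext fun y => sub_sub_sub_comm _ _ _ _
  calc eLpNorm (greenFunction Γ D x₁ - greenFunction Γ D x₂) 2 (volume.restrict D)
      ≤ ENNReal.ofReal (C₀ * ‖x₁ - x₂‖ ^ ξ) + ENNReal.ofReal (C * ‖x₁ - x₂‖) := by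
        rw [split]
        refine (eLpNorm_sub_le ((hΓ2 x₁ hx₁D).sub (hΓ2 x₂ hx₂D)).aestronglyMeasurable
          ((aestronglyMeasurable_harmonicPart hD hb hreg hΓ hx₁D).sub
            (aestronglyMeasurable_harmonicPart hD hb hreg hΓ hx₂D)) one_le_two).trans ?_
        exact add_le_add (hΓH x₁ hx₁D x₂ hx₂D) (harmonic x₁ hx₁ x₂ hx₂)
    _ ≤ ENNReal.ofReal ((C₀ + C * (2 * r) ^ (1 - ξ)) * ‖x₁ - x₂‖ ^ ξ) := by
        rw [← ENNReal.ofReal_add (by positivity) (by positivity), add_mul, mul_assoc]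
        gcongr
        exact norm_sub_le_rpow_mul_rpow hξ hx₁ hx₂

end GreenFunction

section Radial

variable {E : Type*} [NormedAddCommGroup E] [NormedSpace ℝ E] [FiniteDimensional ℝ E]
  [MeasurableSpace E] [BorelSpace E] {μ : Measure E} [μ.IsAddHaarMeasure] {D : Set E} {R : ℝ}

omit [FiniteDimensional ℝ E] [NormedSpace ℝ E] [BorelSpace E] [MeasurableSpace E] in
lemma preimage_sub_left_ball_zero (x : E) (R : ℝ) : (x - ·) ⁻¹' ball 0 R = ball x R := by
  ext y
  simp [dist_eq_norm, norm_sub_rev]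

omit [NormedSpace ℝ E] [FiniteDimensional ℝ E] in
lemma setLIntegral_norm_sub_le {μ : Measure E} [SFinite μ] [μ.IsAddLeftInvariant] [μ.IsNegInvariant]
    (m : ℝ → ℝ≥0∞) {x : E} (hR : D ⊆ ball x R) :
    ∫⁻ y in D, m ‖x - y‖ ∂μ ≤ ∫⁻ y in ball 0 R, m ‖y‖ ∂μ := by
  rw [← (Measure.measurePreserving_sub_left μ x).setLIntegral_comp_preimage_emb
    (MeasurableEquiv.subLeft x).measurableEmbedding _ (ball 0 R), preimage_sub_left_ball_zero]
  exact lintegral_mono_set hR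

variable [Nontrivial E]

lemma eLpNorm_norm_sub_norm_le {Γ m : ℝ → ℝ} (hm0 : ∀ a, 0 ≤ a → 0 ≤ m a)
    (hm : IntegrableOn (fun y => m ‖y‖) (ball 0 R) μ) (hmm : Measurable m) {x₁ x₂ : E}
    (hx₁ : D ⊆ ball x₁ R) (hx₂ : D ⊆ ball x₂ R)
    (h : ∀ a b, 0 < a → 0 < b → |a - b| ≤ ‖x₁ - x₂‖ → (Γ a - Γ b) ^ 2 ≤ m a + m b) :
    eLpNorm (fun y => Γ ‖x₁ - y‖ - Γ ‖x₂ - y‖) 2 (μ.restrict D) ≤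
      ENNReal.ofReal √(2 * ∫ y in ball 0 R, m ‖y‖ ∂μ) := by
  set J := ∫ y in ball 0 R, m ‖y‖ ∂μ
  have hJ : 0 ≤ J := integral_nonneg fun y => hm0 _ (norm_nonneg y)
  have translated (x : E) (hx : D ⊆ ball x R) :
      ∫⁻ y in D, ENNReal.ofReal (m ‖x - y‖) ∂μ ≤ ENNReal.ofReal J := by
    rw [ofReal_integral_eq_lintegral_ofReal hm (.of_forall fun y => hm0 _ (norm_nonneg y))]
    exact setLIntegral_norm_sub_le (fun a => ENNReal.ofReal (m a)) hx
  have sq_norm : ∫⁻ y in D, ‖Γ ‖x₁ - y‖ - Γ ‖x₂ - y‖‖ₑ ^ (2 : ℝ) ∂μ ≤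
      ENNReal.ofReal (2 * J) := by
    calc ∫⁻ y in D, ‖Γ ‖x₁ - y‖ - Γ ‖x₂ - y‖‖ₑ ^ (2 : ℝ) ∂μ
        ≤ ∫⁻ y in D, (ENNReal.ofReal (m ‖x₁ - y‖) + ENNReal.ofReal (m ‖x₂ - y‖)) ∂μ := by
          refine lintegral_mono_ae ?_
          filter_upwards [ae_restrict_of_ae (Measure.ae_ne μ x₁),
            ae_restrict_of_ae (Measure.ae_ne μ x₂)] with y h₁ h₂
          rw [← ofReal_norm, ENNReal.ofReal_rpow_of_nonneg (norm_nonneg _) zero_le_two,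
            Real.rpow_two, Real.norm_eq_abs, sq_abs]
          refine (ENNReal.ofReal_le_ofReal (h _ _ (norm_sub_pos_iff.2 h₁.symm)
            (norm_sub_pos_iff.2 h₂.symm) ?_)).trans ENNReal.ofReal_add_le
          simpa using abs_norm_sub_norm_le (x₁ - y) (x₂ - y)
      _ = (∫⁻ y in D, ENNReal.ofReal (m ‖x₁ - y‖) ∂μ) +
            ∫⁻ y in D, ENNReal.ofReal (m ‖x₂ - y‖) ∂μ := lintegral_add_left (by fun_prop) _
      _ ≤ ENNReal.ofReal J + ENNReal.ofReal J :=
          add_le_add (translated x₁ hx₁) (translated x₂ hx₂)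
      _ = ENNReal.ofReal (2 * J) := by rw [← ENNReal.ofReal_add hJ hJ, two_mul]
  rw [eLpNorm_eq_lintegral_rpow_enorm_toReal two_ne_zero ENNReal.ofNat_ne_top,
    Real.sqrt_eq_rpow, ← ENNReal.ofReal_rpow_of_nonneg (by positivity) (by norm_num)]
  exact ENNReal.rpow_le_rpow sq_norm (by norm_num)

lemma memLp_two_norm_sub {Γ : ℝ → ℝ} (hΓ : Measurable Γ) {C α : ℝ}
    (hα : α < Module.finrank ℝ E) (h : ∀ a, 0 < a → a < R → Γ a ^ 2 ≤ C * a ^ (-α)) {x : E}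
    (hx : D ⊆ ball x R) : MemLp (fun y => Γ ‖x - y‖) 2 (μ.restrict D) := by
  have meas : Measurable fun y : E => Γ ‖x - y‖ := by fun_prop
  rw [memLp_two_iff_integrable_sq meas.aestronglyMeasurable]
  have at_origin : IntegrableOn (fun y : E => Γ ‖y‖ ^ 2) (ball 0 R) μ := by
    refine integrableOn_ball_of_norm_le_rpow (C := C) (α := α) Module.finrank_pos hα ?_
      ((hΓ.comp measurable_norm).pow_const 2).aestronglyMeasurable
    filter_upwards [ae_restrict_mem measurableSet_ball,
      ae_restrict_of_ae (Measure.ae_ne μ (0 : E))] with y hy hy0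
    rw [Real.norm_of_nonneg (sq_nonneg _)]
    exact h _ (norm_pos_iff.2 hy0) (by simpa using hy)
  rw [← (Measure.measurePreserving_sub_left μ x).integrableOn_comp_preimage
    (MeasurableEquiv.subLeft x).measurableEmbedding, preimage_sub_left_ball_zero] at at_origin
  exact IntegrableOn.mono_set at_origin hx

end Radial

section FundamentalSolutions

lemma log_one_add_le_rpow_div {t s : ℝ} (ht : 0 ≤ t) (hs : 0 < s) (hs1 : s ≤ 1) :
    Real.log (1 + t) ≤ t ^ s / s := by
  rw [le_div_iff₀ hs, mul_comm, ← Real.log_rpow (by positivity)]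
  have subadd : (1 + t) ^ s ≤ 1 ^ s + t ^ s := Real.rpow_add_le_add_rpow zero_le_one ht hs.le hs1
  rw [Real.one_rpow] at subadd
  linarith [Real.log_le_sub_one_of_pos (x := (1 + t) ^ s) (by positivity)]

lemma sq_log_sub_log_le {a b δ s : ℝ} (ha : 0 < a) (hb : 0 < b) (hδ : |a - b| ≤ δ) (hs : 0 < s)
    (hs1 : s ≤ 1) :
    (Real.log a - Real.log b) ^ 2 ≤
      (δ ^ s / s) ^ 2 * a ^ (-(2 * s)) + (δ ^ s / s) ^ 2 * b ^ (-(2 * s)) := by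
  wlog hab : a ≤ b generalizing a b
  · rw [← neg_sub, neg_sq, add_comm]
    exact this hb ha (by rwa [abs_sub_comm]) (le_of_not_ge hab)
  have hδ0 : 0 ≤ δ := (abs_nonneg _).trans hδ
  have hba : b - a ≤ δ := (le_abs_self _).trans (by rwa [abs_sub_comm])
  have : 0 ≤ Real.log b - Real.log a := sub_nonneg.2 (Real.log_le_log ha hab)
  have upper : Real.log b - Real.log a ≤ (δ / a) ^ s / s := by
    rw [← Real.log_div hb.ne' ha.ne', show b / a = 1 + (b - a) / a by field_simp; ring]
    have := sub_nonneg.2 hab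
    refine (log_one_add_le_rpow_div (by positivity) hs hs1).trans ?_
    gcongr
  calc (Real.log a - Real.log b) ^ 2 = (Real.log b - Real.log a) ^ 2 := by ring
    _ ≤ ((δ / a) ^ s / s) ^ 2 := by gcongr
    _ = (δ ^ s / s) ^ 2 * a ^ (-(2 * s)) := by
        rw [Real.div_rpow hδ0 ha.le, Real.rpow_neg ha.le, mul_comm 2 s, Real.rpow_mul ha.le,
          Real.rpow_two]
        field_simp
    _ ≤ _ := le_add_of_nonneg_right (by positivity)

lemma sq_inv_sub_inv_le {a b δ : ℝ} (ha : 0 < a) (hb : 0 < b) (hδ : |a - b| ≤ δ) :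
    (a⁻¹ - b⁻¹) ^ 2 ≤ min (a⁻¹ ^ 2) (δ ^ 2 * a⁻¹ ^ 4) + min (b⁻¹ ^ 2) (δ ^ 2 * b⁻¹ ^ 4) := by
  wlog hab : a ≤ b generalizing a b
  · rw [← neg_sub, neg_sq, add_comm]
    exact this hb ha (by rwa [abs_sub_comm]) (le_of_not_ge hab)
  have hδ0 : 0 ≤ δ := (abs_nonneg _).trans hδ
  have hba : b - a ≤ δ := (le_abs_self _).trans (by rwa [abs_sub_comm])
  have inv_le : b⁻¹ ≤ a⁻¹ := inv_anti₀ ha hab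
  have : 0 ≤ a⁻¹ - b⁻¹ := sub_nonneg.2 inv_le
  refine le_add_of_le_of_nonneg (le_min ?_ ?_) (by positivity)
  · gcongr
    exact sub_le_self _ (inv_pos.2 hb).le
  · calc (a⁻¹ - b⁻¹) ^ 2 = ((b - a) * (a⁻¹ * b⁻¹)) ^ 2 := by congr 1; field_simp
      _ ≤ (δ * (a⁻¹ * a⁻¹)) ^ 2 := by have := sub_nonneg.2 hab; gcongr
      _ = δ ^ 2 * a⁻¹ ^ 4 := by ring

lemma abs_log_le_mul_rpow {a R : ℝ} (ha : 0 < a) (haR : a < R) :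
    |Real.log a| ≤ 2 * (1 + R) * a ^ (-(1 / 2) : ℝ) := by
  have : 0 < R := ha.trans haR
  have log_le : Real.log a ≤ a ^ (1 / 2 : ℝ) / (1 / 2) := Real.log_le_rpow_div ha.le (by norm_num)
  have log_inv_le : Real.log a⁻¹ ≤ a⁻¹ ^ (1 / 2 : ℝ) / (1 / 2) :=
    Real.log_le_rpow_div (inv_pos.2 ha).le (by norm_num)
  rw [Real.log_inv, Real.inv_rpow ha.le, ← Real.rpow_neg ha.le] at log_inv_le
  have split : a ^ (1 / 2 : ℝ) = a * a ^ (-(1 / 2) : ℝ) := by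
    nth_rewrite 2 [← Real.rpow_one a]
    rw [← Real.rpow_add ha]
    norm_num
  have hpos : 0 < a ^ (-(1 / 2) : ℝ) := Real.rpow_pos_of_pos ha _
  rw [split] at log_le
  rw [abs_le]
  constructor <;> nlinarith

lemma continuousOn_fundSol2 : ContinuousOn fundSol2 (Ioi 0) :=
  continuousOn_const.mul (Real.continuousOn_log.mono fun _ hx => ne_of_gt hx)

lemma continuousOn_fundSol3 : ContinuousOn fundSol3 (Ioi 0) :=
  continuousOn_const.mul (continuousOn_inv₀.mono fun _ hx => ne_of_gt hx)

lemma exists_eLpNorm_fundSol2_sub_le (R : ℝ) {s : ℝ} (hs : 0 < s) (hs1 : s < 1) :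
    ∃ C, 0 ≤ C ∧ ∀ (D : Set (Euc 2)) (x₁ x₂ : Euc 2), D ⊆ ball x₁ R → D ⊆ ball x₂ R →
      eLpNorm (fun y => fundSol2 ‖x₁ - y‖ - fundSol2 ‖x₂ - y‖) 2 (volume.restrict D) ≤
        ENNReal.ofReal (C * ‖x₁ - x₂‖ ^ s) := by
  have integrable : IntegrableOn (fun y : Euc 2 => ‖y‖ ^ (-(2 * s))) (ball 0 R) := by
    refine integrableOn_ball_of_norm_le_rpow (C := 1) (α := 2 * s) (by simp)
      (by simp; linarith) (.of_forall fun y => ?_)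
      (measurable_norm.pow_const _).aestronglyMeasurable
    rw [Real.norm_of_nonneg (by positivity), one_mul]
  set J := ∫ y in ball (0 : Euc 2) R, ‖y‖ ^ (-(2 * s))
  refine ⟨√(2 * J) / (2 * Real.pi * s), by positivity, fun D x₁ x₂ hx₁ hx₂ => ?_⟩
  set c := (‖x₁ - x₂‖ ^ s / (2 * Real.pi * s)) ^ 2 with hc
  refine (eLpNorm_norm_sub_norm_le (m := fun a => c * a ^ (-(2 * s)))
    (fun a ha => by positivity) (integrable.const_mul c) (by fun_prop) hx₁ hx₂
    fun a b ha hb hab => ?_).trans_eq ?_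
  · calc (fundSol2 a - fundSol2 b) ^ 2
        = (1 / (2 * Real.pi)) ^ 2 * (Real.log a - Real.log b) ^ 2 := by unfold fundSol2; ring
      _ ≤ _ := mul_le_mul_of_nonneg_left (sq_log_sub_log_le ha hb hab hs hs1.le) (sq_nonneg _)
      _ = c * a ^ (-(2 * s)) + c * b ^ (-(2 * s)) := by rw [hc]; field_simp
  · rw [integral_const_mul, mul_left_comm, Real.sqrt_mul (sq_nonneg _),
      Real.sqrt_sq (by positivity)]
    congr 1
    ring

lemma integrable_min_inv_pow : Integrable fun y : Euc 3 => min (‖y‖⁻¹ ^ 2) (‖y‖⁻¹ ^ 4) := by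
  rw [integrable_fun_norm_addHaar (volume : Measure (Euc 3))
    (f := fun a : ℝ => min (a⁻¹ ^ 2) (a⁻¹ ^ 4))]
  simp only [finrank_euclideanSpace_fin, smul_eq_mul, Nat.add_one_sub_one]
  refine Integrable.mono' (integrable_inv_one_add_sq.const_mul 2).integrableOn
    (Measurable.aestronglyMeasurable (by fun_prop)) ?_
  filter_upwards [ae_restrict_mem measurableSet_Ioi] with x (hx : 0 < x)
  rw [Real.norm_of_nonneg (by positivity), ← div_eq_mul_inv, le_div_iff₀ (by positivity)]
  calc x ^ 2 * min (x⁻¹ ^ 2) (x⁻¹ ^ 4) * (1 + x ^ 2)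
      = x ^ 2 * min (x⁻¹ ^ 2) (x⁻¹ ^ 4) + x ^ 4 * min (x⁻¹ ^ 2) (x⁻¹ ^ 4) := by ring
    _ ≤ x ^ 2 * x⁻¹ ^ 2 + x ^ 4 * x⁻¹ ^ 4 := by
        gcongr
        exacts [min_le_left _ _, min_le_right _ _]
    _ = 2 := by field_simp; norm_num

lemma min_inv_sq_eq_inv_sq_mul {δ : ℝ} (hδ : 0 < δ) (y : Euc 3) :
    min (‖y‖⁻¹ ^ 2) (δ ^ 2 * ‖y‖⁻¹ ^ 4) =
      δ⁻¹ ^ 2 * min (‖δ⁻¹ • y‖⁻¹ ^ 2) (‖δ⁻¹ • y‖⁻¹ ^ 4) := by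
  rw [norm_smul, norm_inv, Real.norm_of_nonneg hδ.le, mul_min_of_nonneg _ _ (by positivity),
    mul_inv, inv_inv]
  congr 1 <;> field_simp

lemma integrable_min_inv_sq {δ : ℝ} (hδ : 0 < δ) :
    Integrable fun y : Euc 3 => min (‖y‖⁻¹ ^ 2) (δ ^ 2 * ‖y‖⁻¹ ^ 4) := by
  simp_rw [min_inv_sq_eq_inv_sq_mul hδ]
  exact (integrable_min_inv_pow.comp_smul (inv_ne_zero hδ.ne')).const_mul _

lemma integral_min_inv_sq {δ : ℝ} (hδ : 0 < δ) :
    ∫ y : Euc 3, min (‖y‖⁻¹ ^ 2) (δ ^ 2 * ‖y‖⁻¹ ^ 4) =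
      δ * ∫ y : Euc 3, min (‖y‖⁻¹ ^ 2) (‖y‖⁻¹ ^ 4) := by
  simp_rw [min_inv_sq_eq_inv_sq_mul hδ]
  rw [integral_const_mul, Measure.integral_comp_smul volume
    (fun y : Euc 3 => min (‖y‖⁻¹ ^ 2) (‖y‖⁻¹ ^ 4)), finrank_euclideanSpace_fin, smul_eq_mul,
    abs_of_pos (by positivity)]
  field_simp

lemma exists_eLpNorm_fundSol3_sub_le :
    ∃ C, 0 ≤ C ∧ ∀ (D : Set (Euc 3)) (x₁ x₂ : Euc 3), Bornology.IsBounded D →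
      eLpNorm (fun y => fundSol3 ‖x₁ - y‖ - fundSol3 ‖x₂ - y‖) 2 (volume.restrict D) ≤
        ENNReal.ofReal (C * ‖x₁ - x₂‖ ^ (1 / 2 : ℝ)) := by
  set J := ∫ y : Euc 3, min (‖y‖⁻¹ ^ 2) (‖y‖⁻¹ ^ 4)
  refine ⟨√(2 * J) / (4 * Real.pi), by positivity, fun D x₁ x₂ hD => ?_⟩
  rcases eq_or_ne x₁ x₂ with rfl | hne
  · simp
  set δ := ‖x₁ - x₂‖
  have hδ : 0 < δ := norm_sub_pos_iff.2 hne
  obtain ⟨R₁, hR₁⟩ := hD.subset_ball x₁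
  obtain ⟨R₂, hR₂⟩ := hD.subset_ball x₂
  set c := (1 / (4 * Real.pi)) ^ 2 with hc
  have integrable := (integrable_min_inv_sq hδ).const_mul c
  refine (eLpNorm_norm_sub_norm_le (R := max R₁ R₂)
    (m := fun a => c * min (a⁻¹ ^ 2) (δ ^ 2 * a⁻¹ ^ 4)) (fun a _ => by positivity)
    integrable.integrableOn (by fun_prop) (hR₁.trans (ball_subset_ball (le_max_left _ _)))
    (hR₂.trans (ball_subset_ball (le_max_right _ _))) fun a b ha hb hab => ?_).trans
    (ENNReal.ofReal_le_ofReal ?_)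
  · calc (fundSol3 a - fundSol3 b) ^ 2 = c * (a⁻¹ - b⁻¹) ^ 2 := by unfold fundSol3; ring
      _ ≤ _ := mul_le_mul_of_nonneg_left (sq_inv_sub_inv_le ha hb hab) (sq_nonneg _)
      _ = _ := mul_add _ _ _
  · rw [integral_const_mul, show √(2 * J) / (4 * Real.pi) * δ ^ (1 / 2 : ℝ) =
      √(c * (δ * (2 * J))) by
        rw [hc, Real.sqrt_mul (sq_nonneg _), Real.sqrt_sq (by positivity),
          Real.sqrt_mul hδ.le, ← Real.sqrt_eq_rpow]
        ring]
    rw [mul_left_comm, mul_left_comm δ, ← integral_min_inv_sq hδ]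
    gcongr
    · exact .of_forall fun y => by positivity
    · exact integrable_min_inv_sq hδ
    · exact Measure.restrict_le_self

end FundamentalSolutions

/-- The regions on which the regularity of the solution is studied: the whole interval in
dimension one, and the balls whose closure lies in `D`. -/
def IsRegion {k : ℕ} (D A : Set (Euc k)) : Prop :=
  (k = 1 ∧ A = D) ∨ ∃ (c : Euc k) (r : ℝ), 0 < r ∧ closedBall c r ⊆ D ∧ A = ball c r

lemma IsRegion.subset {k : ℕ} {D A : Set (Euc k)} (hA : IsRegion D A) : A ⊆ D := by
  rcases hA with ⟨-, rfl⟩ | ⟨c, r, -, hball, rfl⟩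
  · exact subset_rfl
  · exact ball_subset_closedBall.trans hball

/-- A kernel `G` on a bounded open set `D` with square integrable sections `G(x, ·)` that depend
on `x`, in the norm of `L²(D)`, Hölder continuously with exponent `momentExponent k γ` on every
region. -/
structure IsHolderKernel {k : ℕ} (D : Set (Euc k)) (G : Euc k → Euc k → ℝ) : Prop where
  pos : 0 < k
  isOpen : IsOpen D
  isBounded : Bornology.IsBounded D
  nonempty : D.Nonempty
  memLp : ∀ x ∈ D, MemLp (G x) 2 (volume.restrict D)
  holder : ∀ A, IsRegion D A → ∀ γ : ℝ, 0 < γ → γ < 1 → ∃ C : ℝ, 0 ≤ C ∧ ∀ x₁ ∈ A, ∀ x₂ ∈ A,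
    eLpNorm (G x₁ - G x₂) 2 (volume.restrict D) ≤
      ENNReal.ofReal (C * ‖x₁ - x₂‖ ^ momentExponent k γ)

section Interval

variable {b : ℝ}

lemma norm_euc_one (x : Euc 1) : ‖x‖ = |x 0| := by
  rw [EuclideanSpace.norm_eq]
  simp [Real.sqrt_sq_eq_abs]

lemma isOpen_interval : IsOpen {x : Euc 1 | 0 < x 0 ∧ x 0 < b} :=
  (isOpen_lt continuous_const (by fun_prop)).and (isOpen_lt (by fun_prop) continuous_const)

lemma isBounded_interval : Bornology.IsBounded {x : Euc 1 | 0 < x 0 ∧ x 0 < b} := by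
  refine isBounded_iff_forall_norm_le.2 ⟨b, fun x hx => ?_⟩
  rw [norm_euc_one, abs_of_pos hx.1]
  exact hx.2.le

lemma abs_greenInterval_le {x y : Euc 1} (hx : 0 < x 0 ∧ x 0 < b) (hy : 0 < y 0 ∧ y 0 < b) :
    |greenInterval b x y| ≤ 2 * b := by
  have hb : 0 < b := hx.1.trans hx.2
  have product_nonneg : 0 ≤ x 0 * y 0 / b := div_nonneg (mul_nonneg hx.1.le hy.1.le) hb.le
  have product_le : x 0 * y 0 / b ≤ b := by
    rw [div_le_iff₀ hb]
    exact mul_le_mul hx.2.le hy.2.le hy.1.le hb.le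
  have min_pos : 0 < min (x 0) (y 0) := lt_min hx.1 hy.1
  have min_le : min (x 0) (y 0) ≤ b := (min_le_left _ _).trans hx.2.le
  rw [greenInterval, abs_le]
  constructor <;> linarith

lemma abs_greenInterval_sub_le (x₁ x₂ : Euc 1) {y : Euc 1} (hy : 0 < y 0 ∧ y 0 < b) :
    |greenInterval b x₁ y - greenInterval b x₂ y| ≤ 2 * ‖x₁ - x₂‖ := by
  have hb : 0 < b := hy.1.trans hy.2
  rw [norm_euc_one, PiLp.sub_apply, two_mul,
    show greenInterval b x₁ y - greenInterval b x₂ y =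
      (min (x₁ 0) (y 0) - min (x₂ 0) (y 0)) - (x₁ 0 - x₂ 0) * (y 0 / b) by
        simp only [greenInterval]; ring]
  refine (abs_sub _ _).trans (add_le_add ?_ ?_)
  · simpa using abs_min_sub_min_le_max (x₁ 0) (y 0) (x₂ 0) (y 0)
  · rw [abs_mul, abs_of_nonneg (div_nonneg hy.1.le hb.le)]
    exact mul_le_of_le_one_right (abs_nonneg _) ((div_le_one hb).2 hy.2.le)

lemma isHolderKernel_greenInterval (hb : 0 < b) :
    IsHolderKernel {x : Euc 1 | 0 < x 0 ∧ x 0 < b} (greenInterval b) where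
  pos := one_pos
  isOpen := isOpen_interval
  isBounded := isBounded_interval
  nonempty := ⟨EuclideanSpace.single 0 (b / 2), by simpa using hb⟩
  memLp x hx := by
    have : IsFiniteMeasure (volume.restrict {x : Euc 1 | 0 < x 0 ∧ x 0 < b}) :=
      ⟨by rw [Measure.restrict_apply_univ]; exact isBounded_interval.measure_lt_top⟩
    refine MemLp.of_bound (Measurable.aestronglyMeasurable ?_) (2 * b) ?_
    · unfold greenInterval
      fun_prop
    · filter_upwards [ae_restrict_mem isOpen_interval.measurableSet] with y hy
      exact abs_greenInterval_le hx hy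
  holder A _ γ _ _ := by
    set N := eLpNorm (fun _ : Euc 1 => (1 : ℝ)) 2
      (volume.restrict {x : Euc 1 | 0 < x 0 ∧ x 0 < b})
    have hN : N ≠ ∞ := by
      refine (memLp_const_iff two_ne_zero ENNReal.ofNat_ne_top).2 (.inr ?_) |>.eLpNorm_ne_top
      rw [Measure.restrict_apply_univ]
      exact isBounded_interval.measure_lt_top
    refine ⟨2 * N.toReal, by positivity, fun x₁ _ x₂ _ => ?_⟩
    rw [momentExponent, if_pos rfl, Real.rpow_one, mul_right_comm,
      ENNReal.ofReal_mul (by positivity), ENNReal.ofReal_toReal hN]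
    refine eLpNorm_le_mul_eLpNorm_of_ae_le_mul ?_ 2
    filter_upwards [ae_restrict_mem isOpen_interval.measurableSet] with y hy
    simpa using abs_greenInterval_sub_le x₁ x₂ hy

end Interval

section Domain

lemma isHolderKernel_greenFunction {k : ℕ} [NeZero k] (hk : k ≠ 1) {D : Set (Euc k)}
    (hD : IsOpen D) (hb : Bornology.IsBounded D) (hne : D.Nonempty) (hreg : HasRegularBoundary D)
    {Γ : ℝ → ℝ} (hΓ : ContinuousOn Γ (Ioi 0)) {m : ℝ}
    (hm : ∀ y ∈ D, ∀ z ∈ frontier D, m ≤ Γ ‖z - y‖)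
    (hΓ2 : ∀ x ∈ D, MemLp (fun y => Γ ‖x - y‖) 2 (volume.restrict D))
    (hG : ∀ x ∈ D, eLpNorm (greenFunction Γ D x) 2 (volume.restrict D) ≠ ∞)
    (hξ : ∀ γ, 0 < γ → momentExponent k γ ≤ 1)
    (hΓH : ∀ γ, 0 < γ → γ < 1 → ∃ C : ℝ, 0 ≤ C ∧ ∀ x₁ ∈ D, ∀ x₂ ∈ D,
      eLpNorm (fun y => Γ ‖x₁ - y‖ - Γ ‖x₂ - y‖) 2 (volume.restrict D) ≤
        ENNReal.ofReal (C * ‖x₁ - x₂‖ ^ momentExponent k γ)) :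
    IsHolderKernel D (greenFunction Γ D) where
  pos := Nat.pos_of_neZero k
  isOpen := hD
  isBounded := hb
  nonempty := hne
  memLp x hx := memLp_greenFunction hD hb hreg hΓ (hΓ2 x hx) (hG x hx) hx
  holder := by
    rintro A (⟨rfl, -⟩ | ⟨c, r, hr, hball, rfl⟩) γ hγ0 hγ1
    · exact absurd rfl hk
    · obtain ⟨C, hC, singular⟩ := hΓH γ hγ0 hγ1
      exact exists_eLpNorm_greenFunction_sub_le hD hb hreg hΓ hm hΓ2 hG (hξ γ hγ0) hC singular
        hr hball

lemma dist_lt_diam_closure_add_one {X : Type*} [PseudoMetricSpace X] {D : Set X}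
    (hb : Bornology.IsBounded D) {x y : X} (hx : x ∈ closure D) (hy : y ∈ closure D) :
    dist x y < diam (closure D) + 1 :=
  (dist_le_diam_of_mem hb.closure hx hy).trans_lt (lt_add_one _)

lemma subset_ball_diam_closure_add_one {X : Type*} [PseudoMetricSpace X] {D : Set X}
    (hb : Bornology.IsBounded D) {x : X} (hx : x ∈ D) : D ⊆ ball x (diam (closure D) + 1) :=
  fun _ hy => dist_lt_diam_closure_add_one hb (subset_closure hy) (subset_closure hx)

lemma isHolderKernel_greenFunction_fundSol2 {D : Set (Euc 2)} (hD : IsOpen D)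
    (hb : Bornology.IsBounded D) (hne : D.Nonempty) (hreg : HasRegularBoundary D)
    (hG : ∀ x ∈ D, eLpNorm (greenFunction fundSol2 D x) 2 (volume.restrict D) ≠ ∞) :
    IsHolderKernel D (greenFunction fundSol2 D) := by
  have moment (γ : ℝ) : momentExponent 2 γ = 1 - γ := by simp [momentExponent]
  set R := diam (closure D) + 1
  refine isHolderKernel_greenFunction (m := fundSol2 R) (by norm_num) hD hb hne hreg
    continuousOn_fundSol2 (fun y hy z hz => ?_) (fun x hx => ?_) hG (fun γ hγ => ?_)
    fun γ hγ0 hγ1 => ?_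
  · refine mul_le_mul_of_nonpos_left (Real.log_le_log (norm_sub_pos_of_mem_frontier hD hy hz) ?_)
      (neg_nonpos.2 (by positivity))
    rw [← dist_eq_norm]
    exact (dist_lt_diam_closure_add_one hb (frontier_subset_closure hz) (subset_closure hy)).le
  · refine memLp_two_norm_sub (C := (1 / (2 * Real.pi)) ^ 2 * (2 * (1 + R)) ^ 2) (α := 1)
      (by unfold fundSol2; fun_prop) (by simp) (fun a ha haR => ?_)
      (subset_ball_diam_closure_add_one hb hx)
    calc fundSol2 a ^ 2 = (1 / (2 * Real.pi)) ^ 2 * |Real.log a| ^ 2 := by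
          rw [fundSol2, mul_pow, neg_sq, sq_abs]
      _ ≤ (1 / (2 * Real.pi)) ^ 2 * (2 * (1 + R) * a ^ (-(1 / 2) : ℝ)) ^ 2 := by
          gcongr
          exact abs_log_le_mul_rpow ha haR
      _ = (1 / (2 * Real.pi)) ^ 2 * (2 * (1 + R)) ^ 2 * a ^ (-1 : ℝ) := by
          rw [mul_pow _ (a ^ _), ← Real.rpow_mul_natCast ha.le, mul_assoc]
          norm_num
  · rw [moment]
    linarith
  · obtain ⟨C, hC, bound⟩ := exists_eLpNorm_fundSol2_sub_le R (s := 1 - γ) (by linarith)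
      (by linarith)
    rw [moment]
    exact ⟨C, hC, fun x₁ hx₁ x₂ hx₂ => bound D x₁ x₂ (subset_ball_diam_closure_add_one hb hx₁)
      (subset_ball_diam_closure_add_one hb hx₂)⟩

lemma isHolderKernel_greenFunction_fundSol3 {D : Set (Euc 3)} (hD : IsOpen D)
    (hb : Bornology.IsBounded D) (hne : D.Nonempty) (hreg : HasRegularBoundary D)
    (hG : ∀ x ∈ D, eLpNorm (greenFunction fundSol3 D x) 2 (volume.restrict D) ≠ ∞) :
    IsHolderKernel D (greenFunction fundSol3 D) := by
  have moment (γ : ℝ) : momentExponent 3 γ = 1 / 2 := by simp [momentExponent]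
  refine isHolderKernel_greenFunction (m := 0) (by norm_num) hD hb hne hreg
    continuousOn_fundSol3 (fun y _ z _ => ?_) (fun x hx => ?_) hG (fun γ _ => ?_)
    fun γ _ _ => ?_
  · unfold fundSol3
    positivity
  · refine memLp_two_norm_sub (C := (1 / (4 * Real.pi)) ^ 2) (α := 2)
      (by unfold fundSol3; fun_prop) (by norm_num) (fun a ha _ => ?_)
      (subset_ball_diam_closure_add_one hb hx)
    rw [fundSol3, mul_pow, Real.rpow_neg ha.le, Real.rpow_two, inv_pow]
  · rw [moment]
    norm_num
  · obtain ⟨C, hC, bound⟩ := exists_eLpNorm_fundSol3_sub_le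
    rw [moment]
    exact ⟨C, hC, fun x₁ _ x₂ _ => bound D x₁ x₂ hb⟩

theorem IsDomainWithGreen.isHolderKernel {k : ℕ} {D : Set (Euc k)} {G : Euc k → Euc k → ℝ}
    (hG : IsDomainWithGreen k D G) (hK : greenSup D G ≠ ∞) : IsHolderKernel D G := by
  have sections (x : Euc k) (hx : x ∈ D) : eLpNorm (G x) 2 (volume.restrict D) ≠ ∞ :=
    ne_top_of_le_ne_top hK
      (le_iSup₂ (f := fun x _ => eLpNorm (G x) 2 (volume.restrict D)) x hx)
  cases hG with
  | dim1 b hb => exact isHolderKernel_greenInterval hb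
  | dim2 D hD hconn hb hreg =>
    exact isHolderKernel_greenFunction_fundSol2 hD hb hconn.nonempty hreg sections
  | dim3 D hD hconn hb hreg =>
    exact isHolderKernel_greenFunction_fundSol3 hD hb hconn.nonempty hreg sections

end Domain

/-! ### The nonlinearity -/

section Nonlinearity

variable {k d : ℕ} {D : Set (Euc k)} {f : Euc d → Euc d} {F : L2 D d → L2 D d}

lemma isFiniteMeasure_restrict_of_isBounded (hb : Bornology.IsBounded D) :
    IsFiniteMeasure (volume.restrict D) :=
  isFiniteMeasure_restrict.2 hb.measure_lt_top.ne

lemma neZero_restrict_of_isOpen (hD : IsOpen D) (hne : D.Nonempty) :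
    NeZero (volume.restrict D) :=
  ⟨by simpa using (hD.measure_pos volume hne).ne'⟩

lemma exists_measureReal_ball_eq_mul {E : Type*} [NormedAddCommGroup E] [NormedSpace ℝ E]
    [MeasurableSpace E] [BorelSpace E] [FiniteDimensional ℝ E] [Nontrivial E] (μ : Measure E)
    [μ.IsAddHaarMeasure] (c : E) {r : ℝ} (hr : 0 ≤ r) {t : ℝ} (ht₀ : 0 ≤ t) (ht₁ : t ≤ 1) :
    ∃ s ≤ r, μ.real (ball c s) = t * μ.real (ball c r) := by
  have hn : Module.finrank ℝ E ≠ 0 := Module.finrank_pos.ne'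
  refine ⟨t ^ (Module.finrank ℝ E : ℝ)⁻¹ * r,
    mul_le_of_le_one_left hr (Real.rpow_le_one ht₀ ht₁ (by positivity)), ?_⟩
  rw [measureReal_def, measureReal_def,
    Measure.addHaar_ball μ c (by positivity), Measure.addHaar_ball μ c hr, ENNReal.toReal_mul,
    ENNReal.toReal_mul, ENNReal.toReal_ofReal (by positivity),
    ENNReal.toReal_ofReal (by positivity), mul_pow,
    Real.rpow_inv_natCast_pow ht₀ hn, mul_assoc]

lemma exists_measurableSet_ne_zero_compl_ne_zero [NeZero k] (hD : IsOpen D) (hne : D.Nonempty) :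
    ∃ E, MeasurableSet E ∧ volume.restrict D E ≠ 0 ∧ volume.restrict D Eᶜ ≠ 0 := by
  obtain ⟨c, hc⟩ := hne
  obtain ⟨r, hr, hrD⟩ := Metric.isOpen_iff.1 hD c hc
  have hpos : 0 < volume.real (ball c r) :=
    ENNReal.toReal_pos (measure_ball_pos volume c hr).ne' measure_ball_lt_top.ne
  obtain ⟨s, hsr, hs⟩ := exists_measureReal_ball_eq_mul volume c hr.le
    (by norm_num : (0 : ℝ) ≤ 1 / 2) (by norm_num)
  have hsub : ball c s ⊆ ball c r := ball_subset_ball hsr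
  have hdiff : volume.real (ball c r \ ball c s) = 1 / 2 * volume.real (ball c r) := by
    rw [measureReal_sdiff hsub measurableSet_ball, hs]
    ring
  refine ⟨ball c s, measurableSet_ball, fun h => ?_, fun h => ?_⟩
  · rw [Measure.restrict_apply measurableSet_ball, inter_eq_left.2 (hsub.trans hrD)] at h
    rw [measureReal_def, h, ENNReal.toReal_zero] at hs
    linarith
  · rw [Measure.restrict_apply measurableSet_ball.compl] at h
    have hdiff_sub : ball c r \ ball c s ⊆ (ball c s)ᶜ ∩ D := fun z hz => ⟨hz.2, hrD hz.1⟩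
    have h₀ : volume (ball c r \ ball c s) = 0 := measure_mono_null hdiff_sub h
    rw [measureReal_def, h₀, ENNReal.toReal_zero] at hdiff
    linarith

lemma IsNemytskii.apply_const [IsFiniteMeasure (volume.restrict D)] (hF : IsNemytskii D f F)
    (x : Euc d) :
    F (Lp.const 2 (volume.restrict D) x) = Lp.const 2 (volume.restrict D) (f x) := by
  refine Lp.ext ?_
  filter_upwards [hF (Lp.const 2 (volume.restrict D) x),
    Lp.coeFn_const 2 (volume.restrict D) x, Lp.coeFn_const 2 (volume.restrict D) (f x)]
    with y hFy hx hfx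
  rw [hFy, hx, hfx, Function.const_apply, Function.const_apply]

lemma IsNemytskii.continuous_of_continuous [IsFiniteMeasure (volume.restrict D)]
    [NeZero (volume.restrict D)] (hF : IsNemytskii D f F) (hc : Continuous F) :
    Continuous f := by
  set κ := (volume.restrict D).real univ ^ (1 / (2 : ℝ≥0∞).toReal)
  have hκ : 0 < κ := Real.rpow_pos_of_pos measureReal_univ_pos _
  have hnorm (y : Euc d) : ‖Lp.const 2 (volume.restrict D) y‖ = ‖y‖ * κ :=
    Lp.norm_const _ _ _ two_ne_zero
  have hconst : Continuous fun x : Euc d => F (Lp.const 2 (volume.restrict D) x) :=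
    hc.comp (Lp.constL 2 (volume.restrict D) ℝ).continuous
  refine continuous_iff_continuousAt.2 fun x₀ => tendsto_iff_norm_sub_tendsto_zero.2 ?_
  have hlim := (tendsto_iff_norm_sub_tendsto_zero.1 (hconst.tendsto x₀)).mul_const κ⁻¹
  rw [zero_mul] at hlim
  refine hlim.congr fun x => ?_
  rw [hF.apply_const, hF.apply_const, ← map_sub, hnorm, mul_inv_cancel_right₀ hκ.ne']

lemma norm_indicatorConstLp_eq_mul_sqrt {E : Set (Euc k)} (hE : MeasurableSet E)
    (hμE : volume.restrict D E ≠ ∞) (x : Euc d) :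
    ‖indicatorConstLp 2 hE hμE x‖ = ‖x‖ * √((volume.restrict D).real E) := by
  rw [norm_indicatorConstLp two_ne_zero ENNReal.ofNat_ne_top, ENNReal.toReal_ofNat,
    Real.sqrt_eq_rpow]

lemma IsNemytskii.norm_mul_sqrt_le (hF : IsNemytskii D f F) {E : Set (Euc k)}
    (hE : MeasurableSet E) (hμE : volume.restrict D E ≠ ∞) (x : Euc d) :
    ‖f x‖ * √((volume.restrict D).real E) ≤ ‖F (indicatorConstLp 2 hE hμE x)‖ := by
  rw [← norm_indicatorConstLp_eq_mul_sqrt hE hμE]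
  refine Lp.norm_le_norm_of_ae_le ?_
  filter_upwards [hF (indicatorConstLp 2 hE hμE x),
    indicatorConstLp_coeFn (p := 2) (hs := hE) (hμs := hμE) (c := x),
    indicatorConstLp_coeFn (p := 2) (hs := hE) (hμs := hμE) (c := f x)] with y hFy hx hfx
  rw [hFy, hx, hfx]
  by_cases hy : y ∈ E
  · rw [indicator_of_mem hy, indicator_of_mem hy]
  · rw [indicator_of_notMem hy, norm_zero]
    exact norm_nonneg _

/- `F` is tested on `x 1_E`, where `E` is a ball of volume proportional to `(1 + ‖x‖)⁻²`: these
functions stay in a fixed ball of `L²`. -/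
lemma IsNemytskii.exists_norm_le_mul_one_add_norm [NeZero k]
    [IsFiniteMeasure (volume.restrict D)] (hD : IsOpen D) (hne : D.Nonempty)
    (hF : IsNemytskii D f F) (hbd : IsBoundedOperator F) :
    ∃ M : ℝ, 0 ≤ M ∧ ∀ x, ‖f x‖ ≤ M * (1 + ‖x‖) := by
  obtain ⟨c, hc⟩ := hne
  obtain ⟨r, hr, hrD⟩ := Metric.isOpen_iff.1 hD c hc
  set V := volume.real (ball c r)
  have hV : 0 < V := ENNReal.toReal_pos (measure_ball_pos volume c hr).ne' measure_ball_lt_top.ne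
  obtain ⟨M, hM₀, hM⟩ := (hbd (closedBall 0 √V) isBounded_closedBall).exists_pos_norm_le
  refine ⟨M / √V, by positivity, fun x => ?_⟩
  have hn : 1 ≤ 1 + ‖x‖ := le_add_of_nonneg_right (norm_nonneg x)
  obtain ⟨s, hsr, hs⟩ := exists_measureReal_ball_eq_mul volume c hr.le
    (t := ((1 + ‖x‖) ^ 2)⁻¹) (by positivity) (inv_le_one_of_one_le₀ (one_le_pow₀ hn))
  have hμ : volume.restrict D (ball c s) ≠ ∞ := measure_ne_top _ _
  have hsqrt : √((volume.restrict D).real (ball c s)) = √V / (1 + ‖x‖) := by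
    rw [measureReal_restrict_apply measurableSet_ball,
      inter_eq_left.2 ((ball_subset_ball hsr).trans hrD), hs, inv_mul_eq_div,
      Real.sqrt_div hV.le, Real.sqrt_sq (by positivity)]
  have hball : ‖indicatorConstLp 2 measurableSet_ball hμ x‖ ≤ √V := by
    rw [norm_indicatorConstLp_eq_mul_sqrt, hsqrt, mul_div_left_comm]
    exact mul_le_of_le_one_right (Real.sqrt_nonneg V) (div_le_one_of_le₀ (by simp) (by positivity))
  have hle : ‖f x‖ * (√V / (1 + ‖x‖)) ≤ M := by
    rw [← hsqrt]
    exact (hF.norm_mul_sqrt_le measurableSet_ball hμ x).trans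
      (hM _ (mem_image_of_mem F (mem_closedBall_zero_iff.2 hball)))
  rwa [← mul_div_assoc, div_le_iff₀ (by positivity), ← le_div_iff₀ (Real.sqrt_pos.2 hV),
    mul_div_right_comm] at hle

/- The condition on `F` is applied to the function equal to `x` on `E` and to `y` off `E`. -/
lemma IsNemytskii.norm_sub_le_of_pointwise [IsFiniteMeasure (volume.restrict D)]
    (hF : IsNemytskii D f F) {E : Set (Euc k)} (hE : MeasurableSet E)
    (hE₀ : volume.restrict D E ≠ 0) (hE₁ : volume.restrict D Eᶜ ≠ 0) {L : ℝ}
    (hL : ∀ v : L2 D d, ∀ᵐ z₁ ∂(volume.restrict D), ∀ᵐ z₂ ∂(volume.restrict D),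
      ‖F v z₁ - F v z₂‖ ≤ L * ‖v z₁ - v z₂‖) (x y : Euc d) :
    ‖f x - f y‖ ≤ L * ‖x - y‖ := by
  classical
  have hmem : MemLp (E.piecewise (fun _ => x) fun _ => y) 2 (volume.restrict D) :=
    (memLp_const x).piecewise hE (memLp_const y)
  obtain ⟨v, hv⟩ : ∃ v : L2 D d, v =ᵐ[volume.restrict D] E.piecewise (fun _ => x) fun _ => y :=
    ⟨hmem.toLp _, hmem.coeFn_toLp⟩
  have hFv := hF v
  obtain ⟨z₁, hz₁, ⟨hL₁, hv₁⟩, hF₁⟩ := Measure.exists_mem_of_measure_ne_zero_of_ae hE₀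
    (ae_restrict_of_ae (((hL v).and hv).and hFv))
  obtain ⟨z₂, hz₂, ⟨hL₂, hv₂⟩, hF₂⟩ := Measure.exists_mem_of_measure_ne_zero_of_ae hE₁
    (ae_restrict_of_ae ((hL₁.and hv).and hFv))
  rwa [hF₁, hF₂, hv₁, hv₂, piecewise_eq_of_mem _ _ _ hz₁, piecewise_eq_of_notMem _ _ _ hz₂] at hL₂

lemma IsNemytskii.norm_sub_le (hF : IsNemytskii D f F) {L : ℝ}
    (hf : ∀ x y, ‖f x - f y‖ ≤ L * ‖x - y‖) (v w : L2 D d) : ‖F v - F w‖ ≤ L * ‖v - w‖ := by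
  refine Lp.norm_le_mul_norm_of_ae_le_mul ?_
  filter_upwards [hF v, hF w, Lp.coeFn_sub v w, Lp.coeFn_sub (F v) (F w)]
    with z hFv hFw hsub hFsub
  rw [hsub, hFsub, Pi.sub_apply, Pi.sub_apply, hFv, hFw]
  exact hf _ _

lemma CondMbar.neg_le_inner [NeZero k] [IsFiniteMeasure (volume.restrict D)] (hD : IsOpen D)
    (hne : D.Nonempty) {L : ℝ} (hM : CondMbar D F L) (v w : L2 D d) :
    -(L * ‖v - w‖ ^ 2) ≤ ⟪v - w, F v - F w⟫ := by
  obtain ⟨_, f₁, f₂, F₁, F₂, _, hF₂, hsum, _, hmono, hlip⟩ := hM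
  obtain ⟨E, hE, hE₀, hE₁⟩ := exists_measurableSet_ne_zero_compl_ne_zero hD hne
  have hle := hF₂.norm_sub_le (hF₂.norm_sub_le_of_pointwise hE hE₀ hE₁ hlip) v w
  have hsplit : F v - F w = (F₁ v - F₁ w) + (F₂ v - F₂ w) := by rw [hsum, hsum]; abel
  have hinner : -(‖v - w‖ * (L * ‖v - w‖)) ≤ ⟪v - w, F₂ v - F₂ w⟫ :=
    (neg_le_neg (mul_le_mul_of_nonneg_left hle (norm_nonneg _))).trans
      (abs_le.1 (abs_real_inner_le_norm _ _)).1
  rw [hsplit, inner_add_right]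
  linarith [hmono v w]

lemma IsNemytskii.exists_norm_le_of_linear_growth [IsFiniteMeasure (volume.restrict D)]
    (hF : IsNemytskii D f F) {M : ℝ} (hM₀ : 0 ≤ M) (hM : ∀ x, ‖f x‖ ≤ M * (1 + ‖x‖)) :
    ∃ B : ℝ, 0 ≤ B ∧ ∀ v : L2 D d, ‖F v‖ ≤ B * (1 + ‖v‖) := by
  set one : Lp ℝ 2 (volume.restrict D) := Lp.const 2 (volume.restrict D) 1 with hone
  refine ⟨M * max 1 ‖one‖, by positivity, fun v => ?_⟩
  have hv : MemLp (fun x => ‖v x‖) 2 (volume.restrict D) := (Lp.memLp v).norm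
  have hFv : ‖F v‖ ≤ M * ‖one + hv.toLp _‖ := by
    refine Lp.norm_le_mul_norm_of_ae_le_mul ?_
    filter_upwards [hF v, Lp.coeFn_add one (hv.toLp _),
      Lp.coeFn_const 2 (volume.restrict D) (1 : ℝ), hv.coeFn_toLp] with z hFz hadd hc hvz
    rw [hFz, hadd, Pi.add_apply, hone, hc, hvz]
    exact (hM _).trans (mul_le_mul_of_nonneg_left (le_abs_self _) hM₀)
  have hnorm : ‖hv.toLp _‖ = ‖v‖ := by rw [Lp.norm_toLp, Lp.norm_def, eLpNorm_norm]
  calc ‖F v‖ ≤ M * ‖one + hv.toLp _‖ := hFv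
    _ ≤ M * (‖one‖ * 1 + 1 * ‖v‖) := by
        rw [mul_one, one_mul, ← hnorm]
        gcongr
        exact norm_add_le _ _
    _ ≤ M * (max 1 ‖one‖ * 1 + max 1 ‖one‖ * ‖v‖) := by
        gcongr
        · exact le_max_right _ _
        · exact le_max_left _ _
    _ = M * max 1 ‖one‖ * (1 + ‖v‖) := by ring

lemma IsPoincareConst.mul_norm_sub_le {G : Euc k → Euc k → ℝ} {a : ℝ}
    (ha : IsPoincareConst D G d a) {L : ℝ}
    (hmono : ∀ v w : L2 D d, -(L * ‖v - w‖ ^ 2) ≤ ⟪v - w, F v - F w⟫) {u z : L2 D d}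
    (huz : ∀ᵐ x ∂(volume.restrict D), u x + ∫ y in D, G x y • F u y = z x) :
    (a - L) * ‖z - u‖ ≤ ‖F z‖ := by
  have hconv : ∀ᵐ x ∂(volume.restrict D), ∫ y in D, G x y • F u y = (z - u : L2 D d) x := by
    filter_upwards [huz, Lp.coeFn_sub z u] with x hx hsub
    rw [hsub, Pi.sub_apply, ← hx, add_sub_cancel_left]
  have hnorm : ∫ x in D, ‖∫ y in D, G x y • F u y‖ ^ 2 = ‖z - u‖ ^ 2 := by
    rw [← real_inner_self_eq_norm_sq, L2.inner_def]
    refine integral_congr_ae ?_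
    filter_upwards [hconv] with x hx
    rw [hx, real_inner_self_eq_norm_sq]
  have hinner : ∫ x in D, ⟪∫ y in D, G x y • F u y, F u x⟫ = ⟪z - u, F u⟫ := by
    rw [L2.inner_def]
    refine integral_congr_ae ?_
    filter_upwards [hconv] with x hx
    rw [hx]
  have hpoincare : a * ‖z - u‖ ^ 2 ≤ ⟪z - u, F u⟫ := hnorm ▸ hinner ▸ ha.2 (F u)
  have hweak := hmono z u
  rw [inner_sub_right] at hweak
  rcases (norm_nonneg (z - u)).eq_or_lt with hzero | hpos
  · rw [← hzero, mul_zero]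
    exact norm_nonneg _
  · refine le_of_mul_le_mul_left ?_ hpos
    linarith [real_inner_le_norm (z - u) (F z)]

lemma IsPoincareConst.exists_norm_le {G : Euc k → Euc k → ℝ} {a : ℝ}
    (ha : IsPoincareConst D G d a) {L : ℝ} (hLa : L < a)
    (hmono : ∀ v w : L2 D d, -(L * ‖v - w‖ ^ 2) ≤ ⟪v - w, F v - F w⟫) {B : ℝ} (hB₀ : 0 ≤ B)
    (hB : ∀ v : L2 D d, ‖F v‖ ≤ B * (1 + ‖v‖)) :
    ∃ B' : ℝ, 0 ≤ B' ∧ ∀ u z : L2 D d,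
      (∀ᵐ x ∂(volume.restrict D), u x + ∫ y in D, G x y • F u y = z x) →
      ‖F u‖ ≤ B' * (1 + ‖z‖) := by
  have hpos : 0 < a - L := sub_pos.2 hLa
  refine ⟨B * (1 + B / (a - L)), by positivity, fun u z huz => ?_⟩
  have hdist : ‖z - u‖ ≤ B / (a - L) * (1 + ‖z‖) := by
    rw [div_mul_eq_mul_div, le_div_iff₀' hpos]
    exact (ha.mul_norm_sub_le hmono huz).trans (hB z)
  have hu : ‖u‖ ≤ ‖z‖ + ‖z - u‖ := by
    simpa only [sub_sub_cancel] using norm_sub_le z (z - u)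
  calc ‖F u‖ ≤ B * (1 + ‖u‖) := hB u
    _ ≤ B * ((1 + ‖z‖) + B / (a - L) * (1 + ‖z‖)) :=
        mul_le_mul_of_nonneg_left (by linarith) hB₀
    _ = B * (1 + B / (a - L)) * (1 + ‖z‖) := by ring

end Nonlinearity

/-! ### Moments of the noise -/

section Noise

variable {Ω : Type*} [MeasurableSpace Ω] {P : Measure Ω} {k d : ℕ}

lemma eLpNorm_eq_mul_eLpNorm_gaussianReal {X : Ω → ℝ} (hX : HasGaussianLaw X P)
    (hmean : ∫ ω, X ω ∂P = 0) {s : ℝ} (hs : 0 ≤ s) (hsq : ∫ ω, X ω ^ 2 ∂P = s ^ 2) (p : ℝ≥0∞) :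
    eLpNorm X p P = ENNReal.ofReal s * eLpNorm id p (gaussianReal 0 1) := by
  have hscale : gaussianReal 0 Var[X; P].toNNReal = (gaussianReal 0 1).map (fun x => s * x) := by
    rw [gaussianReal_map_const_mul, mul_zero, mul_one,
      variance_of_integral_eq_zero hX.aemeasurable hmean, hsq]
    congr 1
    exact Real.toNNReal_of_nonneg _
  have hlaw := hX.map_eq_gaussianReal
  rw [hmean, hscale] at hlaw
  calc eLpNorm X p P = eLpNorm id p (P.map X) := by
        rw [eLpNorm_map_measure aestronglyMeasurable_id hX.aemeasurable, Function.id_comp]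
    _ = eLpNorm (s • id) p (gaussianReal 0 1) := by
        rw [hlaw, eLpNorm_map_measure aestronglyMeasurable_id (by fun_prop), Function.id_comp]
        rfl
    _ = ENNReal.ofReal s * eLpNorm id p (gaussianReal 0 1) := by
        rw [eLpNorm_const_smul, Real.enorm_eq_ofReal hs]

section WhiteNoise

variable {W : Fin d → Lp ℝ 2 (volume : Measure (Euc k)) → Ω → ℝ} {D : Set (Euc k)}
  {h h₁ h₂ : Euc k → ℝ}

lemma IsWhiteNoise.eLpNorm_apply (hW : IsWhiteNoise P k d W) (j : Fin d)
    (φ : Lp ℝ 2 (volume : Measure (Euc k))) (p : ℝ≥0∞) :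
    eLpNorm (W j φ) p P = ENNReal.ofReal ‖φ‖ * eLpNorm id p (gaussianReal 0 1) := by
  refine eLpNorm_eq_mul_eLpNorm_gaussianReal (hW.gaussian.hasGaussianLaw_eval (j, φ))
    (hW.centred j φ) (norm_nonneg _) ?_ p
  simp only [sq, hW.covariance, if_true, real_inner_self_eq_norm_mul_norm]

lemma IsWhiteNoise.memLp_two (hW : IsWhiteNoise P k d W) (j : Fin d)
    (φ : Lp ℝ 2 (volume : Measure (Euc k))) : MemLp (W j φ) 2 P :=
  (hW.gaussian.hasGaussianLaw_eval (j, φ)).memLp_two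

lemma IsWhiteNoise.integral_sub_sq (hW : IsWhiteNoise P k d W) (j : Fin d)
    (φ ψ : Lp ℝ 2 (volume : Measure (Euc k))) :
    ∫ ω, (W j φ - W j ψ) ω ^ 2 ∂P = ‖φ - ψ‖ ^ 2 := by
  have hint (φ ψ) : Integrable (fun ω => W j φ ω * W j ψ ω) P :=
    (hW.memLp_two j φ).integrable_mul (hW.memLp_two j ψ)
  have hexpand (ω : Ω) : (W j φ - W j ψ) ω ^ 2 =
      (W j φ ω * W j φ ω - 2 * (W j φ ω * W j ψ ω)) + W j ψ ω * W j ψ ω := by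
    rw [Pi.sub_apply]
    ring
  have hint₂ : Integrable (fun ω => W j φ ω * W j φ ω - 2 * (W j φ ω * W j ψ ω)) P :=
    (hint φ φ).sub ((hint φ ψ).const_mul 2)
  rw [integral_congr_ae (.of_forall hexpand), integral_add hint₂ (hint ψ ψ),
    integral_sub (hint φ φ) ((hint φ ψ).const_mul 2), integral_const_mul]
  simp only [hW.covariance, if_true]
  rw [norm_sub_sq_real, real_inner_self_eq_norm_sq, real_inner_self_eq_norm_sq]

lemma IsWhiteNoise.eLpNorm_sub (hW : IsWhiteNoise P k d W) (j : Fin d)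
    (φ ψ : Lp ℝ 2 (volume : Measure (Euc k))) (p : ℝ≥0∞) :
    eLpNorm (W j φ - W j ψ) p P =
      ENNReal.ofReal ‖φ - ψ‖ * eLpNorm id p (gaussianReal 0 1) := by
  have := hW.gaussian.isProbabilityMeasure
  refine eLpNorm_eq_mul_eLpNorm_gaussianReal
    (hW.gaussian.hasGaussianLaw_sub (s := (j, φ)) (t := (j, ψ))) ?_ (norm_nonneg _)
    (hW.integral_sub_sq j φ ψ) p
  simp only [Pi.sub_apply]
  rw [integral_sub ((hW.memLp_two j φ).integrable one_le_two)
    ((hW.memLp_two j ψ).integrable one_le_two), hW.centred, hW.centred, sub_zero]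

omit [MeasurableSpace Ω] in
lemma wienerIntegral_eq_of_memLp (W : Lp ℝ 2 (volume : Measure (Euc k)) → Ω → ℝ)
    (hD : MeasurableSet D) (hh : MemLp h 2 (volume.restrict D)) :
    wienerIntegral W D h = W (((memLp_indicator_iff_restrict hD).2 hh).toLp _) :=
  dif_pos _

lemma IsWhiteNoise.aestronglyMeasurable_wienerIntegral (hW : IsWhiteNoise P k d W) (j : Fin d)
    (hD : MeasurableSet D) (hh : MemLp h 2 (volume.restrict D)) :
    AEStronglyMeasurable (wienerIntegral (W j) D h) P := by
  rw [wienerIntegral_eq_of_memLp _ hD hh]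
  exact (hW.memLp_two j _).aestronglyMeasurable

lemma IsWhiteNoise.eLpNorm_wienerIntegral (hW : IsWhiteNoise P k d W) (j : Fin d)
    (hD : MeasurableSet D) (hh : MemLp h 2 (volume.restrict D)) (p : ℝ≥0∞) :
    eLpNorm (wienerIntegral (W j) D h) p P =
      eLpNorm h 2 (volume.restrict D) * eLpNorm id p (gaussianReal 0 1) := by
  rw [wienerIntegral_eq_of_memLp _ hD hh, hW.eLpNorm_apply, Lp.norm_toLp,
    eLpNorm_indicator_eq_eLpNorm_restrict hD, ENNReal.ofReal_toReal hh.eLpNorm_ne_top]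

lemma IsWhiteNoise.eLpNorm_wienerIntegral_sub (hW : IsWhiteNoise P k d W) (j : Fin d)
    (hD : MeasurableSet D) (hh₁ : MemLp h₁ 2 (volume.restrict D))
    (hh₂ : MemLp h₂ 2 (volume.restrict D)) (p : ℝ≥0∞) :
    eLpNorm (wienerIntegral (W j) D h₁ - wienerIntegral (W j) D h₂) p P =
      eLpNorm (h₁ - h₂) 2 (volume.restrict D) * eLpNorm id p (gaussianReal 0 1) := by
  rw [wienerIntegral_eq_of_memLp _ hD hh₁, wienerIntegral_eq_of_memLp _ hD hh₂, hW.eLpNorm_sub,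
    ← MemLp.toLp_sub, Lp.norm_toLp, ← indicator_sub', eLpNorm_indicator_eq_eLpNorm_restrict hD,
    ENNReal.ofReal_toReal (hh₁.sub hh₂).eLpNorm_ne_top]

end WhiteNoise

lemma eLpNorm_sum_smul_const_le {ι E : Type*} [Fintype ι] [NormedAddCommGroup E]
    [NormedSpace ℝ E] {w : ι → Ω → ℝ} (hw : ∀ j, AEStronglyMeasurable (w j) P) (e : ι → E)
    {p : ℝ≥0∞} (hp : 1 ≤ p) :
    eLpNorm (fun ω => ∑ j, w j ω • e j) p P ≤ ∑ j, ‖e j‖ₑ * eLpNorm (w j) p P := by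
  have hsum : (fun ω => ∑ j, w j ω • e j) = ∑ j, fun ω => w j ω • e j := by
    ext1 ω
    rw [Finset.sum_apply]
  rw [hsum]
  refine (eLpNorm_sum_le (fun j _ => (hw j).smul_const (e j)) hp).trans
    (Finset.sum_le_sum fun j _ => ?_)
  refine eLpNorm_le_mul_eLpNorm_of_ae_le_mul'' p (hw j) (.of_forall fun ω => ?_)
  rw [enorm_smul, mul_comm]

/-- The stochastic convolution `(∑ⱼ σᵢⱼ ∫_D G(x, y) Wʲ(dy))ᵢ`, the random source term of the mild
formulation. -/
def noise (D : Set (Euc k)) (G : Euc k → Euc k → ℝ) (σ : Matrix (Fin d) (Fin d) ℝ)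
    (W : Fin d → Lp ℝ 2 (volume : Measure (Euc k)) → Ω → ℝ) (x : Euc k) (ω : Ω) : Euc d :=
  WithLp.toLp 2 fun i => ∑ j, σ i j * wienerIntegral (W j) D (G x) ω

/-- The ratio by which the `Lᵖ(P)` norm of a stochastic convolution against `σ` exceeds the `L²`
norm of the kernel: the sum of the norms of the columns of `σ` times the `Lᵖ` norm of a standard
Gaussian variable. -/
def noiseConst (σ : Matrix (Fin d) (Fin d) ℝ) (p : ℝ≥0∞) : ℝ≥0∞ :=
  (∑ j, ‖(WithLp.toLp 2 (σ.col j) : Euc d)‖ₑ) * eLpNorm id p (gaussianReal 0 1)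

lemma noiseConst_ne_top (σ : Matrix (Fin d) (Fin d) ℝ) {p : ℝ≥0∞} (hp : p ≠ ∞) :
    noiseConst σ p ≠ ∞ := by
  lift p to ℝ≥0 using hp
  exact ENNReal.mul_ne_top (ENNReal.sum_ne_top.2 fun j _ => enorm_ne_top)
    (memLp_id_gaussianReal p).eLpNorm_ne_top

section StochasticConvolution

variable {D : Set (Euc k)} {G : Euc k → Euc k → ℝ} (σ : Matrix (Fin d) (Fin d) ℝ)
  {W : Fin d → Lp ℝ 2 (volume : Measure (Euc k)) → Ω → ℝ} {x x₁ x₂ : Euc k} {p : ℝ≥0∞}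

omit [MeasurableSpace Ω] in
lemma noise_eq_sum (x : Euc k) : noise D G σ W x =
    fun ω => ∑ j, wienerIntegral (W j) D (G x) ω • (WithLp.toLp 2 (σ.col j) : Euc d) := by
  ext ω i
  simp [noise, mul_comm]

lemma aestronglyMeasurable_noise (hW : IsWhiteNoise P k d W) (hD : MeasurableSet D)
    (hx : MemLp (G x) 2 (volume.restrict D)) : AEStronglyMeasurable (noise D G σ W x) P := by
  rw [noise_eq_sum]
  exact Finset.aestronglyMeasurable_fun_sum _ fun j _ =>
    (hW.aestronglyMeasurable_wienerIntegral j hD hx).smul_const _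

lemma eLpNorm_noise_le (hW : IsWhiteNoise P k d W) (hD : MeasurableSet D)
    (hx : MemLp (G x) 2 (volume.restrict D)) (hp : 1 ≤ p) :
    eLpNorm (noise D G σ W x) p P ≤ noiseConst σ p * eLpNorm (G x) 2 (volume.restrict D) := by
  rw [noise_eq_sum]
  refine (eLpNorm_sum_smul_const_le
    (fun j => hW.aestronglyMeasurable_wienerIntegral j hD hx) _ hp).trans_eq ?_
  simp only [hW.eLpNorm_wienerIntegral _ hD hx, ← Finset.sum_mul, noiseConst]
  ring

lemma eLpNorm_noise_sub_le (hW : IsWhiteNoise P k d W) (hD : MeasurableSet D)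
    (hx₁ : MemLp (G x₁) 2 (volume.restrict D)) (hx₂ : MemLp (G x₂) 2 (volume.restrict D))
    (hp : 1 ≤ p) :
    eLpNorm (noise D G σ W x₁ - noise D G σ W x₂) p P ≤
      noiseConst σ p * eLpNorm (G x₁ - G x₂) 2 (volume.restrict D) := by
  have hsub : noise D G σ W x₁ - noise D G σ W x₂ = fun ω =>
      ∑ j, (wienerIntegral (W j) D (G x₁) - wienerIntegral (W j) D (G x₂)) ω •
        (WithLp.toLp 2 (σ.col j) : Euc d) := by
    simp only [noise_eq_sum, Pi.sub_def, sub_smul, Finset.sum_sub_distrib]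
  rw [hsub]
  refine (eLpNorm_sum_smul_const_le (fun j =>
    (hW.aestronglyMeasurable_wienerIntegral j hD hx₁).sub
      (hW.aestronglyMeasurable_wienerIntegral j hD hx₂)) _ hp).trans_eq ?_
  simp only [hW.eLpNorm_wienerIntegral_sub _ hD hx₁ hx₂, ← Finset.sum_mul, noiseConst]
  ring

end StochasticConvolution

end Noise

/-! ### Moments of the increments of the solution -/

section Fields

variable {X Ω E : Type*} [MeasurableSpace X] [MeasurableSpace Ω] {μ : Measure X} {P : Measure Ω}

lemma integrable_smul_of_memLp_two [NormedAddCommGroup E] [NormedSpace ℝ E] {h : X → ℝ} {φ : X → E}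
    (hh : MemLp h 2 μ) (hφ : MemLp φ 2 μ) : Integrable (fun y => h y • φ y) μ :=
  memLp_one_iff_integrable.1 (hφ.smul (r := 1) hh)

lemma enorm_integral_smul_le [NormedAddCommGroup E] [NormedSpace ℝ E] {h : X → ℝ} {φ : X → E}
    (hh : AEStronglyMeasurable h μ) (hφ : AEStronglyMeasurable φ μ) :
    ‖∫ y, h y • φ y ∂μ‖ₑ ≤ eLpNorm h 2 μ * eLpNorm φ 2 μ := by
  refine (enorm_integral_le_lintegral_enorm _).trans ?_
  rw [← eLpNorm_one_eq_lintegral_enorm]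
  exact eLpNorm_smul_le_mul_eLpNorm (p := 2) (q := 2) (r := 1) hφ hh

lemma enorm_integral_smul_sub_le [NormedAddCommGroup E] [NormedSpace ℝ E] {h₁ h₂ : X → ℝ}
    {φ : X → E} (hh₁ : MemLp h₁ 2 μ) (hh₂ : MemLp h₂ 2 μ) (hφ : MemLp φ 2 μ) :
    ‖(∫ y, h₁ y • φ y ∂μ) - ∫ y, h₂ y • φ y ∂μ‖ₑ ≤ eLpNorm (h₁ - h₂) 2 μ * eLpNorm φ 2 μ := by
  rw [← integral_sub (integrable_smul_of_memLp_two hh₁ hφ) (integrable_smul_of_memLp_two hh₂ hφ)]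
  simp_rw [← sub_smul]
  exact enorm_integral_smul_le (hh₁.sub hh₂).aestronglyMeasurable hφ.aestronglyMeasurable

lemma integral_smul_apply {d : ℕ} {h : X → ℝ} {φ : X → Euc d} (hh : MemLp h 2 μ)
    (hφ : MemLp φ 2 μ) (i : Fin d) : (∫ y, h y • φ y ∂μ) i = ∫ y, h y * φ y i ∂μ :=
  ((EuclideanSpace.proj (𝕜 := ℝ) i : Euc d →L[ℝ] ℝ).integral_comp_comm
    (integrable_smul_of_memLp_two hh hφ)).symm

lemma measurable_indicator_of_continuousOn_of_measurable [TopologicalSpace X]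
    [TopologicalSpace.MetrizableSpace X] [SecondCountableTopology X] [OpensMeasurableSpace X]
    [TopologicalSpace E] [TopologicalSpace.PseudoMetrizableSpace E] [MeasurableSpace E]
    [BorelSpace E] [Zero E] {D : Set X} (hD : MeasurableSet D) {v : X → Ω → E}
    (hm : ∀ x ∈ D, Measurable (v x)) (hc : ∀ ω, ContinuousOn (fun x => v x ω) D) :
    Measurable fun q : X × Ω => D.indicator (fun x => v x q.2) q.1 := by
  have hrestrict : Measurable (Function.uncurry fun (x : D) (ω : Ω) => v x ω) :=
    measurable_uncurry_of_continuous_of_measurable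
      (fun ω => continuousOn_iff_continuous_domRestrict.1 (hc ω)) fun x => hm x x.2
  refine measurable_of_restrict_of_restrict_compl (measurable_fst hD) ?_ ?_
  · have hpair : Measurable fun q : Prod.fst ⁻¹' D => ((⟨q.1.1, q.2⟩ : D), (q.1.2 : Ω)) :=
      (measurable_fst.comp measurable_subtype_coe).subtype_mk.prodMk
        (measurable_snd.comp measurable_subtype_coe)
    convert hrestrict.comp hpair using 1
    ext1 q
    exact indicator_of_mem (s := D) q.2 fun x => v x q.1.2
  · convert measurable_const (a := (0 : E)) using 1
    ext1 q
    exact indicator_of_notMem (s := D) q.2 fun x => v x q.1.2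

variable {p : ℝ≥0}

lemma measurable_eLpNorm_of_measurable_uncurry [TopologicalSpace E] [ContinuousENorm E]
    [MeasurableSpace E] [OpensMeasurableSpace E] {z : X → Ω → E} [SFinite μ] (hp : p ≠ 0)
    (hz : Measurable (Function.uncurry z)) :
    Measurable fun ω => eLpNorm (fun x => z x ω) p μ := by
  simp_rw [eLpNorm_nnreal_eq_lintegral hp]
  exact (hz.enorm.pow_const (p : ℝ)).lintegral_prod_left'.pow_const _

lemma eLpNorm_eLpNorm_swap [TopologicalSpace E] [ContinuousENorm E] [MeasurableSpace E]
    [OpensMeasurableSpace E] {z : X → Ω → E} [SFinite μ] [SFinite P] (hp : p ≠ 0)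
    (hz : Measurable (Function.uncurry z)) :
    eLpNorm (fun ω => eLpNorm (fun x => z x ω) p μ) p P =
      eLpNorm (fun x => eLpNorm (z x) p P) p μ := by
  have hpow : Measurable fun q : X × Ω => ‖z q.1 q.2‖ₑ ^ (p : ℝ) := hz.enorm.pow_const _
  refine (ENNReal.rpow_left_injective (NNReal.coe_ne_zero.2 hp)) ?_
  simp only [eLpNorm_nnreal_pow_eq_lintegral hp, enorm_eq_self]
  exact lintegral_lintegral_swap (hpow.comp measurable_swap).aemeasurable

section ContinuousField

variable [TopologicalSpace X] [TopologicalSpace.MetrizableSpace X] [SecondCountableTopology X]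
  [OpensMeasurableSpace X] [NormedAddCommGroup E] [MeasurableSpace E] [BorelSpace E] {D : Set X}
  {z : X → Ω → E} [SFinite μ]

lemma measurable_eLpNorm_of_continuousOn (hD : MeasurableSet D) (hm : ∀ x ∈ D, Measurable (z x))
    (hc : ∀ ω, ContinuousOn (fun x => z x ω) D) (hp : p ≠ 0) :
    Measurable fun ω => eLpNorm (fun x => z x ω) p (μ.restrict D) := by
  have hindicator (ω : Ω) := eLpNorm_congr_ae (p := p)
    (indicator_ae_eq_restrict (μ := μ) (f := fun x => z x ω) hD)
  simp_rw [← hindicator]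
  exact measurable_eLpNorm_of_measurable_uncurry hp
    (measurable_indicator_of_continuousOn_of_measurable hD hm hc)

lemma eLpNorm_eLpNorm_le_of_continuousOn [SFinite P] (hD : MeasurableSet D)
    (hm : ∀ x ∈ D, Measurable (z x)) (hc : ∀ ω, ContinuousOn (fun x => z x ω) D) (hp : p ≠ 0)
    {Q : ℝ≥0∞} (hQ : ∀ x ∈ D, eLpNorm (z x) p P ≤ Q) :
    eLpNorm (fun ω => eLpNorm (fun x => z x ω) p (μ.restrict D)) p P ≤
      Q * μ D ^ (p : ℝ)⁻¹ := by
  have hindicator (ω : Ω) := eLpNorm_congr_ae (p := p)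
    (indicator_ae_eq_restrict (μ := μ) (f := fun x => z x ω) hD)
  simp_rw [← hindicator]
  rw [eLpNorm_eLpNorm_swap (z := fun x ω => D.indicator (fun x => z x ω) x) hp
    (measurable_indicator_of_continuousOn_of_measurable hD hm hc), ← Measure.restrict_apply_univ D]
  refine eLpNorm_le_of_ae_enorm_bound ?_
  filter_upwards [ae_restrict_mem hD] with x hx
  simpa only [indicator_of_mem hx, enorm_eq_self] using hQ x hx

end ContinuousField

end Fields

lemma momentExponent_pos (k : ℕ) {γ : ℝ} (hγ : γ < 1) : 0 < momentExponent k γ := by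
  unfold momentExponent
  split_ifs
  · exact one_pos
  · linarith
  · exact one_half_pos

section Kernel

variable {k d : ℕ} {D : Set (Euc k)} {G : Euc k → Euc k → ℝ}

lemma eLpNorm_le_greenSup {x : Euc k} (hx : x ∈ D) :
    eLpNorm (G x) 2 (volume.restrict D) ≤ greenSup D G :=
  le_iSup₂ (f := fun x _ => eLpNorm (G x) 2 (volume.restrict D)) x hx

lemma IsHolderKernel.tendsto_eLpNorm_sub (hG : IsHolderKernel D G) {x : Euc k} (hx : x ∈ D) :
    Filter.Tendsto (fun z => eLpNorm (G z - G x) 2 (volume.restrict D)) (nhds x) (nhds 0) := by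
  obtain ⟨r, hr, hball⟩ := nhds_basis_closedBall.mem_iff.1 (hG.isOpen.mem_nhds hx)
  obtain ⟨C, -, hC⟩ := hG.holder (ball x r) (.inr ⟨x, r, hr, hball, rfl⟩) (1 / 2) one_half_pos
    one_half_lt_one
  have hξ := momentExponent_pos k (one_half_lt_one : (1 / 2 : ℝ) < 1)
  have hbound : ContinuousAt
      (fun z : Euc k => ENNReal.ofReal (C * ‖z - x‖ ^ momentExponent k (1 / 2))) x := by
    refine ENNReal.continuous_ofReal.continuousAt.comp (continuousAt_const.mul ?_)
    exact (by fun_prop : ContinuousAt (fun z : Euc k => ‖z - x‖) x).rpow_const (.inr hξ.le)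
  rw [ContinuousAt, sub_self, norm_zero, Real.zero_rpow hξ.ne', mul_zero,
    ENNReal.ofReal_zero] at hbound
  refine tendsto_of_tendsto_of_tendsto_of_le_of_le' tendsto_const_nhds hbound
    (.of_forall fun _ => zero_le) ?_
  filter_upwards [ball_mem_nhds x hr] with z hz using hC z hz x (mem_ball_self hr)

lemma IsHolderKernel.continuousOn_integral (hG : IsHolderKernel D G) {φ : Euc k → Euc d}
    (hφ : MemLp φ 2 (volume.restrict D)) : ContinuousOn (fun x => ∫ y in D, G x y • φ y) D := by
  intro x hx
  refine ContinuousAt.continuousWithinAt (tendsto_iff_edist_tendsto_0.2 ?_)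
  have hlim := ENNReal.Tendsto.mul_const (hG.tendsto_eLpNorm_sub hx) (.inr hφ.eLpNorm_ne_top)
  rw [zero_mul] at hlim
  refine tendsto_of_tendsto_of_tendsto_of_le_of_le' tendsto_const_nhds hlim
    (.of_forall fun _ => zero_le) ?_
  filter_upwards [hG.isOpen.mem_nhds hx] with z hz
  rw [edist_eq_enorm_sub]
  exact enorm_integral_smul_sub_le (hG.memLp z hz) (hG.memLp x hx) hφ

lemma memLp_of_continuousOn_closure {E : Type*} [NormedAddCommGroup E] (hD : IsOpen D)
    (hb : Bornology.IsBounded D) {φ : Euc k → E} (hφ : ContinuousOn φ (closure D)) (p : ℝ≥0∞) :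
    MemLp φ p (volume.restrict D) := by
  have := isFiniteMeasure_restrict_of_isBounded hb
  obtain ⟨C, hC⟩ := hb.isCompact_closure.exists_bound_of_continuousOn hφ
  refine .of_bound ((hφ.mono subset_closure).aestronglyMeasurable hD.measurableSet) C ?_
  filter_upwards [ae_restrict_mem hD.measurableSet] with x hx using hC x (subset_closure hx)

end Kernel

section Moments

variable {Ω : Type*} [MeasurableSpace Ω] {P : Measure Ω} {k d : ℕ} {D : Set (Euc k)}
  {G : Euc k → Euc k → ℝ} {f : Euc d → Euc d} {g : Euc k → Euc d}
  {σ : Matrix (Fin d) (Fin d) ℝ} {W : Fin d → Lp ℝ 2 (volume : Measure (Euc k)) → Ω → ℝ}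
  {u v : Euc k → Ω → Euc d}

/-- A mild solution whose paths are all, and not only almost all, continuous on `closure D`; the
equation is in vector form. Every mild solution has such a version, to which Fubini's theorem
applies pathwise. -/
structure IsContinuousMildSolution (P : Measure Ω) (D : Set (Euc k)) (G : Euc k → Euc k → ℝ)
    (f : Euc d → Euc d) (g : Euc k → Euc d) (σ : Matrix (Fin d) (Fin d) ℝ)
    (W : Fin d → Lp ℝ 2 (volume : Measure (Euc k)) → Ω → ℝ) (v : Euc k → Ω → Euc d) : Prop where
  measurable : ∀ x ∈ D, Measurable (v x)
  continuousOn : ∀ ω, ContinuousOn (fun x => v x ω) (closure D)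
  equation : ∀ x ∈ D, ∀ᵐ ω ∂P, v x ω + ∫ y in D, G x y • f (v y ω) =
    (∫ y in D, G x y • g y) + noise D G σ W x ω

lemma IsMildSolution.exists_measurable_continuousOn (hu : IsMildSolution P D G f g σ W u) :
    ∃ v : Euc k → Ω → Euc d, (∀ x ∈ D, Measurable (v x)) ∧
      (∀ ω, ContinuousOn (fun x => v x ω) (closure D)) ∧ ∀ᵐ ω ∂P, ∀ x, v x ω = u x ω := by
  obtain ⟨N, hN, hNmeas, hN₀⟩ := exists_measurable_superset_of_null (ae_iff.1 hu.paths)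
  refine ⟨fun x => Nᶜ.indicator (u x), fun x hx => (hu.measurable x hx).indicator hNmeas.compl,
    fun ω => ?_, ?_⟩
  · by_cases hω : ω ∈ N
    · simp only [indicator_of_notMem (notMem_compl_iff.2 hω), continuousOn_const]
    · simp only [indicator_of_mem (mem_compl hω)]
      exact (not_not.1 fun h => hω (hN h)).1
  · filter_upwards [measure_eq_zero_iff_ae_notMem.1 hN₀] with ω hω x
    exact indicator_of_mem (mem_compl hω) _

lemma IsMildSolution.exists_isContinuousMildSolution (hu : IsMildSolution P D G f g σ W u)
    (hG : IsHolderKernel D G) (hf : Continuous f) (hg : MemLp g 2 (volume.restrict D)) :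
    ∃ v, IsContinuousMildSolution P D G f g σ W v ∧ ∀ᵐ ω ∂P, ∀ x, v x ω = u x ω := by
  obtain ⟨v, hmeas, hcont, hvu⟩ := hu.exists_measurable_continuousOn
  refine ⟨v, ⟨hmeas, hcont, fun x hx => ?_⟩, hvu⟩
  filter_upwards [hu.equation x hx, hvu] with ω heq hω
  have hfv : MemLp (fun y => f (v y ω)) 2 (volume.restrict D) :=
    memLp_of_continuousOn_closure hG.isOpen hG.isBounded (hf.comp_continuousOn (hcont ω)) 2
  simp only [← hω] at heq
  ext i
  rw [PiLp.add_apply, PiLp.add_apply, integral_smul_apply (hG.memLp x hx) hfv,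
    integral_smul_apply (hG.memLp x hx) hg, heq i]
  rfl

/-- The linear part `u + ∫_D G(·, y) f(u(y)) dy` of the mild equation. -/
def linearPart (D : Set (Euc k)) (G : Euc k → Euc k → ℝ) (f : Euc d → Euc d)
    (v : Euc k → Ω → Euc d) (x : Euc k) (ω : Ω) : Euc d :=
  v x ω + ∫ y in D, G x y • f (v y ω)

namespace IsContinuousMildSolution

lemma memLp_comp (hv : IsContinuousMildSolution P D G f g σ W v) (hG : IsHolderKernel D G)
    (hf : Continuous f) (ω : Ω) : MemLp (fun y => f (v y ω)) 2 (volume.restrict D) :=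
  memLp_of_continuousOn_closure hG.isOpen hG.isBounded (hf.comp_continuousOn (hv.continuousOn ω)) 2

lemma measurable_indicator_comp (hv : IsContinuousMildSolution P D G f g σ W v)
    (hG : IsHolderKernel D G) (hf : Continuous f) :
    Measurable fun q : Euc k × Ω => D.indicator (fun y => f (v y q.2)) q.1 :=
  measurable_indicator_of_continuousOn_of_measurable hG.isOpen.measurableSet
    (fun x hx => hf.measurable.comp (hv.measurable x hx))
    fun ω => hf.comp_continuousOn ((hv.continuousOn ω).mono subset_closure)

lemma measurable_eLpNorm_comp (hv : IsContinuousMildSolution P D G f g σ W v)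
    (hG : IsHolderKernel D G) (hf : Continuous f) :
    Measurable fun ω => eLpNorm (fun y => f (v y ω)) 2 (volume.restrict D) :=
  measurable_eLpNorm_of_continuousOn (p := 2) hG.isOpen.measurableSet
    (fun x hx => hf.measurable.comp (hv.measurable x hx))
    (fun ω => hf.comp_continuousOn ((hv.continuousOn ω).mono subset_closure)) two_ne_zero

lemma measurable_integral (hv : IsContinuousMildSolution P D G f g σ W v)
    (hG : IsHolderKernel D G) (hf : Continuous f) {x : Euc k} (hx : x ∈ D) :
    Measurable fun ω => ∫ y in D, G x y • f (v y ω) := by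
  have hGx := (hG.memLp x hx).aestronglyMeasurable
  have hjoint : Measurable fun q : Ω × Euc k =>
      hGx.mk (G x) q.2 • D.indicator (fun y => f (v y q.1)) q.2 :=
    (hGx.stronglyMeasurable_mk.measurable.comp measurable_snd).smul
      ((hv.measurable_indicator_comp hG hf).comp measurable_swap)
  convert (hjoint.stronglyMeasurable.integral_prod_right' (ν := volume.restrict D)).measurable
    using 2 with ω
  refine integral_congr_ae ?_
  filter_upwards [hGx.ae_eq_mk, ae_restrict_mem hG.isOpen.measurableSet] with y hy hyD
  rw [indicator_of_mem hyD, hy]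

lemma measurable_linearPart (hv : IsContinuousMildSolution P D G f g σ W v)
    (hG : IsHolderKernel D G) (hf : Continuous f) {x : Euc k} (hx : x ∈ D) :
    Measurable (linearPart D G f v x) :=
  (hv.measurable x hx).add (hv.measurable_integral hG hf hx)

lemma continuousOn_linearPart (hv : IsContinuousMildSolution P D G f g σ W v)
    (hG : IsHolderKernel D G) (hf : Continuous f) (ω : Ω) :
    ContinuousOn (fun x => linearPart D G f v x ω) D :=
  ((hv.continuousOn ω).mono subset_closure).add (hG.continuousOn_integral (hv.memLp_comp hG hf ω))

lemma memLp_linearPart (hv : IsContinuousMildSolution P D G f g σ W v) (hG : IsHolderKernel D G)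
    (hK : greenSup D G ≠ ∞) (hf : Continuous f) (ω : Ω) (p : ℝ≥0∞) :
    MemLp (fun x => linearPart D G f v x ω) p (volume.restrict D) := by
  have := isFiniteMeasure_restrict_of_isBounded hG.isBounded
  have hDm := hG.isOpen.measurableSet
  have hfv := hv.memLp_comp hG hf ω
  refine (memLp_of_continuousOn_closure hG.isOpen hG.isBounded (hv.continuousOn ω) p).add ?_
  refine .of_enorm_bound ((hG.continuousOn_integral hfv).aestronglyMeasurable hDm)
    (ENNReal.mul_ne_top hK hfv.eLpNorm_ne_top) ?_
  filter_upwards [ae_restrict_mem hDm] with x hx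
  exact (enorm_integral_smul_le (hG.memLp x hx).1 hfv.1).trans
    (mul_le_mul_left (eLpNorm_le_greenSup hx) _)

lemma eLpNorm_linearPart_le (hv : IsContinuousMildSolution P D G f g σ W v)
    (hG : IsHolderKernel D G) (hg : AEStronglyMeasurable g (volume.restrict D))
    (hW : IsWhiteNoise P k d W) {p : ℝ≥0∞} (hp : 1 ≤ p) {x : Euc k} (hx : x ∈ D) :
    eLpNorm (linearPart D G f v x) p P ≤
      greenSup D G * eLpNorm g 2 (volume.restrict D) + noiseConst σ p * greenSup D G := by
  have := hW.gaussian.isProbabilityMeasure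
  have hDm := hG.isOpen.measurableSet
  calc eLpNorm (linearPart D G f v x) p P
      = eLpNorm ((fun _ => ∫ y in D, G x y • g y) + noise D G σ W x) p P :=
        eLpNorm_congr_ae (by filter_upwards [hv.equation x hx] with ω hω using hω)
    _ ≤ eLpNorm (fun _ : Ω => ∫ y in D, G x y • g y) p P + eLpNorm (noise D G σ W x) p P :=
        eLpNorm_add_le aestronglyMeasurable_const
          (aestronglyMeasurable_noise σ hW hDm (hG.memLp x hx)) hp
    _ ≤ _ := ?_
  rw [eLpNorm_const _ (one_pos.trans_le hp).ne' (NeZero.ne P), measure_univ, ENNReal.one_rpow,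
    mul_one]
  gcongr
  · exact (enorm_integral_smul_le (hG.memLp x hx).1 hg).trans
      (mul_le_mul_left (eLpNorm_le_greenSup hx) _)
  · exact (eLpNorm_noise_le σ hW hDm (hG.memLp x hx) hp).trans
      (mul_le_mul_right (eLpNorm_le_greenSup hx) _)

lemma eLpNorm_eLpNorm_linearPart_ne_top (hv : IsContinuousMildSolution P D G f g σ W v)
    (hG : IsHolderKernel D G) (hK : greenSup D G ≠ ∞) (hf : Continuous f)
    (hg : MemLp g 2 (volume.restrict D)) (hW : IsWhiteNoise P k d W) {p : ℝ≥0} (hp : 1 ≤ p) :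
    eLpNorm (fun ω => eLpNorm (fun x => linearPart D G f v x ω) p (volume.restrict D)) p P
      ≠ ∞ := by
  have := hW.gaussian.isProbabilityMeasure
  have hbound := eLpNorm_eLpNorm_le_of_continuousOn (μ := volume) (P := P)
    hG.isOpen.measurableSet (fun x hx => hv.measurable_linearPart hG hf hx)
    (hv.continuousOn_linearPart hG hf) (one_pos.trans_le hp).ne'
    fun x hx => hv.eLpNorm_linearPart_le hG hg.1 hW (by exact_mod_cast hp) hx
  refine ne_top_of_le_ne_top ?_ hbound
  exact ENNReal.mul_ne_top (ENNReal.add_ne_top.2 ⟨ENNReal.mul_ne_top hK hg.eLpNorm_ne_top,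
    ENNReal.mul_ne_top (noiseConst_ne_top σ ENNReal.coe_ne_top) hK⟩)
    (ENNReal.rpow_ne_top_of_nonneg (by positivity) hG.isBounded.measure_lt_top.ne)

lemma eLpNorm_comp_le (hv : IsContinuousMildSolution P D G f g σ W v) (hG : IsHolderKernel D G)
    (hK : greenSup D G ≠ ∞) (hf : Continuous f) {F : L2 D d → L2 D d} (hF : IsNemytskii D f F)
    {B : ℝ} (hB : ∀ u z : L2 D d,
      (∀ᵐ x ∂volume.restrict D, u x + ∫ y in D, G x y • F u y = z x) → ‖F u‖ ≤ B * (1 + ‖z‖))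
    (ω : Ω) :
    eLpNorm (fun y => f (v y ω)) 2 (volume.restrict D) ≤ ENNReal.ofReal B *
      (1 + eLpNorm (fun x => linearPart D G f v x ω) 2 (volume.restrict D)) := by
  have hvω : MemLp (fun x => v x ω) 2 (volume.restrict D) :=
    memLp_of_continuousOn_closure hG.isOpen hG.isBounded (hv.continuousOn ω) 2
  have hz := hv.memLp_linearPart hG hK hf ω 2
  have hFv : F (hvω.toLp _) =ᵐ[volume.restrict D] fun y => f (v y ω) := by
    filter_upwards [hF (hvω.toLp _), hvω.coeFn_toLp] with y hFy hy
    rw [hFy, hy]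
  have hint (x : Euc k) : ∫ y in D, G x y • F (hvω.toLp _) y = ∫ y in D, G x y • f (v y ω) := by
    refine integral_congr_ae ?_
    filter_upwards [hFv] with y hy
    rw [hy]
  have hnorm : ‖F (hvω.toLp _)‖ ≤ B * (1 + ‖hz.toLp _‖) := by
    refine hB (hvω.toLp _) (hz.toLp _) ?_
    filter_upwards [hvω.coeFn_toLp, hz.coeFn_toLp] with x hvx hzx
    rw [hvx, hzx, hint, linearPart]
  calc eLpNorm (fun y => f (v y ω)) 2 (volume.restrict D) = ‖F (hvω.toLp _)‖ₑ := by
        rw [Lp.enorm_def, eLpNorm_congr_ae hFv]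
    _ ≤ ENNReal.ofReal (B * (1 + ‖hz.toLp _‖)) := by
        rw [← ofReal_norm]
        exact ENNReal.ofReal_le_ofReal hnorm
    _ = _ := by
        rw [ENNReal.ofReal_mul' (by positivity), ENNReal.ofReal_add zero_le_one (norm_nonneg _),
          ENNReal.ofReal_one, ofReal_norm, Lp.enorm_toLp]

lemma eLpNorm_eLpNorm_comp_ne_top (hv : IsContinuousMildSolution P D G f g σ W v)
    (hG : IsHolderKernel D G) (hK : greenSup D G ≠ ∞) (hf : Continuous f)
    {F : L2 D d → L2 D d} (hF : IsNemytskii D f F) (hg : MemLp g 2 (volume.restrict D)) {B : ℝ}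
    (hB : ∀ u z : L2 D d,
      (∀ᵐ x ∂volume.restrict D, u x + ∫ y in D, G x y • F u y = z x) → ‖F u‖ ≤ B * (1 + ‖z‖))
    (hW : IsWhiteNoise P k d W) {p : ℝ≥0} (hp : 2 ≤ p) :
    eLpNorm (fun ω => eLpNorm (fun y => f (v y ω)) 2 (volume.restrict D)) p P ≠ ∞ := by
  have := hW.gaussian.isProbabilityMeasure
  have := isFiniteMeasure_restrict_of_isBounded hG.isBounded
  have hp₁ : 1 ≤ p := one_le_two.trans hp
  set m := volume.restrict D univ ^ (1 / (2 : ℝ≥0∞).toReal - 1 / (p : ℝ≥0∞).toReal)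
  have hm : m ≠ ∞ := by
    refine ENNReal.rpow_ne_top_of_nonneg ?_ (measure_ne_top _ _)
    rw [ENNReal.toReal_ofNat, ENNReal.coe_toReal, sub_nonneg]
    exact one_div_le_one_div_of_le two_pos (by exact_mod_cast hp)
  set Z := fun ω => eLpNorm (fun x => linearPart D G f v x ω) p (volume.restrict D)
  have hZ : AEStronglyMeasurable Z P :=
    (measurable_eLpNorm_of_continuousOn hG.isOpen.measurableSet
      (fun x hx => hv.measurable_linearPart hG hf hx) (hv.continuousOn_linearPart hG hf)
      (one_pos.trans_le hp₁).ne').aestronglyMeasurable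
  have hbound (ω : Ω) : eLpNorm (fun y => f (v y ω)) 2 (volume.restrict D) ≤
      ENNReal.ofReal B * (1 + Z ω * m) := by
    refine (hv.eLpNorm_comp_le hG hK hf hF hB ω).trans ?_
    gcongr
    exact eLpNorm_le_eLpNorm_mul_rpow_measure_univ (by exact_mod_cast hp)
      (hv.memLp_linearPart hG hK hf ω p).aestronglyMeasurable
  refine ne_top_of_le_ne_top ?_ (calc
    eLpNorm (fun ω => eLpNorm (fun y => f (v y ω)) 2 (volume.restrict D)) p P
        ≤ ENNReal.ofReal B * eLpNorm ((fun _ => 1) + fun ω => Z ω * m) p P :=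
          eLpNorm_le_mul_eLpNorm_of_ae_le_mul'' _ (by fun_prop) (.of_forall hbound)
    _ ≤ ENNReal.ofReal B * (1 + m * eLpNorm Z p P) := by
        gcongr
        refine (eLpNorm_add_le (by fun_prop) (by fun_prop) (by exact_mod_cast hp₁)).trans ?_
        gcongr
        · simp [eLpNorm_const _ _ (NeZero.ne P), (one_pos.trans_le hp₁).ne']
        · exact eLpNorm_le_mul_eLpNorm_of_ae_le_mul'' _ hZ (.of_forall fun ω => (mul_comm _ _).le))
  exact ENNReal.mul_ne_top ENNReal.ofReal_ne_top (ENNReal.add_ne_top.2 ⟨ENNReal.one_ne_top,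
    ENNReal.mul_ne_top hm (hv.eLpNorm_eLpNorm_linearPart_ne_top hG hK hf hg hW hp₁)⟩)

lemma ae_enorm_sub_le (hv : IsContinuousMildSolution P D G f g σ W v) (hG : IsHolderKernel D G)
    (hf : Continuous f) (hg : MemLp g 2 (volume.restrict D)) {x₁ x₂ : Euc k} (hx₁ : x₁ ∈ D)
    (hx₂ : x₂ ∈ D) : ∀ᵐ ω ∂P, ‖(v x₁ - v x₂) ω‖ₑ ≤
      eLpNorm (G x₁ - G x₂) 2 (volume.restrict D) *
        (eLpNorm (fun y => f (v y ω)) 2 (volume.restrict D) +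
          eLpNorm g 2 (volume.restrict D)) +
      ‖(noise D G σ W x₁ - noise D G σ W x₂) ω‖ₑ := by
  filter_upwards [hv.equation x₁ hx₁, hv.equation x₂ hx₂] with ω heq₁ heq₂
  have hsplit : v x₁ ω - v x₂ ω =
      -((∫ y in D, G x₁ y • f (v y ω)) - ∫ y in D, G x₂ y • f (v y ω)) +
      ((∫ y in D, G x₁ y • g y) - ∫ y in D, G x₂ y • g y) +
      (noise D G σ W x₁ ω - noise D G σ W x₂ ω) := by
    rw [eq_sub_of_add_eq heq₁, eq_sub_of_add_eq heq₂]
    abel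
  rw [Pi.sub_apply, hsplit, mul_add]
  refine (enorm_add_le _ _).trans (add_le_add_left ((enorm_add_le _ _).trans ?_) _)
  rw [enorm_neg]
  exact add_le_add
    (enorm_integral_smul_sub_le (hG.memLp x₁ hx₁) (hG.memLp x₂ hx₂) (hv.memLp_comp hG hf ω))
    (enorm_integral_smul_sub_le (hG.memLp x₁ hx₁) (hG.memLp x₂ hx₂) hg)

lemma eLpNorm_sub_le (hv : IsContinuousMildSolution P D G f g σ W v) (hG : IsHolderKernel D G)
    (hf : Continuous f) (hg : MemLp g 2 (volume.restrict D)) (hW : IsWhiteNoise P k d W)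
    {p : ℝ≥0∞} (hp : 1 ≤ p) {x₁ x₂ : Euc k} (hx₁ : x₁ ∈ D) (hx₂ : x₂ ∈ D) :
    eLpNorm (v x₁ - v x₂) p P ≤ (eLpNorm (fun ω => eLpNorm (fun y => f (v y ω)) 2
      (volume.restrict D) + eLpNorm g 2 (volume.restrict D)) p P + noiseConst σ p) *
        eLpNorm (G x₁ - G x₂) 2 (volume.restrict D) := by
  have hG₁ := hG.memLp x₁ hx₁
  have hG₂ := hG.memLp x₂ hx₂
  have hDm := hG.isOpen.measurableSet
  set N := fun ω => eLpNorm (fun y => f (v y ω)) 2 (volume.restrict D) +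
    eLpNorm g 2 (volume.restrict D)
  have hN : AEStronglyMeasurable N P :=
    ((hv.measurable_eLpNorm_comp hG hf).add_const _).aestronglyMeasurable
  have hnoise := (aestronglyMeasurable_noise σ hW hDm hG₁).sub
    (aestronglyMeasurable_noise σ hW hDm hG₂)
  set δ := eLpNorm (G x₁ - G x₂) 2 (volume.restrict D)
  calc eLpNorm (v x₁ - v x₂) p P
      ≤ eLpNorm ((fun ω => δ * N ω) +
          fun ω => ‖(noise D G σ W x₁ - noise D G σ W x₂) ω‖ₑ) p P :=
        eLpNorm_mono_enorm_ae (hv.ae_enorm_sub_le hG hf hg hx₁ hx₂)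
    _ ≤ eLpNorm (fun ω => δ * N ω) p P +
          eLpNorm (noise D G σ W x₁ - noise D G σ W x₂) p P := by
        rw [← eLpNorm_enorm (noise D G σ W x₁ - noise D G σ W x₂)]
        exact eLpNorm_add_le (hN.aemeasurable.const_mul δ).aestronglyMeasurable
          hnoise.enorm.aestronglyMeasurable hp
    _ ≤ δ * eLpNorm N p P + noiseConst σ p * δ :=
        add_le_add (eLpNorm_le_mul_eLpNorm_of_ae_le_mul'' _ hN (.of_forall fun _ => le_rfl))
          (eLpNorm_noise_sub_le σ hW hDm hG₁ hG₂ hp)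
    _ = (eLpNorm N p P + noiseConst σ p) * δ := by ring

lemma exists_eLpNorm_sub_le (hv : IsContinuousMildSolution P D G f g σ W v)
    (hG : IsHolderKernel D G) (hf : Continuous f) (hg : MemLp g 2 (volume.restrict D))
    (hW : IsWhiteNoise P k d W) {p : ℝ≥0} (hp : 1 ≤ p)
    (hfv : eLpNorm (fun ω => eLpNorm (fun y => f (v y ω)) 2 (volume.restrict D)) p P ≠ ∞) :
    ∃ C : ℝ≥0, ∀ x₁ ∈ D, ∀ x₂ ∈ D, eLpNorm (v x₁ - v x₂) p P ≤
      C * eLpNorm (G x₁ - G x₂) 2 (volume.restrict D) := by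
  have := hW.gaussian.isProbabilityMeasure
  have hp' : (1 : ℝ≥0∞) ≤ p := by exact_mod_cast hp
  have hsource : eLpNorm (fun ω => eLpNorm (fun y => f (v y ω)) 2 (volume.restrict D) +
      eLpNorm g 2 (volume.restrict D)) p P ≠ ∞ := by
    refine ne_top_of_le_ne_top (ENNReal.add_ne_top.2 ⟨hfv, hg.eLpNorm_ne_top⟩)
      ((eLpNorm_add_le (hv.measurable_eLpNorm_comp hG hf).aestronglyMeasurable
        aestronglyMeasurable_const hp').trans_eq ?_)
    simp [eLpNorm_const _ _ (NeZero.ne P), (one_pos.trans_le hp).ne']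
  refine ⟨(eLpNorm (fun ω => eLpNorm (fun y => f (v y ω)) 2 (volume.restrict D) +
    eLpNorm g 2 (volume.restrict D)) p P + noiseConst σ p).toNNReal, fun x₁ hx₁ x₂ hx₂ => ?_⟩
  rw [ENNReal.coe_toNNReal
    (ENNReal.add_ne_top.2 ⟨hsource, noiseConst_ne_top σ ENNReal.coe_ne_top⟩)]
  exact hv.eLpNorm_sub_le hG hf hg hW hp' hx₁ hx₂

end IsContinuousMildSolution

end Moments

section Regions

variable {k : ℕ} {D A : Set (Euc k)} {G : Euc k → Euc k → ℝ}

lemma IsRegion.isOpen (hA : IsRegion D A) (hD : IsOpen D) : IsOpen A := by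
  rcases hA with ⟨-, rfl⟩ | ⟨c, r, -, -, rfl⟩
  exacts [hD, isOpen_ball]

lemma IsRegion.nonempty (hA : IsRegion D A) (hD : D.Nonempty) : A.Nonempty := by
  rcases hA with ⟨-, rfl⟩ | ⟨c, r, hr, -, rfl⟩
  exacts [hD, nonempty_ball.2 hr]

lemma convex_interval (b : ℝ) : Convex ℝ {x : Euc 1 | 0 < x 0 ∧ x 0 < b} :=
  (convex_Ioo 0 b).linear_preimage (EuclideanSpace.proj (𝕜 := ℝ) (0 : Fin 1)).toLinearMap

lemma IsRegion.convex (hA : IsRegion D A) (hG : IsDomainWithGreen k D G) : Convex ℝ A := by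
  rcases hA with ⟨hk, rfl⟩ | ⟨c, r, -, -, rfl⟩
  · cases hG with
    | dim1 b hb => exact convex_interval b
    | dim2 => simp at hk
    | dim3 => simp at hk
  · exact convex_ball c r

lemma IsDomainWithGreen.pathExponent_sub_le_momentExponent (hG : IsDomainWithGreen k D G) {γ : ℝ}
    (hγ : 0 ≤ γ) : pathExponent k - γ ≤ momentExponent k γ := by
  cases hG <;> simp [pathExponent, momentExponent, hγ]

lemma IsDomainWithGreen.volume_ne_zero (hG : IsDomainWithGreen k D G) : volume D ≠ 0 := by
  cases hG with
  | dim1 b hb =>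
    exact (isOpen_interval.measure_pos _ (isHolderKernel_greenInterval hb).nonempty).ne'
  | dim2 D hD hconn => exact (hD.measure_pos _ hconn.nonempty).ne'
  | dim3 D hD hconn => exact (hD.measure_pos _ hconn.nonempty).ne'

lemma greenSup_ne_top (hD : volume D ≠ 0) {L : ℝ}
    (hL : ENNReal.ofReal L < (greenSup D G * volume D ^ (1 / 2 : ℝ))⁻¹) : greenSup D G ≠ ∞ := by
  intro h
  rw [h, ENNReal.top_mul (by simp [ENNReal.rpow_eq_zero_iff, hD]), ENNReal.inv_top] at hL
  exact not_lt_zero hL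

end Regions

section Increments

variable {Ω : Type*} [MeasurableSpace Ω] {P : Measure Ω} {k d : ℕ} {D A : Set (Euc k)}
  {G : Euc k → Euc k → ℝ} {f : Euc d → Euc d} {g : Euc k → Euc d}
  {σ : Matrix (Fin d) (Fin d) ℝ} {W : Fin d → Lp ℝ 2 (volume : Measure (Euc k)) → Ω → ℝ}
  {v : Euc k → Ω → Euc d}

lemma lintegral_enorm_sub_rpow_le_of_eLpNorm_le {E F : Type*} [NormedAddCommGroup E]
    [NormedAddCommGroup F] {v : E → Ω → F} {x₁ x₂ : E} {p : ℝ≥0} (hp : p ≠ 0) {C ξ : ℝ} (hC : 0 ≤ C)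
    (h : eLpNorm (v x₁ - v x₂) p P ≤ ENNReal.ofReal (C * ‖x₁ - x₂‖ ^ ξ)) :
    ∫⁻ ω, ‖v x₁ ω - v x₂ ω‖ₑ ^ (p : ℝ) ∂P ≤
      ENNReal.ofReal (C ^ (p : ℝ) * ‖x₁ - x₂‖ ^ (p * ξ)) := by
  calc ∫⁻ ω, ‖v x₁ ω - v x₂ ω‖ₑ ^ (p : ℝ) ∂P
      = eLpNorm (v x₁ - v x₂) p P ^ (p : ℝ) := (eLpNorm_nnreal_pow_eq_lintegral hp).symm
    _ ≤ ENNReal.ofReal (C * ‖x₁ - x₂‖ ^ ξ) ^ (p : ℝ) := by gcongr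
    _ = _ := by
      rw [ENNReal.ofReal_rpow_of_nonneg (by positivity) p.coe_nonneg,
        Real.mul_rpow hC (by positivity), ← Real.rpow_mul (norm_nonneg _), mul_comm ξ]

lemma IsNemytskii.exists_norm_le_of_mild [NeZero k] {F : L2 D d → L2 D d} (hF : IsNemytskii D f F)
    (hG : IsHolderKernel D G) (hbd : IsBoundedOperator F) {a L : ℝ}
    (ha : IsPoincareConst D G d a) (hLa : L < a)
    (hmono : ∀ v w : L2 D d, -(L * ‖v - w‖ ^ 2) ≤ ⟪v - w, F v - F w⟫) :
    ∃ B : ℝ, ∀ u z : L2 D d, (∀ᵐ x ∂volume.restrict D, u x + ∫ y in D, G x y • F u y = z x) →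
      ‖F u‖ ≤ B * (1 + ‖z‖) := by
  have := isFiniteMeasure_restrict_of_isBounded hG.isBounded
  obtain ⟨M, hM₀, hM⟩ := hF.exists_norm_le_mul_one_add_norm hG.isOpen hG.nonempty hbd
  obtain ⟨B, hB₀, hB⟩ := hF.exists_norm_le_of_linear_growth hM₀ hM
  obtain ⟨B', -, hB'⟩ := ha.exists_norm_le hLa hmono hB₀ hB
  exact ⟨B', hB'⟩

lemma IsContinuousMildSolution.exists_lintegral_enorm_sub_rpow_le
    (hv : IsContinuousMildSolution P D G f g σ W v) (hG : IsHolderKernel D G)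
    (hf : Continuous f) (hg : MemLp g 2 (volume.restrict D)) (hW : IsWhiteNoise P k d W)
    {p : ℝ≥0} (hp : 1 ≤ p)
    (hfv : eLpNorm (fun ω => eLpNorm (fun y => f (v y ω)) 2 (volume.restrict D)) p P ≠ ∞)
    (hA : IsRegion D A) {γ : ℝ} (hγ₀ : 0 < γ) (hγ₁ : γ < 1) :
    ∃ C : ℝ, 0 < C ∧ ∀ x₁ ∈ A, ∀ x₂ ∈ A, ∫⁻ ω, ‖v x₁ ω - v x₂ ω‖ₑ ^ (p : ℝ) ∂P ≤
      ENNReal.ofReal (C * ‖x₁ - x₂‖ ^ (p * momentExponent k γ)) := by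
  obtain ⟨C₁, hC₁⟩ := hv.exists_eLpNorm_sub_le hG hf hg hW hp hfv
  obtain ⟨C₂, hC₂, hholder⟩ := hG.holder A hA γ hγ₀ hγ₁
  refine ⟨(C₁ * C₂ + 1) ^ (p : ℝ), by positivity, fun x₁ hx₁ x₂ hx₂ =>
    lintegral_enorm_sub_rpow_le_of_eLpNorm_le (one_pos.trans_le hp).ne' (by positivity) ?_⟩
  calc eLpNorm (v x₁ - v x₂) p P
      ≤ C₁ * eLpNorm (G x₁ - G x₂) 2 (volume.restrict D) :=
        hC₁ x₁ (hA.subset hx₁) x₂ (hA.subset hx₂)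
    _ ≤ C₁ * ENNReal.ofReal (C₂ * ‖x₁ - x₂‖ ^ momentExponent k γ) := by
        gcongr
        exact hholder x₁ hx₁ x₂ hx₂
    _ = ENNReal.ofReal (C₁ * C₂ * ‖x₁ - x₂‖ ^ momentExponent k γ) := by
        rw [← ENNReal.ofReal_coe_nnreal, ← ENNReal.ofReal_mul C₁.coe_nonneg, mul_assoc]
    _ ≤ _ := by
        gcongr
        exact le_add_of_nonneg_right zero_le_one

end Increments

/-! ### Hölder continuity from finite energy -/

open AffineMap (homothety)

section Homothety

variable {E : Type*} [NormedAddCommGroup E] [NormedSpace ℝ E] {A : Set E} {x y a b : E} {s t : ℝ}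

lemma homothety_mem_of_convex (hA : Convex ℝ A) (hx : x ∈ A) (ha : a ∈ A) (hs0 : 0 ≤ s)
    (hs1 : s ≤ 1) : homothety x s a ∈ A := by
  rw [AffineMap.homothety_eq_lineMap]
  exact hA.lineMap_mem hx ha ⟨hs0, hs1⟩

lemma dist_homothety_homothety_le {Λ : ℝ} (hΛ : ∀ a ∈ A, ∀ b ∈ A, dist a b ≤ Λ) (hx : x ∈ A)
    (ha : a ∈ A) (hy : y ∈ A) (hb : b ∈ A) (ht0 : 0 ≤ t) (hts : t ≤ s)
    (hxy : dist x y ≤ s * Λ) : dist (homothety x s a) (homothety y t b) ≤ 3 * (s * Λ) := by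
  have hax : dist (homothety x s a) x ≤ s * Λ := by
    rw [dist_comm, dist_center_homothety, Real.norm_of_nonneg (ht0.trans hts)]
    exact mul_le_mul_of_nonneg_left (hΛ x hx a ha) (ht0.trans hts)
  have hby : dist y (homothety y t b) ≤ s * Λ := by
    rw [dist_center_homothety, Real.norm_of_nonneg ht0]
    exact mul_le_mul hts (hΛ y hy b hb) dist_nonneg (ht0.trans hts)
  linarith [dist_triangle4 (homothety x s a) x y (homothety y t b)]

variable [FiniteDimensional ℝ E] [MeasurableSpace E] [BorelSpace E] {μ : Measure E}
  [μ.IsAddHaarMeasure]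

lemma lintegral_comp_homothety (H : E → ℝ≥0∞) (x : E) (hs : 0 < s) :
    ∫⁻ a, H (homothety x s a) ∂μ = ENNReal.ofReal (s ^ Module.finrank ℝ E)⁻¹ * ∫⁻ a, H a ∂μ := by
  have hsmul : MeasurableEmbedding fun a : E => s • a :=
    (Homeomorph.smulOfNeZero s hs.ne').measurableEmbedding
  calc ∫⁻ a, H (homothety x s a) ∂μ = ∫⁻ a, H (s • (a - x) + x) ∂μ := rfl
    _ = ∫⁻ a, H (s • a + x) ∂μ := lintegral_sub_right_eq_self (fun a => H (s • a + x)) x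
    _ = ∫⁻ a, H (a + x) ∂(μ.map fun a => s • a) :=
      (hsmul.lintegral_map fun a => H (a + x)).symm
    _ = ENNReal.ofReal (s ^ Module.finrank ℝ E)⁻¹ * ∫⁻ a, H (a + x) ∂μ := by
      rw [Measure.map_addHaar_smul μ hs.ne', lintegral_smul_measure, abs_of_pos (by positivity),
        smul_eq_mul]
    _ = _ := by rw [lintegral_add_right_eq_self H x]

lemma lintegral_cond_comp_homothety_le (hAm : MeasurableSet A) (hA : Convex ℝ A) (hx : x ∈ A)
    (hs0 : 0 < s) (hs1 : s ≤ 1) (H : E → ℝ≥0∞) :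
    ∫⁻ a, H (homothety x s a) ∂μ[|A] ≤
      ENNReal.ofReal (s ^ Module.finrank ℝ E)⁻¹ * ∫⁻ a, H a ∂μ[|A] := by
  simp only [ProbabilityTheory.cond, lintegral_smul_measure, smul_eq_mul]
  rw [mul_left_comm, ← lintegral_indicator hAm, ← lintegral_indicator hAm,
    ← lintegral_comp_homothety _ x hs0]
  gcongr with a
  exact indicator_le (fun b hb =>
    (indicator_of_mem (homothety_mem_of_convex hA hx hb hs0.le hs1) H).ge) a

end Homothety

section Energy

variable {E F : Type*} [NormedAddCommGroup E] [NormedAddCommGroup F] [MeasurableSpace E]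

/-- The integral `∫∫ ‖w a - w b‖ᵖ / ‖a - b‖ᶿ ν(da) ν(db)`, which for the Lebesgue measure `ν` on a
domain is the Gagliardo (or Slobodeckij) seminorm of a fractional Sobolev space. -/
def gagliardoEnergy (ν : Measure E) (p θ : ℝ) (w : E → F) : ℝ≥0∞ :=
  ∫⁻ a, ∫⁻ b, ‖w a - w b‖ₑ ^ p / ‖a - b‖ₑ ^ θ ∂ν ∂ν

omit [MeasurableSpace E] in
lemma enorm_sub_rpow_div_mul (w : E → F) {p : ℝ} (hp : 0 < p) (θ : ℝ) (a b : E) :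
    ‖w a - w b‖ₑ ^ p / ‖a - b‖ₑ ^ θ * ‖a - b‖ₑ ^ θ = ‖w a - w b‖ₑ ^ p := by
  rcases eq_or_ne a b with rfl | hab
  · simp [hp]
  · have hne : ‖a - b‖ₑ ≠ 0 := enorm_ne_zero.2 (sub_ne_zero.2 hab)
    exact ENNReal.div_mul_cancel (ENNReal.rpow_pos hne.bot_lt enorm_ne_top).ne'
      (ENNReal.rpow_ne_top_of_ne_zero hne enorm_ne_top)

variable [NormedSpace ℝ E] [FiniteDimensional ℝ E] [BorelSpace E] {μ : Measure E}
  [μ.IsAddHaarMeasure] {A : Set E} {w : E → F} {x y : E} {s t Λ : ℝ}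

lemma lintegral_enorm_sub_homothety_rpow_le (hAm : MeasurableSet A) (hA : Convex ℝ A)
    {p θ : ℝ} (hp : 0 < p) (hθ : 0 ≤ θ) (hΛ : ∀ a ∈ A, ∀ b ∈ A, dist a b ≤ Λ)
    (hx : x ∈ A) (hy : y ∈ A) (ht0 : 0 < t) (hts : t ≤ s) (hs1 : s ≤ 1) (hxy : dist x y ≤ s * Λ) :
    ∫⁻ a, ∫⁻ b, ‖w (homothety x s a) - w (homothety y t b)‖ₑ ^ p ∂μ[|A] ∂μ[|A] ≤
      ENNReal.ofReal (3 * (s * Λ)) ^ θ * (ENNReal.ofReal (t ^ Module.finrank ℝ E)⁻¹ *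
        (ENNReal.ofReal (s ^ Module.finrank ℝ E)⁻¹ * gagliardoEnergy μ[|A] p θ w)) := by
  set q : E → E → ℝ≥0∞ := fun a b => ‖w a - w b‖ₑ ^ p / ‖a - b‖ₑ ^ θ
  have hquotient : ∀ a ∈ A, ∀ b ∈ A, ‖w (homothety x s a) - w (homothety y t b)‖ₑ ^ p ≤
      ENNReal.ofReal (3 * (s * Λ)) ^ θ * q (homothety x s a) (homothety y t b) := by
    intro a ha b hb
    have hdist : ‖homothety x s a - homothety y t b‖ₑ ≤ ENNReal.ofReal (3 * (s * Λ)) := by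
      rw [← edist_eq_enorm_sub, edist_dist]
      exact ENNReal.ofReal_le_ofReal
        (dist_homothety_homothety_le hΛ hx ha hy hb ht0.le hts hxy)
    rw [← enorm_sub_rpow_div_mul w hp θ, mul_comm]
    exact mul_le_mul' (ENNReal.rpow_le_rpow hdist hθ) le_rfl
  calc ∫⁻ a, ∫⁻ b, ‖w (homothety x s a) - w (homothety y t b)‖ₑ ^ p ∂μ[|A] ∂μ[|A]
      ≤ ∫⁻ a, ∫⁻ b, ENNReal.ofReal (3 * (s * Λ)) ^ θ *
          q (homothety x s a) (homothety y t b) ∂μ[|A] ∂μ[|A] := by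
        refine lintegral_mono_ae ((ae_cond_mem hAm).mono fun a ha => ?_)
        exact lintegral_mono_ae ((ae_cond_mem hAm).mono fun b hb => hquotient a ha b hb)
    _ = ENNReal.ofReal (3 * (s * Λ)) ^ θ *
          ∫⁻ a, ∫⁻ b, q (homothety x s a) (homothety y t b) ∂μ[|A] ∂μ[|A] := by
        simp_rw [lintegral_const_mul' _ _ (ENNReal.rpow_ne_top_of_nonneg hθ ENNReal.ofReal_ne_top)]
    _ ≤ ENNReal.ofReal (3 * (s * Λ)) ^ θ * ∫⁻ a, ENNReal.ofReal (t ^ Module.finrank ℝ E)⁻¹ *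
          ∫⁻ b, q (homothety x s a) b ∂μ[|A] ∂μ[|A] := by
        gcongr with a
        exact lintegral_cond_comp_homothety_le hAm hA hy ht0 (hts.trans hs1) _
    _ = ENNReal.ofReal (3 * (s * Λ)) ^ θ * (ENNReal.ofReal (t ^ Module.finrank ℝ E)⁻¹ *
          ∫⁻ a, ∫⁻ b, q (homothety x s a) b ∂μ[|A] ∂μ[|A]) := by
        rw [lintegral_const_mul' _ _ ENNReal.ofReal_ne_top]
    _ ≤ _ := by
        gcongr
        exact lintegral_cond_comp_homothety_le hAm hA hx (ht0.trans_le hts) hs1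
          fun a => ∫⁻ b, q a b ∂μ[|A]

omit [MeasurableSpace E] in
lemma mul_rpow_mul_inv_pow_le {n : ℕ} {p α : ℝ} (hΛ : 0 < Λ) (ht0 : 0 < t) (hst : s / 2 ≤ t)
    (hts : t ≤ s) : (3 * (s * Λ)) ^ (2 * n + p * α) * ((t ^ n)⁻¹ * (s ^ n)⁻¹) ≤
      2 ^ n * (3 * Λ) ^ (2 * n + p * α) * (s ^ α) ^ p := by
  have hs0 : 0 < s := ht0.trans_le hts
  have hscale : (3 * (s * Λ)) ^ (2 * n + p * α) =
      (3 * Λ) ^ (2 * n + p * α) * (s ^ n * s ^ n * (s ^ α) ^ p) := by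
    rw [mul_left_comm, mul_comm s, Real.mul_rpow (by positivity) hs0.le, Real.rpow_add hs0,
      two_mul, Real.rpow_add hs0, Real.rpow_natCast, mul_comm p, Real.rpow_mul hs0.le]
  have hinv : (t ^ n)⁻¹ ≤ 2 ^ n * (s ^ n)⁻¹ := by
    rw [← div_eq_mul_inv, ← div_pow, ← inv_pow, ← inv_div]
    gcongr
  calc (3 * (s * Λ)) ^ (2 * n + p * α) * ((t ^ n)⁻¹ * (s ^ n)⁻¹)
      ≤ (3 * Λ) ^ (2 * n + p * α) * (s ^ n * s ^ n * (s ^ α) ^ p) *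
          (2 ^ n * (s ^ n)⁻¹ * (s ^ n)⁻¹) := by
        rw [hscale]
        gcongr
    _ = 2 ^ n * (3 * Λ) ^ (2 * n + p * α) * (s ^ α) ^ p := by field_simp

omit [μ.IsAddHaarMeasure] in
lemma aestronglyMeasurable_comp_homothety (hAm : MeasurableSet A) (hA : Convex ℝ A)
    (hw : ContinuousOn w A) (hx : x ∈ A) (hs0 : 0 ≤ s) (hs1 : s ≤ 1) :
    AEStronglyMeasurable (fun a => w (homothety x s a)) μ[|A] :=
  ((hw.comp (AffineMap.homothety_continuous x s).continuousOn fun _ ha =>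
    homothety_mem_of_convex hA hx ha hs0 hs1).aestronglyMeasurable hAm).smul_measure _

lemma eLpNorm_sub_homothety_le (hAm : MeasurableSet A) (hA : Convex ℝ A) (hw : ContinuousOn w A)
    {p : ℝ≥0} (hp : p ≠ 0) {α : ℝ} (hα : 0 ≤ α) (hΛ0 : 0 < Λ)
    (hΛ : ∀ a ∈ A, ∀ b ∈ A, dist a b ≤ Λ) (hx : x ∈ A) (hy : y ∈ A) (ht0 : 0 < t)
    (hst : s / 2 ≤ t) (hts : t ≤ s) (hs1 : s ≤ 1) (hxy : dist x y ≤ s * Λ) :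
    eLpNorm (fun q : E × E => w (homothety x s q.1) - w (homothety y t q.2)) p
        (μ[|A].prod μ[|A]) ≤
      (ENNReal.ofReal (2 ^ Module.finrank ℝ E * (3 * Λ) ^ (2 * Module.finrank ℝ E + p * α)) *
        gagliardoEnergy μ[|A] p (2 * Module.finrank ℝ E + p * α) w) ^ (p : ℝ)⁻¹ *
        ENNReal.ofReal (s ^ α) := by
  have hs0 : 0 < s := ht0.trans_le hts
  have hp0 : (0 : ℝ) < p := by positivity
  set I := gagliardoEnergy μ[|A] p (2 * Module.finrank ℝ E + p * α) w
  have hmeas : AEStronglyMeasurable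
      (fun q : E × E => w (homothety x s q.1) - w (homothety y t q.2)) (μ[|A].prod μ[|A]) :=
    (aestronglyMeasurable_comp_homothety hAm hA hw hx hs0.le hs1).comp_fst.sub
      (aestronglyMeasurable_comp_homothety hAm hA hw hy ht0.le (hts.trans hs1)).comp_snd
  rw [← ENNReal.rpow_le_rpow_iff hp0, ENNReal.mul_rpow_of_nonneg _ _ hp0.le,
    ENNReal.rpow_inv_rpow hp0.ne', eLpNorm_nnreal_pow_eq_lintegral hp,
    lintegral_prod _ (hmeas.enorm.pow_const _)]
  set n := Module.finrank ℝ E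
  set θ := 2 * (n : ℝ) + p * α
  have hθ : 0 ≤ θ := by positivity
  calc ∫⁻ a, ∫⁻ b, ‖w (homothety x s a) - w (homothety y t b)‖ₑ ^ (p : ℝ) ∂μ[|A] ∂μ[|A]
      ≤ ENNReal.ofReal (3 * (s * Λ)) ^ θ *
          (ENNReal.ofReal (t ^ n)⁻¹ * (ENNReal.ofReal (s ^ n)⁻¹ * I)) :=
        lintegral_enorm_sub_homothety_rpow_le hAm hA hp0 hθ hΛ hx hy ht0 hts hs1 hxy
    _ = ENNReal.ofReal ((3 * (s * Λ)) ^ θ * ((t ^ n)⁻¹ * (s ^ n)⁻¹)) * I := by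
        rw [ENNReal.ofReal_rpow_of_nonneg (by positivity) hθ, ENNReal.ofReal_mul (by positivity),
          ENNReal.ofReal_mul (by positivity)]
        ring
    _ ≤ ENNReal.ofReal (2 ^ n * (3 * Λ) ^ θ * (s ^ α) ^ (p : ℝ)) * I := by
        gcongr ENNReal.ofReal ?_ * _
        exact mul_rpow_mul_inv_pow_le hΛ0 ht0 hst hts
    _ = ENNReal.ofReal (2 ^ n * (3 * Λ) ^ θ) * I * ENNReal.ofReal (s ^ α) ^ (p : ℝ) := by
        rw [ENNReal.ofReal_mul (by positivity),
          ENNReal.ofReal_rpow_of_nonneg (by positivity) hp0.le]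
        ring

end Energy

open Filter in
lemma le_mul_inv_one_sub_of_le_add_half {N : ℝ → ℝ≥0∞} {R : ℝ≥0∞} {α : ℝ}
    (hN : ∀ s, 0 < s → s ≤ 1 → N s ≤ R * ENNReal.ofReal (s ^ α) + N (s / 2))
    (hlim : Tendsto N (nhdsWithin 0 (Ioi 0)) (nhds 0)) {s : ℝ} (hs0 : 0 < s) (hs1 : s ≤ 1) :
    N s ≤ R * ENNReal.ofReal (s ^ α) * (1 - ENNReal.ofReal ((1 / 2) ^ α))⁻¹ := by
  set ρ := ENNReal.ofReal ((1 / 2) ^ α)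
  have hiterate : ∀ n : ℕ, N s ≤
      R * ENNReal.ofReal (s ^ α) * ∑ i ∈ Finset.range n, ρ ^ i + N (s / 2 ^ n) := by
    intro n
    induction n with
    | zero => simp
    | succ n ih =>
      have hscale : ENNReal.ofReal ((s / 2 ^ n) ^ α) = ENNReal.ofReal (s ^ α) * ρ ^ n := by
        rw [← ENNReal.ofReal_pow (by positivity), ← ENNReal.ofReal_mul (by positivity),
          div_eq_mul_one_div, ← one_div_pow, Real.mul_rpow hs0.le (by positivity),
          Real.rpow_pow_comm (by norm_num)]
      calc N s ≤ R * ENNReal.ofReal (s ^ α) * ∑ i ∈ Finset.range n, ρ ^ i +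
            (R * ENNReal.ofReal ((s / 2 ^ n) ^ α) + N (s / 2 ^ n / 2)) := by
            refine ih.trans (add_le_add le_rfl (hN _ (by positivity) ?_))
            exact div_le_one_of_le₀ (hs1.trans (one_le_pow₀ one_le_two)) (by positivity)
        _ = _ := by
            rw [hscale, Finset.sum_range_succ, div_div, ← pow_succ]
            ring
  have hgeometric : ∀ n : ℕ, N s ≤
      R * ENNReal.ofReal (s ^ α) * (1 - ρ)⁻¹ + N (s / 2 ^ n) := by
    intro n
    refine (hiterate n).trans ?_
    rw [← ENNReal.tsum_geometric]
    gcongr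
    exact ENNReal.sum_le_tsum _
  have hhalving : Tendsto (fun n : ℕ => s / 2 ^ n) atTop (nhdsWithin 0 (Ioi 0)) :=
    tendsto_nhdsWithin_iff.2 ⟨tendsto_const_nhds.div_atTop
      (tendsto_pow_atTop_atTop_of_one_lt one_lt_two), Eventually.of_forall fun n => by
        rw [mem_Ioi]; positivity⟩
  simpa using ge_of_tendsto' (tendsto_const_nhds.add (hlim.comp hhalving)) hgeometric

section Campanato

variable {E F : Type*} [NormedAddCommGroup E] [NormedSpace ℝ E] [MeasurableSpace E]
  [NormedAddCommGroup F] {μ : Measure E} {A : Set E} {w : E → F} {x y : E} {p : ℝ≥0∞} {s α Λ : ℝ}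
  {R : ℝ≥0∞}

/-- A Campanato-type condition: on average, the values of `w` on two copies of `A` that have been
shrunk by comparable ratios towards nearby points of `A` differ by at most `R sᵅ`, with `s` the
larger of the ratios. The constant `Λ` stands for a bound of the diameter of `A`. -/
def IsCampanatoBound (μ : Measure E) (A : Set E) (w : E → F) (p : ℝ≥0∞) (α Λ : ℝ) (R : ℝ≥0∞) :
    Prop :=
  ∀ x ∈ A, ∀ y ∈ A, ∀ s t : ℝ, 0 < t → s / 2 ≤ t → t ≤ s → s ≤ 1 → dist x y ≤ s * Λ →
    eLpNorm (fun q : E × E => w (homothety x s q.1) - w (homothety y t q.2)) p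
      (μ[|A].prod μ[|A]) ≤ R * ENNReal.ofReal (s ^ α)

open Filter in
lemma tendsto_eLpNorm_sub_homothety (hAm : MeasurableSet A) (hA : Convex ℝ A)
    (hw : ContinuousOn w A) (hΛ : ∀ a ∈ A, ∀ b ∈ A, dist a b ≤ Λ) (hx : x ∈ A) :
    Tendsto (fun s : ℝ => eLpNorm (fun a => w x - w (homothety x s a)) p μ[|A])
      (nhdsWithin 0 (Ioi 0)) (nhds 0) := by
  rw [ENNReal.tendsto_nhds_zero]
  intro ε hε
  obtain ⟨δ, hδ0, hδ⟩ := Metric.mem_nhdsWithin_iff.1 (hw x hx (closedEBall_mem_nhds (w x) hε))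
  have hsmall : ∀ᶠ s : ℝ in nhdsWithin 0 (Ioi 0), s * Λ < δ :=
    ((continuous_mul_const Λ).tendsto' 0 0 (zero_mul Λ)).mono_left nhdsWithin_le_nhds
      |>.eventually (gt_mem_nhds hδ0)
  filter_upwards [hsmall, Ioc_mem_nhdsGT one_pos] with s hsδ hs
  have hclose : ∀ᵐ a ∂μ[|A], ‖w x - w (homothety x s a)‖ₑ ≤ ε := by
    filter_upwards [ae_cond_mem hAm] with a ha
    have hdist : dist (homothety x s a) x < δ := by
      rw [dist_comm, dist_center_homothety, Real.norm_of_nonneg hs.1.le]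
      exact (mul_le_mul_of_nonneg_left (hΛ x hx a ha) hs.1.le).trans_lt hsδ
    rw [← edist_eq_enorm_sub, edist_comm]
    exact hδ ⟨hdist, homothety_mem_of_convex hA hx ha hs.1.le hs.2⟩
  calc eLpNorm (fun a => w x - w (homothety x s a)) p μ[|A]
      ≤ ε • μ[|A] univ ^ p.toReal⁻¹ := eLpNorm_le_of_ae_enorm_bound hclose
    _ ≤ ε * 1 := by
        rw [smul_eq_mul]
        gcongr
        exact ENNReal.rpow_le_one prob_le_one (by positivity)
    _ = ε := mul_one ε

variable [BorelSpace E] [FiniteDimensional ℝ E] [IsProbabilityMeasure μ[|A]]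

lemma eLpNorm_sub_homothety_comp_fst (hAm : MeasurableSet A) (hA : Convex ℝ A)
    (hw : ContinuousOn w A) (hx : x ∈ A) (hs0 : 0 ≤ s) (hs1 : s ≤ 1) :
    eLpNorm (fun q : E × E => w x - w (homothety x s q.1)) p (μ[|A].prod μ[|A]) =
      eLpNorm (fun a => w x - w (homothety x s a)) p μ[|A] :=
  eLpNorm_comp_measurePreserving (g := fun a => w x - w (homothety x s a))
    (aestronglyMeasurable_const.sub (aestronglyMeasurable_comp_homothety hAm hA hw hx hs0 hs1))
    measurePreserving_fst

lemma eLpNorm_sub_homothety_comp_snd (hAm : MeasurableSet A) (hA : Convex ℝ A)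
    (hw : ContinuousOn w A) (hx : x ∈ A) (hs0 : 0 ≤ s) (hs1 : s ≤ 1) :
    eLpNorm (fun q : E × E => w x - w (homothety x s q.2)) p (μ[|A].prod μ[|A]) =
      eLpNorm (fun a => w x - w (homothety x s a)) p μ[|A] :=
  eLpNorm_comp_measurePreserving (g := fun a => w x - w (homothety x s a))
    (aestronglyMeasurable_const.sub (aestronglyMeasurable_comp_homothety hAm hA hw hx hs0 hs1))
    measurePreserving_snd

lemma IsCampanatoBound.eLpNorm_sub_homothety_le (hR : IsCampanatoBound μ A w p α Λ R)
    (hp : 1 ≤ p) (hAm : MeasurableSet A) (hA : Convex ℝ A) (hw : ContinuousOn w A)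
    (hΛ : ∀ a ∈ A, ∀ b ∈ A, dist a b ≤ Λ) (hx : x ∈ A) (hs0 : 0 < s) (hs1 : s ≤ 1) :
    eLpNorm (fun a => w x - w (homothety x s a)) p μ[|A] ≤
      R * ENNReal.ofReal (s ^ α) * (1 - ENNReal.ofReal ((1 / 2) ^ α))⁻¹ := by
  refine le_mul_inv_one_sub_of_le_add_half (fun s hs0 hs1 => ?_)
    (tendsto_eLpNorm_sub_homothety hAm hA hw hΛ hx) hs0 hs1
  have hs0' : 0 ≤ s / 2 := by linarith
  have hs1' : s / 2 ≤ 1 := by linarith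
  have hxx : dist x x ≤ s * Λ := by
    rw [dist_self]
    exact mul_nonneg hs0.le (dist_nonneg.trans (hΛ x hx x hx))
  have hmeas := aestronglyMeasurable_comp_homothety (μ := μ) hAm hA hw hx hs0.le hs1
  have hmeas' := aestronglyMeasurable_comp_homothety (μ := μ) hAm hA hw hx hs0' hs1'
  rw [← eLpNorm_sub_homothety_comp_fst hAm hA hw hx hs0.le hs1,
    ← eLpNorm_sub_homothety_comp_snd hAm hA hw hx hs0' hs1', add_comm]
  calc eLpNorm (fun q : E × E => w x - w (homothety x s q.1)) p (μ[|A].prod μ[|A])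
      = eLpNorm ((fun q => w x - w (homothety x (s / 2) q.2)) -
          fun q => w (homothety x s q.1) - w (homothety x (s / 2) q.2)) p
          (μ[|A].prod μ[|A]) := by
        congr 1
        ext q
        simp only [Pi.sub_apply]
        abel
    _ ≤ _ := eLpNorm_sub_le (aestronglyMeasurable_const.sub hmeas'.comp_snd)
        (hmeas.comp_fst.sub hmeas'.comp_snd) hp
    _ ≤ _ := by
        gcongr
        exact hR x hx x hx s (s / 2) (by linarith) le_rfl (by linarith) hs1 hxx

lemma IsCampanatoBound.enorm_sub_le (hR : IsCampanatoBound μ A w p α Λ R)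
    (hp : 1 ≤ p) (hAm : MeasurableSet A) (hA : Convex ℝ A) (hw : ContinuousOn w A)
    (hΛ : ∀ a ∈ A, ∀ b ∈ A, dist a b ≤ Λ) (hx : x ∈ A) (hy : y ∈ A) (hs0 : 0 < s) (hs1 : s ≤ 1)
    (hxy : dist x y ≤ s * Λ) :
    ‖w x - w y‖ₑ ≤ R * (2 * (1 - ENNReal.ofReal ((1 / 2) ^ α))⁻¹ + 1) * ENNReal.ofReal (s ^ α) := by
  have hmeasx := aestronglyMeasurable_comp_homothety (μ := μ) hAm hA hw hx hs0.le hs1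
  have hmeasy := aestronglyMeasurable_comp_homothety (μ := μ) hAm hA hw hy hs0.le hs1
  have hbound : ∀ z ∈ A, eLpNorm (fun a => w z - w (homothety z s a)) p μ[|A] ≤
      R * ENNReal.ofReal (s ^ α) * (1 - ENNReal.ofReal ((1 / 2) ^ α))⁻¹ := fun z hz =>
    hR.eLpNorm_sub_homothety_le hp hAm hA hw hΛ hz hs0 hs1
  calc ‖w x - w y‖ₑ = eLpNorm (fun _ : E × E => w x - w y) p (μ[|A].prod μ[|A]) := by
        rw [eLpNorm_const _ (one_pos.trans_le hp).ne' (IsProbabilityMeasure.ne_zero _),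
          measure_univ, ENNReal.one_rpow, mul_one]
    _ = eLpNorm ((fun q => w x - w (homothety x s q.1)) +
          (fun q => w (homothety x s q.1) - w (homothety y s q.2)) -
          fun q => w y - w (homothety y s q.2)) p (μ[|A].prod μ[|A]) := by
        congr 1
        ext q
        simp only [Pi.sub_apply, Pi.add_apply]
        abel
    _ ≤ eLpNorm (fun a => w x - w (homothety x s a)) p μ[|A] +
          R * ENNReal.ofReal (s ^ α) + eLpNorm (fun a => w y - w (homothety y s a)) p μ[|A] := by
        rw [← eLpNorm_sub_homothety_comp_fst hAm hA hw hx hs0.le hs1,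
          ← eLpNorm_sub_homothety_comp_snd hAm hA hw hy hs0.le hs1]
        refine (eLpNorm_sub_le ((aestronglyMeasurable_const.sub hmeasx.comp_fst).add
          (hmeasx.comp_fst.sub hmeasy.comp_snd))
          (aestronglyMeasurable_const.sub hmeasy.comp_snd) hp).trans (add_le_add ?_ le_rfl)
        exact (eLpNorm_add_le (aestronglyMeasurable_const.sub hmeasx.comp_fst)
          (hmeasx.comp_fst.sub hmeasy.comp_snd) hp).trans (add_le_add le_rfl
            (hR x hx y hy s s hs0 (by linarith) le_rfl hs1 hxy))
    _ ≤ _ := (add_le_add (add_le_add (hbound x hx) le_rfl) (hbound y hy)).trans_eq (by ring)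

lemma IsCampanatoBound.exists_holderOnWith {α : ℝ≥0} (hR : IsCampanatoBound μ A w p α Λ R)
    (hRtop : R ≠ ∞) (hα : 0 < α) (hp : 1 ≤ p) (hAm : MeasurableSet A) (hA : Convex ℝ A)
    (hw : ContinuousOn w A) (hΛ0 : 0 < Λ) (hΛ : ∀ a ∈ A, ∀ b ∈ A, dist a b ≤ Λ) :
    ∃ C : ℝ≥0, HolderOnWith C α w A := by
  have hratio : ENNReal.ofReal ((1 / 2) ^ (α : ℝ)) < 1 :=
    ENNReal.ofReal_lt_one.2 (Real.rpow_lt_one (by norm_num) (by norm_num) hα)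
  have hinv : (1 - ENNReal.ofReal ((1 / 2) ^ (α : ℝ)))⁻¹ ≠ ∞ :=
    ENNReal.inv_ne_top.2 (tsub_pos_of_lt hratio).ne'
  obtain ⟨C, hC⟩ : ∃ C : ℝ≥0, R * (2 * (1 - ENNReal.ofReal ((1 / 2) ^ (α : ℝ)))⁻¹ + 1) = C :=
    ⟨_, (ENNReal.coe_toNNReal (by finiteness)).symm⟩
  refine ⟨C * ((1 / Λ) ^ (α : ℝ)).toNNReal, fun x hx y hy => ?_⟩
  rcases eq_or_ne x y with rfl | hxy
  · simp
  have hle := hR.enorm_sub_le hp hAm hA hw hΛ hx hy (div_pos (dist_pos.2 hxy) hΛ0)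
    ((div_le_one hΛ0).2 (hΛ x hx y hy)) (div_mul_cancel₀ _ hΛ0.ne').ge
  calc edist (w x) (w y) ≤ C * ENNReal.ofReal ((dist x y / Λ) ^ (α : ℝ)) := by
        rw [edist_eq_enorm_sub, ← hC]
        exact hle
    _ = C * (ENNReal.ofReal ((1 / Λ) ^ (α : ℝ)) * edist x y ^ (α : ℝ)) := by
        rw [div_eq_mul_one_div, mul_comm (dist x y),
          Real.mul_rpow (by positivity) dist_nonneg, ENNReal.ofReal_mul (by positivity),
          edist_dist, ENNReal.ofReal_rpow_of_nonneg dist_nonneg α.coe_nonneg]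
    _ = _ := by
        rw [ENNReal.coe_mul, mul_assoc]
        rfl

end Campanato

theorem exists_holderOnWith_of_gagliardoEnergy_ne_top {E F : Type*} [NormedAddCommGroup E]
    [NormedSpace ℝ E] [FiniteDimensional ℝ E] [MeasurableSpace E] [BorelSpace E]
    [NormedAddCommGroup F] {μ : Measure E} [μ.IsAddHaarMeasure] {A : Set E} {w : E → F}
    {p α : ℝ≥0} (hAo : IsOpen A) (hAne : A.Nonempty) (hA : Convex ℝ A)
    (hAb : Bornology.IsBounded A) (hw : ContinuousOn w A) (hp : 1 ≤ p) (hα : 0 < α)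
    (henergy : gagliardoEnergy μ[|A] p (2 * Module.finrank ℝ E + p * α) w ≠ ∞) :
    ∃ C : ℝ≥0, HolderOnWith C α w A := by
  have := cond_isProbabilityMeasure_of_finite (hAo.measure_pos μ hAne).ne' hAb.measure_lt_top.ne
  have hΛ : ∀ a ∈ A, ∀ b ∈ A, dist a b ≤ diam (closure A) + 1 := fun a ha b hb =>
    (dist_lt_diam_closure_add_one hAb (subset_closure ha) (subset_closure hb)).le
  have hΛ0 : 0 < diam (closure A) + 1 := by positivity
  refine IsCampanatoBound.exists_holderOnWith (μ := μ) (p := p)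
    (fun x hx y hy s t ht0 hst hts hs1 hxy => eLpNorm_sub_homothety_le hAo.measurableSet hA hw
      (one_pos.trans_le hp).ne' α.coe_nonneg hΛ0 hΛ hx hy ht0 hst hts hs1 hxy)
    ?_ hα (by exact_mod_cast hp) hAo.measurableSet hA hw hΛ0 hΛ
  exact ENNReal.rpow_ne_top_of_nonneg (by positivity)
    (ENNReal.mul_ne_top ENNReal.ofReal_ne_top henergy)

section PathRegularity

lemma lintegral_lintegral_lintegral_rotate {Ω X : Type*} [MeasurableSpace Ω] [MeasurableSpace X]
    {P : Measure Ω} [SFinite P] {ν : Measure X} [SFinite ν] {H : Ω → X → X → ℝ≥0∞}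
    (hH : Measurable fun q : (Ω × X) × X => H q.1.1 q.1.2 q.2) :
    ∫⁻ ω, (∫⁻ a, ∫⁻ b, H ω a b ∂ν ∂ν) ∂P = ∫⁻ a, ∫⁻ b, ∫⁻ ω, H ω a b ∂P ∂ν ∂ν := by
  have hinner : Measurable fun q : Ω × X => ∫⁻ b, H q.1 q.2 b ∂ν := hH.lintegral_prod_right'
  rw [lintegral_lintegral_swap (f := fun ω a => ∫⁻ b, H ω a b ∂ν) hinner.aemeasurable]
  refine lintegral_congr fun a => ?_
  have hslice : Measurable fun q : Ω × X => H q.1 a q.2 :=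
    hH.comp ((measurable_fst.prodMk measurable_const).prodMk measurable_snd)
  exact lintegral_lintegral_swap (f := fun ω b => H ω a b) hslice.aemeasurable

variable {Ω E F : Type*} [MeasurableSpace Ω] {P : Measure Ω} [NormedAddCommGroup E]
  [NormedAddCommGroup F]

lemma gagliardoEnergy_congr_ae [MeasurableSpace E] {ν : Measure E} {p θ : ℝ} {w w' : E → F}
    (h : w =ᵐ[ν] w') : gagliardoEnergy ν p θ w = gagliardoEnergy ν p θ w' := by
  refine lintegral_congr_ae (h.mono fun a ha => lintegral_congr_ae (h.mono fun b hb => ?_))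
  simp only [ha, hb]

lemma lintegral_enorm_sub_rpow_div_le {v : E → Ω → F} {p θ C : ℝ} (hp : 0 < p) {a b : E}
    (hmom : ∫⁻ ω, ‖v a ω - v b ω‖ₑ ^ p ∂P ≤ ENNReal.ofReal (C * ‖a - b‖ ^ θ)) :
    ∫⁻ ω, ‖v a ω - v b ω‖ₑ ^ p / ‖a - b‖ₑ ^ θ ∂P ≤ ENNReal.ofReal C := by
  rcases eq_or_ne a b with rfl | hab
  · simp [hp]
  · have hpos : 0 < ‖a - b‖ := norm_pos_iff.2 (sub_ne_zero.2 hab)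
    have hpow : 0 < ‖a - b‖ ^ θ := Real.rpow_pos_of_pos hpos _
    rw [← ofReal_norm (a - b), ENNReal.ofReal_rpow_of_pos hpos]
    simp_rw [div_eq_mul_inv]
    rw [lintegral_mul_const' _ _ (ENNReal.inv_ne_top.2 (ENNReal.ofReal_pos.2 hpow).ne'),
      ← div_eq_mul_inv]
    refine ENNReal.div_le_of_le_mul ?_
    rwa [← ENNReal.ofReal_mul' hpow.le]

variable {A : Set E} {v : E → Ω → F}

lemma exists_holderOnWith_of_le (hA : Bornology.IsBounded A) {w : E → F} {C α β : ℝ≥0}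
    (hw : HolderOnWith C β w A) (hαβ : α ≤ β) : ∃ C' : ℝ≥0, HolderOnWith C' α w A := by
  refine ⟨_, hw.of_le (D := (diam (closure A) + 1).toNNReal) (fun x hx y hy => ?_) hαβ⟩
  rw [edist_dist]
  exact ENNReal.ofReal_le_ofReal
    (dist_lt_diam_closure_add_one hA (subset_closure hx) (subset_closure hy)).le

lemma ae_forall_exists_holderOnWith_of_lt (hA : Bornology.IsBounded A) {e : ℝ}
    (h : ∀ β : ℝ≥0, 0 < β → (β : ℝ) < e →
      ∀ᵐ ω ∂P, ∃ C : ℝ≥0, HolderOnWith C β (fun x => v x ω) A) :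
    ∀ᵐ ω ∂P, ∀ α : ℝ≥0, 0 < α → (α : ℝ) < e →
      ∃ C : ℝ≥0, HolderOnWith C α (fun x => v x ω) A := by
  obtain ⟨s, hs, hdense⟩ := TopologicalSpace.exists_countable_dense ℝ≥0
  have hall : ∀ᵐ ω ∂P, ∀ β ∈ s, 0 < β → (β : ℝ) < e →
      ∃ C : ℝ≥0, HolderOnWith C β (fun x => v x ω) A :=
    (ae_ball_iff hs).2 fun β _ => Filter.eventually_imp_distrib_left.2 fun hβ =>
      Filter.eventually_imp_distrib_left.2 fun hβe => h β hβ hβe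
  filter_upwards [hall] with ω hω α hα hαe
  obtain ⟨β, hβs, hαβ, hβe⟩ := hdense.exists_between (Real.lt_toNNReal_iff_coe_lt.2 hαe)
  obtain ⟨C, hC⟩ := hω β hβs (hα.trans hαβ) (Real.lt_toNNReal_iff_coe_lt.1 hβe)
  exact exists_holderOnWith_of_le hA hC hαβ.le

variable [MeasurableSpace E] [BorelSpace E] [SecondCountableTopology E] [MeasurableSpace F]
  [BorelSpace F] [SecondCountableTopology F]

lemma ae_gagliardoEnergy_ne_top [SFinite P] {ν : Measure E} [IsFiniteMeasure ν]
    (hAm : MeasurableSet A) (hνA : ∀ᵐ a ∂ν, a ∈ A) (hvm : ∀ x ∈ A, Measurable (v x))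
    (hvc : ∀ ω, ContinuousOn (fun x => v x ω) A) {p θ C : ℝ} (hp : 0 < p)
    (hmom : ∀ x₁ ∈ A, ∀ x₂ ∈ A, ∫⁻ ω, ‖v x₁ ω - v x₂ ω‖ₑ ^ p ∂P ≤
      ENNReal.ofReal (C * ‖x₁ - x₂‖ ^ θ)) :
    ∀ᵐ ω ∂P, gagliardoEnergy ν p θ (fun x => v x ω) ≠ ∞ := by
  set vA : E → Ω → F := fun x ω => A.indicator (fun x => v x ω) x
  have hvA : ∀ x ∈ A, vA x = v x := fun x hx => funext fun ω => indicator_of_mem hx _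
  have hjoint : Measurable fun q : E × Ω => vA q.1 q.2 :=
    measurable_indicator_of_continuousOn_of_measurable hAm hvm hvc
  have hquotient : Measurable fun q : (Ω × E) × E =>
      ‖vA q.1.2 q.1.1 - vA q.2 q.1.1‖ₑ ^ p / ‖q.1.2 - q.2‖ₑ ^ θ := by
    have hfst : Measurable fun q : (Ω × E) × E => vA q.1.2 q.1.1 :=
      hjoint.comp (measurable_fst.snd.prodMk measurable_fst.fst)
    have hsnd : Measurable fun q : (Ω × E) × E => vA q.2 q.1.1 :=
      hjoint.comp (measurable_snd.prodMk measurable_fst.fst)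
    exact ((hfst.sub hsnd).enorm.pow_const _).div
      ((measurable_fst.snd.sub measurable_snd).enorm.pow_const _)
  have henergy : ∫⁻ ω, gagliardoEnergy ν p θ (fun x => vA x ω) ∂P ≠ ∞ := by
    unfold gagliardoEnergy
    rw [lintegral_lintegral_lintegral_rotate hquotient]
    refine ne_top_of_le_ne_top (b := ∫⁻ _, ∫⁻ _, ENNReal.ofReal C ∂ν ∂ν) ?_ ?_
    · simp only [lintegral_const]
      finiteness
    · refine lintegral_mono_ae (hνA.mono fun a ha => lintegral_mono_ae (hνA.mono fun b hb => ?_))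
      simp only [hvA a ha, hvA b hb]
      exact lintegral_enorm_sub_rpow_div_le hp (hmom a ha b hb)
  have hmeas : Measurable fun ω => gagliardoEnergy ν p θ (fun x => vA x ω) :=
    hquotient.lintegral_prod_right'.lintegral_prod_right'
  filter_upwards [ae_lt_top hmeas henergy] with ω hω
  rw [← gagliardoEnergy_congr_ae (hνA.mono fun x hx => congrFun (hvA x hx) ω)]
  exact hω.ne

/- Kolmogorov's continuity criterion with the non-optimal number `2 dim E` in place of `dim E`: the
Gagliardo energy is a double integral. Letting `p` grow makes up for the difference. -/
lemma ae_exists_holderOnWith_of_lintegral_le [NormedSpace ℝ E] [FiniteDimensional ℝ E] [SFinite P]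
    (hAo : IsOpen A) (hAne : A.Nonempty) (hA : Convex ℝ A) (hAb : Bornology.IsBounded A)
    (hvm : ∀ x ∈ A, Measurable (v x)) (hvc : ∀ ω, ContinuousOn (fun x => v x ω) A) {p α : ℝ≥0}
    (hp : 1 ≤ p) (hα : 0 < α) {C : ℝ}
    (hmom : ∀ x₁ ∈ A, ∀ x₂ ∈ A, ∫⁻ ω, ‖v x₁ ω - v x₂ ω‖ₑ ^ (p : ℝ) ∂P ≤
      ENNReal.ofReal (C * ‖x₁ - x₂‖ ^ (2 * Module.finrank ℝ E + p * α : ℝ))) :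
    ∀ᵐ ω ∂P, ∃ C : ℝ≥0, HolderOnWith C α (fun x => v x ω) A := by
  have := cond_isProbabilityMeasure_of_finite (hAo.measure_pos Measure.addHaar hAne).ne'
    hAb.measure_lt_top.ne
  filter_upwards [ae_gagliardoEnergy_ne_top (ν := Measure.addHaar[|A]) hAo.measurableSet
    (ae_cond_mem hAo.measurableSet) hvm hvc (one_pos.trans_le hp) hmom] with ω hω
  exact exists_holderOnWith_of_gagliardoEnergy_ne_top hAo hAne hA hAb (hvc ω) hp hα hω

lemma ae_forall_exists_holderOnWith_of_lintegral_le [NormedSpace ℝ E] [FiniteDimensional ℝ E]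
    [SFinite P] (hAo : IsOpen A) (hAne : A.Nonempty) (hA : Convex ℝ A)
    (hAb : Bornology.IsBounded A) (hvm : ∀ x ∈ A, Measurable (v x))
    (hvc : ∀ ω, ContinuousOn (fun x => v x ω) A) {e : ℝ} {ξ : ℝ → ℝ}
    (hξ : ∀ γ, 0 < γ → e - γ ≤ ξ γ)
    (hmom : ∀ γ : ℝ, 0 < γ → γ < 1 → ∀ p : ℝ≥0, 2 ≤ p → ∃ C : ℝ, 0 < C ∧ ∀ x₁ ∈ A, ∀ x₂ ∈ A,
      ∫⁻ ω, ‖v x₁ ω - v x₂ ω‖ₑ ^ (p : ℝ) ∂P ≤ ENNReal.ofReal (C * ‖x₁ - x₂‖ ^ (p * ξ γ))) :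
    ∀ᵐ ω ∂P, ∀ α : ℝ≥0, 0 < α → (α : ℝ) < e →
      ∃ C : ℝ≥0, HolderOnWith C α (fun x => v x ω) A := by
  refine ae_forall_exists_holderOnWith_of_lt hAb fun α hα hαe => ?_
  have hgap : 0 < e - α := sub_pos.2 hαe
  have hα' : (0 : ℝ) < α := hα
  obtain ⟨n, hn⟩ := exists_nat_gt ((1 + 2 * Module.finrank ℝ E) / (e - α))
  rw [div_lt_iff₀ hgap] at hn
  set p : ℝ≥0 := n + 2
  have hp : (p : ℝ) = n + 2 := by simp [p]
  have hp0 : (0 : ℝ) < p := by positivity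
  obtain ⟨β, hβ⟩ : ∃ β : ℝ, β = ξ (1 / p) - 2 * Module.finrank ℝ E / p := ⟨_, rfl⟩
  have hαβ : α < β := by
    have hξp := hξ (1 / p) (by positivity)
    have hsmall : 1 / p + 2 * Module.finrank ℝ E / p < e - α := by
      rw [← add_div, div_lt_iff₀ hp0]
      nlinarith
    linarith
  lift β to ℝ≥0 using (hα'.trans hαβ).le
  obtain ⟨C, -, hC⟩ := hmom (1 / p) (by positivity)
    ((div_lt_one hp0).2 (by rw [hp]; linarith [n.cast_nonneg (α := ℝ)])) p (by simp [p])
  have hexponent : (p : ℝ) * ξ (1 / p) = 2 * Module.finrank ℝ E + p * β := by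
    rw [hβ]
    field_simp
    ring
  simp only [hexponent] at hC
  filter_upwards [ae_exists_holderOnWith_of_lintegral_le hAo hAne hA hAb hvm hvc
    (one_le_two.trans (by simp [p])) (hα.trans hαβ) hC] with ω ⟨C', hC'⟩
  exact exists_holderOnWith_of_le hAb hC' hαβ.le

end PathRegularity

end EllipticSPDE

end

open EllipticSPDE in
theorem mainTheorem5_general {Ω : Type*} [MeasurableSpace Ω] (P : Measure Ω)
    {k d : ℕ} (D : Set (Euc k)) (G : Euc k → Euc k → ℝ) (hG : IsDomainWithGreen k D G)
    (hK : greenSup D G ≠ ∞)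
    (f : Euc d → Euc d) (F : L2 D d → L2 D d) (hF : IsNemytskii D f F)
    (g : Euc k → Euc d) (hg : MemLp g 2 (volume.restrict D))
    (σ : Matrix (Fin d) (Fin d) ℝ) (hC : CondC F) (L : ℝ)
    (hmono : ∀ v w : L2 D d, -(L * ‖v - w‖ ^ 2) ≤ ⟪v - w, F v - F w⟫)
    (a : ℝ) (ha : IsPoincareConst D G d a) (hLa : L < a)
    (W : Fin d → Lp ℝ 2 (volume : Measure (Euc k)) → Ω → ℝ) (hW : IsWhiteNoise P k d W)
    (u : Euc k → Ω → Euc d) (hu : IsMildSolution P D G f g σ W u)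
    (A : Set (Euc k)) (hA : IsRegion D A) :
    (∀ γ : ℝ, 0 < γ → γ < 1 → ∀ p : ℝ, 2 ≤ p → ∃ C : ℝ, 0 < C ∧ ∀ x₁ ∈ A, ∀ x₂ ∈ A,
      ∫⁻ ω, ‖u x₁ ω - u x₂ ω‖ₑ ^ p ∂P ≤
        ENNReal.ofReal (C * ‖x₁ - x₂‖ ^ (p * momentExponent k γ))) ∧
    ∀ᵐ ω ∂P, ∀ α : ℝ≥0, 0 < α → (α : ℝ) < pathExponent k →
      ∃ C : ℝ≥0, HolderOnWith C α (fun x => u x ω) A := by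
  have hGK := hG.isHolderKernel hK
  have : NeZero k := ⟨hGK.pos.ne'⟩
  have := hW.gaussian.isProbabilityMeasure
  have := isFiniteMeasure_restrict_of_isBounded hGK.isBounded
  have := neZero_restrict_of_isOpen hGK.isOpen hGK.nonempty
  have hf := hF.continuous_of_continuous hC.1
  obtain ⟨B, hB⟩ := hF.exists_norm_le_of_mild hGK hC.2 ha hLa hmono
  obtain ⟨v, hv, hvu⟩ := hu.exists_isContinuousMildSolution hGK hf hg
  have hmom (γ : ℝ) (hγ₀ : 0 < γ) (hγ₁ : γ < 1) (p : ℝ≥0) (hp : 2 ≤ p) :=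
    hv.exists_lintegral_enorm_sub_rpow_le hGK hf hg hW (one_le_two.trans hp)
      (hv.eLpNorm_eLpNorm_comp_ne_top hGK hK hf hF hg hB hW hp) hA hγ₀ hγ₁
  refine ⟨fun γ hγ₀ hγ₁ p hp => ?_, ?_⟩
  · lift p to ℝ≥0 using zero_le_two.trans hp
    obtain ⟨C, hC₀, hCmom⟩ := hmom γ hγ₀ hγ₁ p (mod_cast hp)
    refine ⟨C, hC₀, fun x₁ hx₁ x₂ hx₂ => (lintegral_congr_ae ?_).trans_le (hCmom x₁ hx₁ x₂ hx₂)⟩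
    filter_upwards [hvu] with ω hω
    rw [hω x₁, hω x₂]
  · filter_upwards [ae_forall_exists_holderOnWith_of_lintegral_le (hA.isOpen hGK.isOpen)
      (hA.nonempty hGK.nonempty) (hA.convex hG) (hGK.isBounded.subset hA.subset)
      (fun x hx => hv.measurable x (hA.subset hx))
      (fun ω => (hv.continuousOn ω).mono (hA.subset.trans subset_closure))
      (fun γ hγ => hG.pathExponent_sub_le_momentExponent hγ.le) hmom, hvu] with ω hω hvω
    simpa only [hvω] using hω

open EllipticSPDE in
theorem mainTheorem5 {Ω : Type*} [MeasurableSpace Ω] (P : Measure Ω) [IsProbabilityMeasure P]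
    {k d : ℕ} (D : Set (Euc k)) (G : Euc k → Euc k → ℝ) (hG : IsDomainWithGreen k D G)
    (f : Euc d → Euc d) (F : L2 D d → L2 D d) (hF : IsNemytskii D f F)
    (g : Euc k → Euc d) (hg : MemLp g 2 (volume.restrict D))
    (σ : Matrix (Fin d) (Fin d) ℝ) (hσ : σ.det ≠ 0)
    (hC : CondC F) (L : ℝ) (hM : CondMbar D F L)
    (a : ℝ) (ha : IsPoincareConst D G d a) (hLa : L < a)
    (hLK : ENNReal.ofReal L < (greenSup D G * volume D ^ (1 / 2 : ℝ))⁻¹)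
    (W : Fin d → Lp ℝ 2 (volume : Measure (Euc k)) → Ω → ℝ) (hW : IsWhiteNoise P k d W)
    (u : Euc k → Ω → Euc d) (hu : IsMildSolution P D G f g σ W u)
    -- the region: all of `D` in dimension one, else a ball whose closure lies in `D`
    (A : Set (Euc k))
    (hA : (k = 1 ∧ A = D) ∨ ∃ (c : Euc k) (r : ℝ), 0 < r ∧ closedBall c r ⊆ D ∧ A = ball c r) :
    (∀ γ : ℝ, 0 < γ → γ < 1 → ∀ p : ℝ, 2 ≤ p → ∃ C : ℝ, 0 < C ∧ ∀ x₁ ∈ A, ∀ x₂ ∈ A,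
      ∫⁻ ω, ‖u x₁ ω - u x₂ ω‖ₑ ^ p ∂P ≤
        ENNReal.ofReal (C * ‖x₁ - x₂‖ ^ (p * momentExponent k γ))) ∧
    ∀ᵐ ω ∂P, ∀ α : ℝ≥0, 0 < α → (α : ℝ) < pathExponent k →
      ∃ C : ℝ≥0, HolderOnWith C α (fun x => u x ω) A := by
  have hK := greenSup_ne_top hG.volume_ne_zero hLK
  have hGK := hG.isHolderKernel hK
  have : NeZero k := ⟨hGK.pos.ne'⟩
  have := isFiniteMeasure_restrict_of_isBounded hGK.isBounded
  exact mainTheorem5_general P D G hG hK f F hF g hg σ hC L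
    (hM.neg_le_inner hGK.isOpen hGK.nonempty) a ha hLa W hW u hu A hA
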